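/- Let $a>0$, $\varkappa>0$, $c_0\in\mathbb R$, and let $\phi_0:\mathbb R^2\to\mathbb R$ be a $C^1$ function whose gradient does not vanish on the curve $\{\phi_0=c_0\}$ and for which $D=\{y\in\mathbb R^2:\phi_0(y)<c_0\}$ is bounded. Let $\Omega=D\times(-a,a)\subset\mathbb R^3$, with lateral boundary $S_1=\partial D\times(-a,a)$, bases $S_2(\pm a)=D\times\{\pm a\}$, $S=\partial\Omega$, and outward unit normal $\bar n$. Let $d_1,d_2\ge 0$ be such that $d_1\in L_2(\mathbb R_+;L_\infty(S_2(-a)))$ and $d_2\in L_1(S_2(a)\times(0,T))$ for every $T>0$. Let $v$ be a velocity field with $v\in L_2(0,T;L_2(\Omega)^3)$ for every $T>0$, such that, for a.e. $t>0$, in the weak sense, $\operatorname{div}v=0$ in $\Omega$, $v\cdot\bar n=0$ on $S_1$, $v\cdot\bar n=-d_1$ on $S_2(-a)$ and $v\cdot\bar n=d_2$ on $S_2(a)$; that is, for all $\psi\in C_c^\infty(\mathbb R^3)$, $$\int_\Omega v(t)\cdot\nabla\psi\,dx=\int_{S_2(a)}d_2(t)\,\psi\,dS_2-\int_{S_2(-a)}d_1(t)\,\psi\,dS_2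 .$$ Let $0<\theta_*<\theta^*$ be constants and let $\theta_0$ be measurable with $\theta_*\le\theta_0\le\theta^*$ a.e. in $\Omega$. Let $\theta$ be a weak solution of $$\theta_t+v\cdot\nabla\theta-\varkappa\Delta\theta=0\ \text{ in }\Omega\times\mathbb R_+,\qquad \bar n\cdot\nabla\theta=0\ \text{ on }S\times\mathbb R_+,\qquad \theta|_{t=0}=\theta_0 ;$$ that is, $\theta\in L_\infty(0,T;L_2(\Omega))\cap L_2(0,T;H^1(\Omega))$ for every $T>0$, and for all $\varphi\in H^1(\Omega)\cap L_\infty(\Omega)$ and $\eta\in C_c^\infty(\mathbb R)$ $$-\int_0^\infty\eta'(t)\int_\Omega\theta\,\varphi\,dx\,dt+\int_0^\infty\eta(t)\int_\Omega\bigl(\varkappa\nabla\theta\cdot\nabla\varphi+(v\cdot\nabla\theta)\,\varphi\bigr)dx\,dt=\eta(0)\int_\Omega\theta_0\,\varphi\,dx .$$ Then, for a.e. $t>0$, $$\theta_*\le\theta(x,t)\le\theta^*\qquad\text{for a.e. }x\in\Omega .$$ -/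

import Mathlib

open MeasureTheory Set
open scoped Gradient ContDiff NNReal

noncomputable section

namespace HeatFlow

/-- The plane of the cross-section variables `(x₁, x₂)`. -/
abbrev E2 : Type := EuclideanSpace ℝ (Fin 2)

/-- The physical space, with points `x = (x₁, x₂, x₃)`. -/
abbrev E3 : Type := EuclideanSpace ℝ (Fin 3)

/-- The data of the cross-section: `φ₀(x₁, x₂) = c₀` is a regular `C¹` curve (the gradient of `φ₀`
does not vanish on it) and the region `φ₀ < c₀` that it encloses is bounded. -/
structure IsCrossSection (φ₀ : E2 → ℝ) (c₀ : ℝ) : Prop where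
  contDiff : ContDiff ℝ 1 φ₀
  regular : ∀ y, φ₀ y = c₀ → ∇ φ₀ y ≠ 0
  bounded : Bornology.IsBounded {y | φ₀ y < c₀}

/-- The cross-section `{φ₀ < c₀}`. Both bases `S₂(-a)`, `S₂(a)` of the cylinder are translates of
it, so a function on a base is a function of `y = (x₁, x₂)` in the cross-section and the surface
measure `dS₂` is the Lebesgue measure on it. -/
def section2 (φ₀ : E2 → ℝ) (c₀ : ℝ) : Set E2 := {y | φ₀ y < c₀}

/-- The point `(y₁, y₂, h)`. -/
def atHeight (y : E2) (h : ℝ) : E3 := !₂[y 0, y 1, h]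

/-- The finite cylinder `Ω = {x : φ₀(x₁, x₂) < c₀, -a < x₃ < a}`. -/
def cylinder (φ₀ : E2 → ℝ) (c₀ a : ℝ) : Set E3 :=
  {x | φ₀ !₂[x 0, x 1] < c₀ ∧ -a < x 2 ∧ x 2 < a}

/-- `u ∈ H¹(Ω)` and `G ∈ L₂(Ω)³` is its weak gradient on the open set `Ω`. -/
structure HasH1Gradient (Ω : Set E3) (u : E3 → ℝ) (G : E3 → E3) : Prop where
  memLp : MemLp u 2 (volume.restrict Ω)
  memLp_grad : MemLp G 2 (volume.restrict Ω)
  integral_eq : ∀ ψ : E3 → ℝ, ContDiff ℝ ∞ ψ → HasCompactSupport ψ → tsupport ψ ⊆ Ω →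
    ∫ x in Ω, u x • ∇ ψ x = -∫ x in Ω, ψ x • G x

/-- `θ ∈ L_∞(0,T; L₂(Ω)) ∩ L₂(0,T; H¹(Ω))` for every `T > 0`, with weak spatial gradient `G`. -/
structure InEnergyClass (Ω : Set E3) (θ : ℝ → E3 → ℝ) (G : ℝ → E3 → E3) : Prop where
  memLp : ∀ T : ℝ, 0 < T →
    MemLp (Function.uncurry θ) 2 (volume.restrict (Ioo 0 T ×ˢ Ω))
  memLp_grad : ∀ T : ℝ, 0 < T →
    MemLp (Function.uncurry G) 2 (volume.restrict (Ioo 0 T ×ˢ Ω))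
  hasGradient : ∀ᵐ t ∂(volume.restrict (Ioi (0 : ℝ))), HasH1Gradient Ω (θ t) (G t)
  essBounded : ∀ T : ℝ, 0 < T → ∃ C : ℝ≥0, ∀ᵐ t ∂(volume.restrict (Ioo (0 : ℝ) T)),
    eLpNorm (θ t) 2 (volume.restrict Ω) ≤ C

/-- The flux data on the bases `S₂(-a)` (inflow `d₁`) and `S₂(a)` (outflow `d₂`), both
nonnegative: `d₁ ∈ L₂(ℝ₊; L_∞(S₂(-a)))`, and `d₂` integrable on `S₂(a) × (0,T)` for all `T`,
which is what is needed to write down the boundary condition for the velocity. -/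
structure IsFluxData (D : Set E2) (d₁ d₂ : ℝ → E2 → ℝ) : Prop where
  measurable₁ : AEStronglyMeasurable (Function.uncurry d₁) (volume.restrict (Ioi (0 : ℝ) ×ˢ D))
  memL2Linfty₁ : ∫⁻ t in Ioi (0 : ℝ), (eLpNorm (d₁ t) ⊤ (volume.restrict D)) ^ 2 < ⊤
  integrable₂ : ∀ T : ℝ, 0 < T → IntegrableOn (Function.uncurry d₂) (Ioo 0 T ×ˢ D)
  nonneg₁ : ∀ᵐ p ∂(volume.restrict (Ioi (0 : ℝ) ×ˢ D)), 0 ≤ Function.uncurry d₁ p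
  nonneg₂ : ∀ᵐ p ∂(volume.restrict (Ioi (0 : ℝ) ×ˢ D)), 0 ≤ Function.uncurry d₂ p

/-- The conditions on the velocity: `v ∈ L₂(0,T; L₂(Ω)³)` for every `T > 0`, and for almost every
`t > 0`, in the weak sense, `div v = 0` in `Ω`, `v · n = 0` on the lateral surface `S₁`,
`v · n = -d₁` on `S₂(-a)` and `v · n = d₂` on `S₂(a)`. The normal trace is given by the Gauss-Green
identity `∫_Ω v · ∇ψ + ∫_Ω (div v) ψ = ∫_S (v · n) ψ dS` with `div v = 0`, for all `ψ` that are
smooth up to the boundary. -/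
structure IsVelocity (φ₀ : E2 → ℝ) (c₀ a : ℝ) (d₁ d₂ : ℝ → E2 → ℝ) (v : ℝ → E3 → E3) :
    Prop where
  memLp : ∀ T : ℝ, 0 < T →
    MemLp (Function.uncurry v) 2 (volume.restrict (Ioo 0 T ×ˢ cylinder φ₀ c₀ a))
  gauss_green : ∀ᵐ t ∂(volume.restrict (Ioi (0 : ℝ))),
    ∀ ψ : E3 → ℝ, ContDiff ℝ ∞ ψ → HasCompactSupport ψ →
      ∫ x in cylinder φ₀ c₀ a, inner ℝ (v t x) (∇ ψ x) =
        (∫ y in section2 φ₀ c₀, d₂ t y * ψ (atHeight y a)) -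
          ∫ y in section2 φ₀ c₀, d₁ t y * ψ (atHeight y (-a))

/-- `θ` is a weak solution of
`θ_t + v · ∇θ - ϰ Δθ = 0` in `Ω × ℝ₊`, `n · ∇θ = 0` on the boundary of `Ω`, `θ|_{t=0} = θ₀`:
it lies in the energy class, and for every bounded `φ ∈ H¹(Ω)`
`d/dt ∫_Ω θ φ + ϰ ∫_Ω ∇θ · ∇φ + ∫_Ω (v · ∇θ) φ = 0` in the sense of distributions in time, with
initial value `∫_Ω θ₀ φ`. -/
def IsWeakHeatSolution (Ω : Set E3) (ϰ : ℝ) (v : ℝ → E3 → E3) (θ₀ : E3 → ℝ)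
    (θ : ℝ → E3 → ℝ) : Prop :=
  ∃ G : ℝ → E3 → E3, InEnergyClass Ω θ G ∧
    ∀ (φ : E3 → ℝ) (Φ : E3 → E3), HasH1Gradient Ω φ Φ →
      (∃ M : ℝ, ∀ᵐ x ∂(volume.restrict Ω), |φ x| ≤ M) →
      ∀ η : ℝ → ℝ, ContDiff ℝ ∞ η → HasCompactSupport η →
        -(∫ t in Ioi (0 : ℝ), deriv η t * ∫ x in Ω, θ t x * φ x)
          + (∫ t in Ioi (0 : ℝ), η t *
              ∫ x in Ω, (ϰ * inner ℝ (G t x) (Φ x) + inner ℝ (v t x) (G t x) * φ x))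
          = η 0 * ∫ x in Ω, θ₀ x * φ x

end HeatFlow

end

set_option linter.unusedSectionVars false

namespace HeatFlow

open Filter Topology ENNReal ContinuousLinearMap

/-! ### Continuity of measure-preserving flows in `L^p` and mollification -/

section Flow

variable {X H E : Type*} [TopologicalSpace X] [MeasurableSpace X] [BorelSpace X] [R1Space X]
  [TopologicalSpace H] [NormedAddCommGroup E] {μ : Measure X} [μ.InnerRegularCompactLTTop]
  [IsLocallyFiniteMeasure μ] {p q : ℝ≥0∞}

/-! The proof is Stampacchia's truncation method. Put W = (θ - k)₊ with k = θ^*. Formally, testing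
the equation with W gives d/dt ∫ W²/2 + ϰ ∫ |∇W|² = -∫ v · ∇(W²/2), and the right side is the
integral of d₁ W²/2 over the lower base minus that of d₂ W²/2 over the upper base. The outflow has a
good sign and is dropped. With m(t) the sup norm of d₁(t), the inflow is at most m times the trace
of W²/2, and a W^{1,1} trace inequality bounds it by m C ∫ (W²/2 + W |∇W|). Young's inequality
absorbs the gradient into the dissipation, so E = ∫ W²/2 satisfies E' ≤ (C m + C² m²/(2ϰ)) E with
E(0) = 0. The coefficient is locally integrable because m ∈ L₂, and Grönwall gives E = 0. The lower
bound is the same statement for -θ and k = -θ_*.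

Three points need work at this regularity.

Gauss-Green is given for smooth ψ only, but is needed for H¹ functions. No trace is constructed:
`IsCrossSection.exists_flux_const` is an inequality between volume integrals, which survives
approximation. A nonnegative u ∈ H¹ is localised by a partition of unity, shifted along the
direction of the segment property and mollified. This yields nonnegative smooth functions whose
gradient on Ω is the shifted mollification of the gradient of u.

The product v · ∇θ is only integrable in space-time, so test functions must be bounded and W is not
admissible. It is replaced by `ramp n (θ - k)`, and W²/2 by the primitive `rampInt n (θ - k)`; the
limit in n is taken by dominated convergence in `energy_inequality`.

No time derivative of θ is available to pair with a function of θ. In `entropy_inequality` the test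
function is frozen at a time t, the weak identity differentiates a time correlation, and convexity
passes from the correlation to the energy. Extending θ by θ₀ to negative times builds in the initial
condition. The resulting distributional inequality is closed by
`ae_le_intervalIntegral_of_distributional` and `eq_zero_of_le_intervalIntegral`. -/

theorem tendsto_eLpNorm_comp_sub (T : H → X → X) (hT : Continuous (Function.uncurry T))
    (hm : ∀ h, MeasurePreserving (T h) μ μ) (hp1 : 1 ≤ p) (hp : p ≠ ⊤) {f : X → E}
    (hf : MemLp f p μ) (h₀ : H) :
    Tendsto (fun h ↦ eLpNorm (fun x ↦ f (T h x) - f (T h₀ x)) p μ) (𝓝 h₀) (𝓝 0) := by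
  have : Fact (1 ≤ p) := ⟨hp1⟩
  -- Currying turns joint continuity of the flow into continuity for the compact-open topology, the
  -- one for which composition with measure-preserving maps is continuous on `Lp`.
  let g : C(H, C(X, X)) := (ContinuousMap.mk _ hT).curry
  have key : Tendsto (fun h ↦ Lp.compMeasurePreserving (g h) (hm h) (hf.toLp f)) (𝓝 h₀)
      (𝓝 (Lp.compMeasurePreserving (g h₀) (hm h₀) (hf.toLp f))) :=
    Filter.Tendsto.compMeasurePreservingLp tendsto_const_nhds (g.continuous.tendsto h₀) hm (hm h₀) hp
  have h2 : ∀ h, Lp.compMeasurePreserving (g h) (hm h) (hf.toLp f)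
      = (hf.comp_measurePreserving (hm h)).toLp (f ∘ T h) := fun h ↦
    Lp.toLp_compMeasurePreserving hf (hm h)
  simp only [h2] at key
  exact (Lp.tendsto_Lp_iff_tendsto_eLpNorm'' _ (fun h ↦ hf.comp_measurePreserving (hm h)) _
    (hf.comp_measurePreserving (hm h₀))).1 key

variable [InnerProductSpace ℝ E]

theorem integrable_inner_of_memLp [p.HolderTriple q 1] {v f : X → E} (hv : MemLp v p μ)
    (hf : MemLp f q μ) : Integrable (fun x ↦ inner ℝ (v x) (f x)) μ := by
  rw [← memLp_one_iff_integrable]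
  refine MemLp.of_bilin (p := p) (q := q) (fun a b ↦ inner ℝ a b) 1 hv hf
    (hv.1.inner hf.1) (Eventually.of_forall fun x ↦ ?_)
  simpa using nnnorm_inner_le_nnnorm (𝕜 := ℝ) (v x) (f x)

/-- By Hölder only the moving factor `f` needs a finite exponent, so the pair `(⊤, 1)` is allowed as
well as `(2, 2)`. It serves both for translations in space and for shifts in time. -/
theorem continuous_integral_inner_comp [p.HolderTriple q 1] (T : H → X → X)
    (hT : Continuous (Function.uncurry T)) (hm : ∀ h, MeasurePreserving (T h) μ μ)
    (hq1 : 1 ≤ q) (hq : q ≠ ⊤) {v f : X → E} (hv : MemLp v p μ) (hf : MemLp f q μ) :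
    Continuous fun h ↦ ∫ x, inner ℝ (v x) (f (T h x)) ∂μ := by
  rw [continuous_iff_continuousAt]
  intro h₀
  have hfT : ∀ h, MemLp (fun x ↦ f (T h x)) q μ := fun h ↦ hf.comp_measurePreserving (hm h)
  refine tendsto_integral_of_L1' _ (integrable_inner_of_memLp hv (hfT h₀)).1
    (Eventually.of_forall fun h ↦ integrable_inner_of_memLp hv (hfT h)) ?_
  have h1 := tendsto_eLpNorm_comp_sub T hT hm hq1 hq hf h₀
  have h2 : Tendsto (fun h ↦ eLpNorm v p μ * eLpNorm (fun x ↦ f (T h x) - f (T h₀ x)) q μ)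
      (𝓝 h₀) (𝓝 0) := by
    simpa using ENNReal.Tendsto.const_mul h1 (Or.inr hv.2.ne)
  refine tendsto_of_tendsto_of_tendsto_of_le_of_le tendsto_const_nhds h2 (fun _ ↦ zero_le)
    fun h ↦ ?_
  have := eLpNorm_le_eLpNorm_mul_eLpNorm_of_nnnorm (p := p) (q := q) (r := 1) hv.1
    ((hfT h).1.sub (hfT h₀).1) (fun a b ↦ inner ℝ a b) 1
    (Eventually.of_forall fun x ↦ by
      simpa using nnnorm_inner_le_nnnorm (𝕜 := ℝ) (v x) (f (T h x) - f (T h₀ x)))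
  simpa [inner_sub_right, Pi.sub_def] using this

end Flow

/-! ### Mollification: strong convergence in L¹, weak convergence in L² -/

section Mollify

variable {V E : Type*} [NormedAddCommGroup V] [NormedSpace ℝ V] [FiniteDimensional ℝ V]
  [MeasurableSpace V] [BorelSpace V] {μ : Measure V} [μ.IsAddHaarMeasure]
  [NormedAddCommGroup E] [InnerProductSpace ℝ E] [CompleteSpace E]

theorem measurePreserving_add_const (h : V) : MeasurePreserving (fun x ↦ x + h) μ μ :=
  measurePreserving_add_right μ h

theorem continuous_uncurry_add_const :
    Continuous (Function.uncurry fun (h : V) (x : V) ↦ x + h) :=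
  continuous_snd.add continuous_fst

theorem integral_bump_convolution_smul {φ : ContDiffBump (0 : V)} (c : E) :
    ∫ y, φ.normed μ y • c ∂μ = c := by
  rw [integral_smul_const, φ.integral_normed, one_smul]

/-- Mollification converges in `L¹`. -/
theorem tendsto_eLpNorm_one_convolution_sub {φ : ℕ → ContDiffBump (0 : V)}
    (hφ : Tendsto (fun n ↦ (φ n).rOut) atTop (𝓝 0)) {f : V → E} (hf : Integrable f μ) :
    Tendsto (fun n ↦ eLpNorm (fun x ↦ convolution ((φ n).normed μ) f (lsmul ℝ ℝ) μ x - f x) 1 μ)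
      atTop (𝓝 0) := by
  have hf1 : MemLp f 1 μ := memLp_one_iff_integrable.2 hf
  have key := tendsto_eLpNorm_comp_sub (fun (h : V) (x : V) ↦ x + h)
    continuous_uncurry_add_const (fun h ↦ measurePreserving_add_const (μ := μ) h) le_rfl
    ENNReal.one_ne_top hf1 0
  rw [ENNReal.tendsto_atTop_zero]
  intro ε hε
  rw [ENNReal.tendsto_nhds_zero] at key
  obtain ⟨δ, hδ, hδ'⟩ := Metric.eventually_nhds_iff_ball.1 (key ε hε)
  obtain ⟨N, hN⟩ := (Metric.tendsto_atTop.1 hφ) δ hδ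
  refine ⟨N, fun n hn ↦ ?_⟩
  have hr : (φ n).rOut < δ := by
    have := hN n hn
    rw [Real.dist_eq, sub_zero] at this
    exact (le_abs_self _).trans_lt this
  have hρi : Integrable ((φ n).normed μ) μ := (φ n).integrable_normed
  have hconv := hρi.ae_convolution_exists (lsmul ℝ ℝ) hf
  have hmeas : AEMeasurable (fun z : V × V ↦ ‖(φ n).normed μ z.2 • (f (z.1 - z.2) - f z.1)‖ₑ)
      (μ.prod μ) := by
    have h1 := (hρi.convolution_integrand (lsmul ℝ ℝ) hf).1
    have h2 : AEStronglyMeasurable (fun z : V × V ↦ (φ n).normed μ z.2 • f z.1) (μ.prod μ) :=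
      (hρi.1.comp_snd).smul (hf.1.comp_fst)
    have := (h1.sub h2).enorm
    refine this.congr (Eventually.of_forall fun z ↦ ?_)
    simp [smul_sub]
  rw [eLpNorm_one_eq_lintegral_enorm]
  -- The error is an average over `y` of the differences `f (x - y) - f x`. Tonelli bounds its norm
  -- by the average of the L¹ moduli of continuity, each at most `ε` because `y` ranges over a ball
  -- of radius less than `δ`.
  calc ∫⁻ x, ‖convolution ((φ n).normed μ) f (lsmul ℝ ℝ) μ x - f x‖ₑ ∂μ
      ≤ ∫⁻ x, ∫⁻ y, ‖(φ n).normed μ y • (f (x - y) - f x)‖ₑ ∂μ ∂μ := by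
        refine lintegral_mono_ae ?_
        filter_upwards [hconv] with x hx
        have : convolution ((φ n).normed μ) f (lsmul ℝ ℝ) μ x - f x
            = ∫ y, (φ n).normed μ y • (f (x - y) - f x) ∂μ := by
          have h1 : Integrable (fun y ↦ (φ n).normed μ y • f (x - y)) μ := hx
          have h2 : Integrable (fun y ↦ (φ n).normed μ y • f x) μ := hρi.smul_const _
          simp only [smul_sub]
          rw [integral_sub h1 h2, integral_bump_convolution_smul]
          rfl
        rw [this]
        exact enorm_integral_le_lintegral_enorm _
    _ = ∫⁻ y, ∫⁻ x, ‖(φ n).normed μ y • (f (x - y) - f x)‖ₑ ∂μ ∂μ :=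
        lintegral_lintegral_swap hmeas
    _ ≤ ∫⁻ y, ‖(φ n).normed μ y‖ₑ * ε ∂μ := by
        refine lintegral_mono fun y ↦ ?_
        simp only [enorm_smul]
        rw [lintegral_const_mul' _ _ enorm_ne_top]
        by_cases hy : y ∈ Metric.ball (0 : V) (φ n).rOut
        · gcongr
          have := hδ' (-y) (by
            rw [mem_ball_zero_iff, norm_neg]
            exact (mem_ball_zero_iff.1 hy).trans hr)
          simpa [eLpNorm_one_eq_lintegral_enorm, sub_eq_add_neg] using this
        · have : (φ n).normed μ y = 0 := by
            rw [← Function.notMem_support, (φ n).support_normed_eq]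
            exact hy
          simp [this]
    _ = ε := by
        have h1 : ∫⁻ y, ‖(φ n).normed μ y‖ₑ ∂μ = 1 := by
          rw [← ofReal_integral_norm_eq_lintegral_enorm hρi]
          simp [abs_of_nonneg ((φ n).nonneg_normed _), (φ n).integral_normed]
        rw [lintegral_mul_const'' _ hρi.1.enorm, h1, one_mul]

/-- The convolution with an `L¹` function of mass `m` is a bounded operator on `L¹`. -/
theorem integral_norm_convolution_le {ρ : V → ℝ} {f : V → E} (hρ : Integrable ρ μ)
    (hf : Integrable f μ) :
    ∫ x, ‖convolution ρ f (lsmul ℝ ℝ) μ x‖ ∂μ ≤ (∫ x, ‖ρ x‖ ∂μ) * ∫ x, ‖f x‖ ∂μ := by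
  have h1 : Integrable (convolution ρ f (lsmul ℝ ℝ) μ) μ := hρ.integrable_convolution _ hf
  have h2 : Integrable (convolution (fun x ↦ ‖ρ x‖) (fun x ↦ ‖f x‖) (lsmul ℝ ℝ) μ) μ :=
    hρ.norm.integrable_convolution _ hf.norm
  calc _ ≤ ∫ x, convolution (fun x ↦ ‖ρ x‖) (fun x ↦ ‖f x‖) (lsmul ℝ ℝ) μ x ∂μ := by
        refine integral_mono h1.norm h2 fun x ↦ ?_
        refine (norm_integral_le_integral_norm _).trans_eq ?_
        simp [convolution, norm_smul]
    _ = _ := by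
        rw [integral_convolution (lsmul ℝ ℝ) hρ.norm hf.norm]
        simp

/-- The pairing with a translated mollification is an average of pairings with translations. -/
theorem integral_inner_convolution_add {ρ : V → ℝ} (hρ : Continuous ρ)
    (hρc : HasCompactSupport ρ) {v f : V → E} (hv : MemLp v 2 μ) (hf : MemLp f 2 μ) (e : V) :
    ∫ x, inner ℝ (v x) (convolution ρ f (lsmul ℝ ℝ) μ (x + e)) ∂μ
      = ∫ y, ρ y * ∫ x, inner ℝ (v x) (f (x + (e - y))) ∂μ ∂μ := by
  have hρi : Integrable ρ μ := hρ.integrable_of_hasCompactSupport hρc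
  have hfl : LocallyIntegrable f μ := hf.locallyIntegrable one_le_two
  -- The correlation of the norms is continuous in the shift, hence integrable against the compactly
  -- supported `ρ`; this justifies Fubini.
  have hcont : Continuous fun h ↦ ∫ x, ‖v x‖ * ‖f (x + h)‖ ∂μ := by
    have := continuous_integral_inner_comp (E := ℝ) (p := 2) (q := 2)
      (fun (h : V) (x : V) ↦ x + h) continuous_uncurry_add_const
      (fun h ↦ measurePreserving_add_const (μ := μ) h) one_le_two (by simp) hv.norm hf.norm
    simpa [mul_comm] using this
  have hmeas : AEStronglyMeasurable (fun z : V × V ↦ ρ z.2 • inner ℝ (v z.1) (f (z.1 + (e - z.2))))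
      (μ.prod μ) := by
    refine (hρ.aestronglyMeasurable.comp_snd).smul (hv.1.comp_fst.inner ?_)
    have h1 : AEStronglyMeasurable (fun x ↦ f (x + e)) μ :=
      hf.1.comp_measurePreserving (measurePreserving_add_const e)
    have h2 := h1.comp_quasiMeasurePreserving (quasiMeasurePreserving_sub μ μ)
    refine h2.congr (Eventually.of_forall fun z ↦ ?_)
    simp only [Function.comp_apply]
    congr 1; abel
  have hint : Integrable (fun z : V × V ↦ ρ z.2 • inner ℝ (v z.1) (f (z.1 + (e - z.2))))
      (μ.prod μ) := by
    rw [integrable_prod_iff' hmeas]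
    constructor
    · refine Eventually.of_forall fun y ↦ ?_
      exact (integrable_inner_of_memLp (p := 2) (q := 2) hv
        (hf.comp_measurePreserving (measurePreserving_add_const (e - y)))).smul (ρ y)
    · have hb : Integrable (fun y ↦ ‖ρ y‖ * ∫ x, ‖v x‖ * ‖f (x + (e - y))‖ ∂μ) μ := by
        refine Continuous.integrable_of_hasCompactSupport
          (hρ.norm.mul (hcont.comp (continuous_const.sub continuous_id))) ?_
        exact (hρc.norm).mul_right
      refine hb.mono' ?_ (Eventually.of_forall fun y ↦ ?_)
      · exact hmeas.norm.prod_swap.integral_prod_right'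
      · rw [Real.norm_of_nonneg (integral_nonneg fun _ ↦ norm_nonneg _), ← integral_const_mul]
        refine integral_mono_of_nonneg (Eventually.of_forall fun _ ↦ norm_nonneg _) ?_
          (Eventually.of_forall fun x ↦ ?_)
        · refine Integrable.const_mul ?_ _
          exact MemLp.integrable_mul (p := 2) (q := 2) hv.norm
            (hf.comp_measurePreserving (measurePreserving_add_const (e - y))).norm
        · simp only [norm_smul]
          gcongr
          exact norm_inner_le_norm _ _
  have hconvex : ∀ x, Integrable (fun y ↦ ρ y • f (x + e - y)) μ := fun x ↦
    hρc.convolutionExists_left (lsmul ℝ ℝ) hρ hfl (x + e)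
  calc _ = ∫ x, ∫ y, ρ y • inner ℝ (v x) (f (x + (e - y))) ∂μ ∂μ := by
        refine integral_congr_ae (Eventually.of_forall fun x ↦ ?_)
        simp only [convolution_lsmul]
        rw [← integral_inner (hconvex x)]
        refine integral_congr_ae (Eventually.of_forall fun y ↦ ?_)
        simp only [inner_smul_right, smul_eq_mul, add_sub_assoc]
    _ = ∫ y, ∫ x, ρ y • inner ℝ (v x) (f (x + (e - y))) ∂μ ∂μ := integral_integral_swap hint
    _ = _ := by
        refine integral_congr_ae (Eventually.of_forall fun y ↦ ?_)
        simp only [smul_eq_mul, integral_const_mul]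

/-- Translated mollifications converge weakly in `L²` as the translation vector and the radius of
the mollifier go to zero. -/
theorem eventually_abs_integral_inner_convolution_sub_lt {v f : V → E} (hv : MemLp v 2 μ)
    (hf : MemLp f 2 μ) {ε : ℝ} (hε : 0 < ε) :
    ∃ τ > 0, ∀ (φ : ContDiffBump (0 : V)) (e : V), φ.rOut + ‖e‖ < τ →
      |∫ x, inner ℝ (v x) (convolution (φ.normed μ) f (lsmul ℝ ℝ) μ (x + e)) ∂μ
        - ∫ x, inner ℝ (v x) (f x) ∂μ| ≤ ε := by
  -- `τ` is the modulus of continuity at 0 of the correlation of `v` with translates of `f`. It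
  -- depends on neither `φ` nor `e`: the mollified pairing averages correlations at shifts `e - y`
  -- of length less than `τ`.
  have hcont := continuous_integral_inner_comp (p := 2) (q := 2)
      (fun (h : V) (x : V) ↦ x + h) continuous_uncurry_add_const
      (fun h ↦ measurePreserving_add_const (μ := μ) h) one_le_two (by simp) hv hf
  obtain ⟨τ, hτ, hτ'⟩ := Metric.continuous_iff.1 hcont 0 ε hε
  refine ⟨τ, hτ, fun φ e hφ ↦ ?_⟩
  rw [integral_inner_convolution_add φ.continuous_normed φ.hasCompactSupport_normed hv hf]
  set J : V → ℝ := fun h ↦ ∫ x, inner ℝ (v x) (f (x + h)) ∂μ with hJ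
  have hJ0 : ∫ x, inner ℝ (v x) (f x) ∂μ = ∫ y, φ.normed μ y * J 0 ∂μ := by
    rw [integral_mul_const, φ.integral_normed, one_mul]
    simp [hJ]
  have hi1 : Integrable (fun y ↦ φ.normed μ y * J (e - y)) μ :=
    (φ.continuous_normed.mul (hcont.comp (continuous_const.sub continuous_id))
      ).integrable_of_hasCompactSupport φ.hasCompactSupport_normed.mul_right
  have hi2 : Integrable (fun y ↦ φ.normed μ y * J 0) μ := φ.integrable_normed.mul_const _
  rw [hJ0, ← integral_sub hi1 hi2]
  have hi3 : Integrable (fun y ↦ φ.normed μ y * ε) μ := φ.integrable_normed.mul_const _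
  rw [← Real.norm_eq_abs]
  refine (norm_integral_le_of_norm_le hi3 (Eventually.of_forall fun y ↦ ?_)).trans_eq ?_
  · rw [← mul_sub, norm_mul, Real.norm_of_nonneg (φ.nonneg_normed y)]
    by_cases hy : y ∈ Metric.ball (0 : V) φ.rOut
    · refine mul_le_mul_of_nonneg_left ?_ (φ.nonneg_normed y)
      have := hτ' (e - y) (by
        rw [dist_zero_right]
        have := mem_ball_zero_iff.1 hy
        linarith [norm_sub_le e y])
      rw [Real.dist_eq] at this
      exact this.le
    · have : φ.normed μ y = 0 := by
        rw [← Function.notMem_support, φ.support_normed_eq]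
        exact hy
      simp [this]
  · rw [integral_mul_const, φ.integral_normed, one_mul]

end Mollify

end HeatFlow

namespace HeatFlow

open Filter Topology ENNReal ContinuousLinearMap

/-! ### Calculus of weak gradients -/

theorem inner_gradient_eq (ψ : E3 → ℝ) (x e : E3) : inner ℝ (∇ ψ x) e = fderiv ℝ ψ x e := by
  rw [← toDual_gradient, InnerProductSpace.toDual_apply_apply]

theorem gradient_eq_toDual_symm (ψ : E3 → ℝ) :
    ∇ ψ = fun x ↦ (InnerProductSpace.toDual ℝ E3).symm (fderiv ℝ ψ x) := rfl

theorem continuous_gradient {ψ : E3 → ℝ} (hψ : ContDiff ℝ 1 ψ) : Continuous (∇ ψ) := by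
  rw [gradient_eq_toDual_symm]
  exact (InnerProductSpace.toDual ℝ E3).symm.continuous.comp (hψ.continuous_fderiv one_ne_zero)

theorem tsupport_gradient_subset (ψ : E3 → ℝ) : tsupport (∇ ψ) ⊆ tsupport ψ := by
  refine subset_trans (closure_mono fun x hx ↦ ?_) (tsupport_fderiv_subset ℝ (f := ψ))
  rw [Function.mem_support] at hx ⊢
  intro h
  exact hx (by rw [gradient_eq_toDual_symm]; simp [h])

theorem hasCompactSupport_gradient {ψ : E3 → ℝ} (hψ : HasCompactSupport ψ) :
    HasCompactSupport (∇ ψ) :=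
  hψ.of_isClosed_subset (isClosed_tsupport _) (tsupport_gradient_subset ψ)

theorem memLp_of_continuous_hasCompactSupport {E : Type*} [NormedAddCommGroup E]
    [SecondCountableTopology E] {ψ : E3 → E} (hψ : Continuous ψ)
    (hc : HasCompactSupport ψ) (p : ℝ≥0∞) (Ω : Set E3) : MemLp ψ p (volume.restrict Ω) :=
  hψ.memLp_of_hasCompactSupport hc

/-- Pairing the vector-valued identity with a fixed `e` gives a scalar one, in which derivatives of
products and convolutions are easier to handle. The way back is
`HasH1Gradient.of_integral_mul_fderiv`. -/
theorem HasH1Gradient.integral_mul_fderiv {Ω : Set E3} {u : E3 → ℝ} {G : E3 → E3}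
    (h : HasH1Gradient Ω u G) {ψ : E3 → ℝ} (hψ : ContDiff ℝ ∞ ψ) (hc : HasCompactSupport ψ)
    (hs : tsupport ψ ⊆ Ω) (e : E3) :
    ∫ x in Ω, u x * fderiv ℝ ψ x e = -∫ x in Ω, ψ x * inner ℝ (G x) e := by
  have h1 := congrArg (fun z ↦ inner ℝ e z) (h.integral_eq ψ hψ hc hs)
  have hψ1 : ContDiff ℝ 1 ψ := hψ.of_le (by exact_mod_cast le_top)
  have i1 : Integrable (fun x ↦ u x • ∇ ψ x) (volume.restrict Ω) := by
    rw [← memLp_one_iff_integrable]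
    exact (memLp_of_continuous_hasCompactSupport (continuous_gradient hψ1)
      (hasCompactSupport_gradient hc) 2 Ω).smul h.memLp
  have i2 : Integrable (fun x ↦ ψ x • G x) (volume.restrict Ω) := by
    rw [← memLp_one_iff_integrable]
    exact h.memLp_grad.smul (memLp_of_continuous_hasCompactSupport hψ1.continuous hc 2 Ω)
  simp only [inner_neg_right] at h1
  rw [← integral_inner i1, ← integral_inner i2] at h1
  simp only [inner_smul_right] at h1
  simpa only [real_inner_comm e, ← inner_gradient_eq] using h1

theorem HasH1Gradient.of_integral_mul_fderiv {Ω : Set E3} {u : E3 → ℝ} {G : E3 → E3}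
    (hu : MemLp u 2 (volume.restrict Ω)) (hG : MemLp G 2 (volume.restrict Ω))
    (h : ∀ ψ : E3 → ℝ, ContDiff ℝ ∞ ψ → HasCompactSupport ψ → tsupport ψ ⊆ Ω → ∀ e : E3,
      ∫ x in Ω, u x * fderiv ℝ ψ x e = -∫ x in Ω, ψ x * inner ℝ (G x) e) :
    HasH1Gradient Ω u G := by
  refine ⟨hu, hG, fun ψ hψ hc hs ↦ ?_⟩
  have hψ1 : ContDiff ℝ 1 ψ := hψ.of_le (by exact_mod_cast le_top)
  have i1 : Integrable (fun x ↦ u x • ∇ ψ x) (volume.restrict Ω) := by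
    rw [← memLp_one_iff_integrable]
    exact (memLp_of_continuous_hasCompactSupport (continuous_gradient hψ1)
      (hasCompactSupport_gradient hc) 2 Ω).smul hu
  have i2 : Integrable (fun x ↦ ψ x • G x) (volume.restrict Ω) := by
    rw [← memLp_one_iff_integrable]
    exact hG.smul (memLp_of_continuous_hasCompactSupport hψ1.continuous hc 2 Ω)
  refine ext_inner_left ℝ fun e ↦ ?_
  rw [inner_neg_right, ← integral_inner i1, ← integral_inner i2]
  simp only [inner_smul_right]
  simpa only [real_inner_comm e, ← inner_gradient_eq] using h ψ hψ hc hs e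

theorem HasH1Gradient.neg {Ω : Set E3} {u : E3 → ℝ} {G : E3 → E3} (h : HasH1Gradient Ω u G) :
    HasH1Gradient Ω (fun x ↦ -u x) (fun x ↦ -G x) := by
  refine ⟨h.memLp.neg, h.memLp_grad.neg, fun ψ hψ hc hs ↦ ?_⟩
  have := h.integral_eq ψ hψ hc hs
  simp only [neg_smul, smul_neg, integral_neg, this]

/-- Product rule, obtained by testing with `ζ * ψ`. The support of `ψ` alone keeps this inside `Ω`,
so `ζ` may be nonzero on the boundary, as the functions of a partition of unity are. -/
theorem HasH1Gradient.smooth_mul {Ω : Set E3} {u : E3 → ℝ} {G : E3 → E3}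
    (h : HasH1Gradient Ω u G) {ζ : E3 → ℝ} (hζ : ContDiff ℝ ∞ ζ) (hc : HasCompactSupport ζ) :
    HasH1Gradient Ω (fun x ↦ ζ x * u x) (fun x ↦ ζ x • G x + u x • ∇ ζ x) := by
  have hζ1 : ContDiff ℝ 1 ζ := hζ.of_le (by exact_mod_cast le_top)
  have m1 : MemLp (fun x ↦ ζ x • G x) 2 (volume.restrict Ω) :=
    h.memLp_grad.smul (memLp_of_continuous_hasCompactSupport hζ1.continuous hc ⊤ Ω)
  have m2 : MemLp (fun x ↦ u x • ∇ ζ x) 2 (volume.restrict Ω) :=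
    (memLp_of_continuous_hasCompactSupport (continuous_gradient hζ1)
      (hasCompactSupport_gradient hc) ⊤ Ω).smul h.memLp
  refine HasH1Gradient.of_integral_mul_fderiv ?_ (m1.add m2) fun ψ hψ hψc hs e ↦ ?_
  · exact h.memLp.smul (memLp_of_continuous_hasCompactSupport hζ1.continuous hc ⊤ Ω)
  have hψ1 : ContDiff ℝ 1 ψ := hψ.of_le (by exact_mod_cast le_top)
  have key := h.integral_mul_fderiv (ψ := fun x ↦ ζ x * ψ x) (hζ.mul hψ) hψc.mul_left
    ((tsupport_mul_subset_right).trans hs) e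
  have hd : ∀ x, fderiv ℝ (fun x ↦ ζ x * ψ x) x e
      = ζ x * fderiv ℝ ψ x e + ψ x * fderiv ℝ ζ x e := fun x ↦ by
    rw [fderiv_fun_mul (hζ1.differentiable one_ne_zero x) (hψ1.differentiable one_ne_zero x)]
    simp
  simp only [hd] at key
  have cψ' : Continuous fun x ↦ fderiv ℝ ψ x e :=
    (hψ1.continuous_fderiv one_ne_zero).clm_apply continuous_const
  have cζ' : Continuous fun x ↦ fderiv ℝ ζ x e :=
    (hζ1.continuous_fderiv one_ne_zero).clm_apply continuous_const
  have kψ' : HasCompactSupport fun x ↦ fderiv ℝ ψ x e := hψc.fderiv_apply (𝕜 := ℝ) e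
  have i1 : Integrable (fun x ↦ u x * (ζ x * fderiv ℝ ψ x e)) (volume.restrict Ω) :=
    h.memLp.integrable_mul (q := 2)
      (memLp_of_continuous_hasCompactSupport (hζ1.continuous.mul cψ') kψ'.mul_left 2 Ω)
  have i2 : Integrable (fun x ↦ u x * (ψ x * fderiv ℝ ζ x e)) (volume.restrict Ω) :=
    h.memLp.integrable_mul (q := 2)
      (memLp_of_continuous_hasCompactSupport (hψ1.continuous.mul cζ') hψc.mul_right 2 Ω)
  have i3 : Integrable (fun x ↦ (ζ x * ψ x) * inner ℝ (G x) e) (volume.restrict Ω) :=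
    MemLp.integrable_mul (p := 2) (q := 2)
      (memLp_of_continuous_hasCompactSupport (hζ1.continuous.mul hψ1.continuous) hψc.mul_left 2 Ω)
      (h.memLp_grad.inner_const e)
  have e1 : ∀ x, u x * (ζ x * fderiv ℝ ψ x e + ψ x * fderiv ℝ ζ x e)
    = u x * (ζ x * fderiv ℝ ψ x e) + u x * (ψ x * fderiv ℝ ζ x e) := fun x ↦ mul_add _ _ _
  simp only [e1] at key
  rw [integral_add i1 i2] at key
  have e2 : ∀ x, ψ x * inner ℝ (ζ x • G x + u x • ∇ ζ x) e
      = (ζ x * ψ x) * inner ℝ (G x) e + u x * (ψ x * fderiv ℝ ζ x e) := fun x ↦ by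
    rw [inner_add_left, inner_smul_left, inner_smul_left, inner_gradient_eq]
    simp; ring
  simp only [e2]
  rw [integral_add i3 i2]
  have e3 : ∀ x, ζ x * u x * fderiv ℝ ψ x e = u x * (ζ x * fderiv ℝ ψ x e) := fun x ↦ by ring
  simp only [e3]
  linarith

/-- A function cut off inside `Ω` and extended by zero has a weak gradient on the whole space. -/
theorem HasH1Gradient.integral_indicator_cutoff {Ω : Set E3} (hΩ : MeasurableSet Ω) {u : E3 → ℝ}
    {G : E3 → E3} (h : HasH1Gradient Ω u G) {χ : E3 → ℝ} (hχ : ContDiff ℝ ∞ χ)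
    (hc : HasCompactSupport χ) (hs : tsupport χ ⊆ Ω) {ψ : E3 → ℝ} (hψ : ContDiff ℝ ∞ ψ) (e : E3) :
    ∫ x, Ω.indicator (fun x ↦ χ x * u x) x * fderiv ℝ ψ x e
      = -∫ x, ψ x * inner ℝ (Ω.indicator (fun x ↦ χ x • G x + u x • ∇ χ x) x) e := by
  have hχ1 : ContDiff ℝ 1 χ := hχ.of_le (by exact_mod_cast le_top)
  have hψ1 : ContDiff ℝ 1 ψ := hψ.of_le (by exact_mod_cast le_top)
  -- Here `χ` alone keeps the support of the product inside `Ω`, which is why `ψ` carries no support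
  -- condition.
  have key := h.integral_mul_fderiv (ψ := fun x ↦ χ x * ψ x) (hχ.mul hψ) hc.mul_right
    ((tsupport_mul_subset_left).trans hs) e
  have hd : ∀ x, fderiv ℝ (fun x ↦ χ x * ψ x) x e
      = χ x * fderiv ℝ ψ x e + ψ x * fderiv ℝ χ x e := fun x ↦ by
    rw [fderiv_fun_mul (hχ1.differentiable one_ne_zero x) (hψ1.differentiable one_ne_zero x)]
    simp
  simp only [hd] at key
  have cψ' : Continuous fun x ↦ fderiv ℝ ψ x e :=
    (hψ1.continuous_fderiv one_ne_zero).clm_apply continuous_const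
  have cχ' : Continuous fun x ↦ fderiv ℝ χ x e :=
    (hχ1.continuous_fderiv one_ne_zero).clm_apply continuous_const
  have kχ' : HasCompactSupport fun x ↦ fderiv ℝ χ x e := hc.fderiv_apply (𝕜 := ℝ) e
  have i1 : Integrable (fun x ↦ u x * (χ x * fderiv ℝ ψ x e)) (volume.restrict Ω) :=
    h.memLp.integrable_mul (q := 2)
      (memLp_of_continuous_hasCompactSupport (hχ1.continuous.mul cψ') hc.mul_right 2 Ω)
  have i2 : Integrable (fun x ↦ u x * (ψ x * fderiv ℝ χ x e)) (volume.restrict Ω) :=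
    h.memLp.integrable_mul (q := 2)
      (memLp_of_continuous_hasCompactSupport (hψ1.continuous.mul cχ') kχ'.mul_left 2 Ω)
  have i3 : Integrable (fun x ↦ (χ x * ψ x) * inner ℝ (G x) e) (volume.restrict Ω) :=
    MemLp.integrable_mul (p := 2) (q := 2)
      (memLp_of_continuous_hasCompactSupport (hχ1.continuous.mul hψ1.continuous) hc.mul_right 2 Ω)
      (h.memLp_grad.inner_const e)
  have e1 : ∀ x, u x * (χ x * fderiv ℝ ψ x e + ψ x * fderiv ℝ χ x e)
    = u x * (χ x * fderiv ℝ ψ x e) + u x * (ψ x * fderiv ℝ χ x e) := fun x ↦ mul_add _ _ _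
  simp only [e1] at key
  rw [integral_add i1 i2] at key
  have e2 : ∀ x, ψ x * inner ℝ (Ω.indicator (fun x ↦ χ x • G x + u x • ∇ χ x) x) e
      = Ω.indicator (fun x ↦ (χ x * ψ x) * inner ℝ (G x) e + u x * (ψ x * fderiv ℝ χ x e)) x := by
    intro x
    by_cases hx : x ∈ Ω
    · simp only [indicator_of_mem hx]
      rw [inner_add_left, inner_smul_left, inner_smul_left, inner_gradient_eq]
      simp; ring
    · simp [indicator_of_notMem hx]
  have e3 : ∀ x, Ω.indicator (fun x ↦ χ x * u x) x * fderiv ℝ ψ x e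
      = Ω.indicator (fun x ↦ u x * (χ x * fderiv ℝ ψ x e)) x := by
    intro x
    by_cases hx : x ∈ Ω
    · simp only [indicator_of_mem hx]; ring
    · simp [indicator_of_notMem hx]
  simp only [e2, e3]
  rw [integral_indicator hΩ, integral_indicator hΩ, integral_add i3 i2]
  linarith

theorem fderiv_convolution_apply {ρ w : E3 → ℝ} (hρ : ContDiff ℝ ∞ ρ) (hρc : HasCompactSupport ρ)
    (hw : LocallyIntegrable w) (z e : E3) :
    fderiv ℝ (convolution ρ w (lsmul ℝ ℝ) volume) z e = ∫ y, fderiv ℝ ρ (z - y) e * w y := by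
  have hρ1 : ContDiff ℝ 1 ρ := hρ.of_le (by exact_mod_cast le_top)
  rw [(hρc.hasFDerivAt_convolution_left (lsmul ℝ ℝ) hρ1 hw z).fderiv]
  have hex : ConvolutionExistsAt (fderiv ℝ ρ) w z ((lsmul ℝ ℝ : ℝ →L[ℝ] ℝ →L[ℝ] ℝ).precompL E3)
      volume :=
    (hρc.fderiv (𝕜 := ℝ)).convolutionExists_left _ (hρ1.continuous_fderiv one_ne_zero) hw z
  rw [convolution_eq_swap]
  have hex' := hex.integrable_swap
  rw [ContinuousLinearMap.integral_apply hex']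
  simp

/-- The gradient of a mollification is the mollification of the weak gradient, wherever the
translates of the mollifier are admissible test functions. -/
theorem gradient_convolution_eq {ρ w : E3 → ℝ} {W : E3 → E3} (hρ : ContDiff ℝ ∞ ρ)
    (hρc : HasCompactSupport ρ) (hw : LocallyIntegrable w) (hW : LocallyIntegrable W) (z : E3)
    (h : ∀ e, ∫ y, w y * fderiv ℝ (fun y ↦ ρ (z - y)) y e
      = -∫ y, ρ (z - y) * inner ℝ (W y) e) :
    ∇ (convolution ρ w (lsmul ℝ ℝ) volume) z = convolution ρ W (lsmul ℝ ℝ) volume z := by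
  have hρ1 : ContDiff ℝ 1 ρ := hρ.of_le (by exact_mod_cast le_top)
  refine ext_inner_right ℝ fun e ↦ ?_
  rw [inner_gradient_eq, fderiv_convolution_apply hρ hρc hw]
  have hd : ∀ y, fderiv ℝ (fun y ↦ ρ (z - y)) y e = -fderiv ℝ ρ (z - y) e := fun y ↦ by
    have := ((hρ1.differentiable one_ne_zero (z - y)).hasFDerivAt.comp y
      ((hasFDerivAt_id y).const_sub z)).fderiv
    simpa [Function.comp_def] using congrArg (fun A ↦ A e) this
  have h' := h e
  simp only [hd, mul_neg, integral_neg, neg_inj] at h'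
  simp only [mul_comm (w _)] at h'
  rw [h', convolution_lsmul_swap, real_inner_comm, ← integral_inner]
  · refine integral_congr_ae (Eventually.of_forall fun y ↦ ?_)
    simp only [inner_smul_right, real_inner_comm e]
  · exact (hρc.convolutionExists_left (lsmul ℝ ℝ) hρ1.continuous hW z).integrable_swap

end HeatFlow

namespace HeatFlow

open Filter Topology ENNReal ContinuousLinearMap
open scoped Manifold

/-! ### The chain rule for weak gradients -/

/-- Two intermediate compact sets are inserted so that the cutoff equals 1 in a neighbourhood of
every point of `K`, not merely on `K`; hence its gradient vanishes on `K` too. -/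
theorem exists_cutoff {K U : Set E3} (hK : IsCompact K) (hU : IsOpen U) (hKU : K ⊆ U) :
    ∃ χ : E3 → ℝ, ContDiff ℝ ∞ χ ∧ HasCompactSupport χ ∧ tsupport χ ⊆ U ∧
      (∀ x, 0 ≤ χ x ∧ χ x ≤ 1) ∧ ∀ x ∈ K, χ =ᶠ[𝓝 x] 1 := by
  obtain ⟨K₂, hK₂, hK2, hK₂U⟩ := exists_compact_between hK hU hKU
  obtain ⟨K₁, hK₁, hK1, hK₁2⟩ := exists_compact_between hK isOpen_interior hK2
  obtain ⟨χ, hχ, hr, hsupp, hone⟩ := exists_contMDiff_support_eq_eq_one_iff (n := (⊤ : ℕ∞)) 𝓘(ℝ, E3)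
    (isOpen_interior (s := K₂)) hK₁.isClosed hK₁2
  have hts : tsupport χ ⊆ K₂ := by
    rw [tsupport, hsupp]
    exact closure_minimal interior_subset hK₂.isClosed
  refine ⟨χ, hχ.contDiff, hK₂.of_isClosed_subset (isClosed_tsupport _) hts, hts.trans hK₂U,
    fun x ↦ hr (mem_range_self x), fun x hx ↦ ?_⟩
  filter_upwards [mem_interior_iff_mem_nhds.1 (hK1 hx)] with y hy
  exact (hone y).1 hy

/-- A sequence of mollifiers with radii tending to zero. -/
noncomputable def mollifier (n : ℕ) : ContDiffBump (0 : E3) where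
  rIn := 1 / (n + 1)
  rOut := 2 / (n + 1)
  rIn_pos := by positivity
  rIn_lt_rOut := by gcongr; norm_num

theorem tendsto_mollifier_rOut : Tendsto (fun n ↦ (mollifier n).rOut) atTop (𝓝 0) := by
  have := (tendsto_one_div_add_atTop_nhds_zero_nat (𝕜 := ℝ)).const_mul 2
  simpa [mollifier, div_eq_mul_inv] using this

theorem ae_tendsto_mollifier {E : Type*} [NormedAddCommGroup E] [NormedSpace ℝ E] [CompleteSpace E]
    {f : E3 → E} (hf : LocallyIntegrable f) :
    ∀ᵐ x, Tendsto (fun n ↦ convolution ((mollifier n).normed volume) f (lsmul ℝ ℝ) volume x) atTop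
      (𝓝 (f x)) := by
  -- The outer radius is twice the inner one for every `n`; a bounded ratio is what the Lebesgue
  -- differentiation theorem requires of the mollifiers.
  refine ContDiffBump.ae_convolution_tendsto_right_of_locallyIntegrable (K := 2)
    tendsto_mollifier_rOut (Eventually.of_forall fun n ↦ ?_) hf
  simp [mollifier, div_eq_mul_inv]

/-- Chain rule on the whole space, by mollification. For smooth `wn` it is classical integration by
parts. In the limit, `f ∘ wn` converges in L¹ because `f` is Lipschitz; in the gradient term, `Wn -
W` tends to 0 in L¹ against the bounded factor `deriv f (wn)`, and dominated convergence treats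
`deriv f (wn)` against the fixed `W`. -/
theorem integral_comp_mul_fderiv {f : ℝ → ℝ} (hf : ContDiff ℝ 1 f) {L : ℝ}
    (hL : ∀ s, |deriv f s| ≤ L) {w : E3 → ℝ} {W : E3 → E3} (hw : Integrable w)
    (hW : Integrable W)
    (h : ∀ ψ : E3 → ℝ, ContDiff ℝ ∞ ψ → HasCompactSupport ψ → ∀ e,
      ∫ x, w x * fderiv ℝ ψ x e = -∫ x, ψ x * inner ℝ (W x) e)
    {ψ : E3 → ℝ} (hψ : ContDiff ℝ ∞ ψ) (hψc : HasCompactSupport ψ) (e : E3) :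
    ∫ x, f (w x) * fderiv ℝ ψ x e = -∫ x, ψ x * (deriv f (w x) * inner ℝ (W x) e) := by
  have hψ1 : ContDiff ℝ 1 ψ := hψ.of_le (by exact_mod_cast le_top)
  have hf' : Continuous (deriv f) := hf.continuous_deriv le_rfl
  have hL0 : 0 ≤ L := (abs_nonneg _).trans (hL 0)
  have hlip : ∀ a b, |f a - f b| ≤ L * |a - b| := fun a b ↦ by
    have := convex_univ.norm_image_sub_le_of_norm_deriv_le (f := f) (C := L)
      (fun x _ ↦ hf.differentiable one_ne_zero x) (fun x _ ↦ hL x) (mem_univ b) (mem_univ a)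
    simpa using this
  have cψ' : Continuous fun x ↦ fderiv ℝ ψ x e :=
    (hψ1.continuous_fderiv one_ne_zero).clm_apply continuous_const
  have kψ' : HasCompactSupport fun x ↦ fderiv ℝ ψ x e := hψc.fderiv_apply (𝕜 := ℝ) e
  obtain ⟨C', hC'⟩ := kψ'.exists_bound_of_continuous cψ'
  obtain ⟨C, hC⟩ := hψc.exists_bound_of_continuous hψ1.continuous
  have hC0 : 0 ≤ C := (norm_nonneg _).trans (hC 0)
  have hC0' : 0 ≤ C' := (norm_nonneg _).trans (hC' 0)
  set ρ : ℕ → E3 → ℝ := fun n ↦ (mollifier n).normed volume with hρ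
  set wn : ℕ → E3 → ℝ := fun n ↦ convolution (ρ n) w (lsmul ℝ ℝ) volume with hwn
  set Wn : ℕ → E3 → E3 := fun n ↦ convolution (ρ n) W (lsmul ℝ ℝ) volume with hWn
  have hρs : ∀ n, ContDiff ℝ ∞ (ρ n) := fun n ↦ (mollifier n).contDiff_normed
  have hρc : ∀ n, HasCompactSupport (ρ n) := fun n ↦ (mollifier n).hasCompactSupport_normed
  have hwns : ∀ n, ContDiff ℝ ∞ (wn n) := fun n ↦
    (hρc n).contDiff_convolution_left _ (hρs n) hw.locallyIntegrable
  have hwn1 : ∀ n, ContDiff ℝ 1 (wn n) := fun n ↦ (hwns n).of_le (by exact_mod_cast le_top)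
  have hgrad : ∀ n x, fderiv ℝ (wn n) x e = inner ℝ (Wn n x) e := by
    intro n x
    rw [← inner_gradient_eq, gradient_convolution_eq (hρs n) (hρc n) hw.locallyIntegrable
      hW.locallyIntegrable x]
    intro e
    refine h _ ((hρs n).comp (contDiff_const.sub contDiff_id)) ?_ e
    exact (hρc n).comp_homeomorph (Homeomorph.subLeft x)
  have hibp : ∀ n, ∫ x, f (wn n x) * fderiv ℝ ψ x e
      = -∫ x, ψ x * (deriv f (wn n x) * inner ℝ (Wn n x) e) := by
    intro n
    have hdf : ∀ x, fderiv ℝ (fun x ↦ f (wn n x)) x e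
        = deriv f (wn n x) * inner ℝ (Wn n x) e := by
      intro x
      have h1 := ((hf.differentiable one_ne_zero (wn n x)).hasDerivAt.comp_hasFDerivAt x
        ((hwn1 n).differentiable one_ne_zero x).hasFDerivAt).fderiv
      have h2 := congrArg (fun A ↦ A e) h1
      simpa [Function.comp_def, hgrad] using h2
    have hfw : ContDiff ℝ 1 fun x ↦ f (wn n x) := hf.comp (hwn1 n)
    have hfw' : Continuous fun x ↦ fderiv ℝ (fun x ↦ f (wn n x)) x e :=
      (hfw.continuous_fderiv one_ne_zero).clm_apply continuous_const
    have := integral_mul_fderiv_eq_neg_fderiv_mul_of_integrable (μ := (volume : Measure E3))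
      (f := fun x ↦ f (wn n x)) (g := ψ) (v := e)
      ((hfw'.mul hψ1.continuous).integrable_of_hasCompactSupport hψc.mul_left)
      ((hfw.continuous.mul cψ').integrable_of_hasCompactSupport kψ'.mul_left)
      ((hfw.continuous.mul hψ1.continuous).integrable_of_hasCompactSupport hψc.mul_left)
      (fun x _ ↦ hfw.differentiable one_ne_zero x) (fun x _ ↦ hψ1.differentiable one_ne_zero x)
    simp only [hdf] at this
    rw [this]
    simp only [mul_comm (ψ _)]
  have hconv1 := tendsto_eLpNorm_one_convolution_sub (μ := (volume : Measure E3))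
    tendsto_mollifier_rOut hw
  have hconv2 := tendsto_eLpNorm_one_convolution_sub (μ := (volume : Measure E3))
    tendsto_mollifier_rOut hW
  have hWni : ∀ n, Integrable (Wn n) := fun n ↦
    ((mollifier n).integrable_normed).integrable_convolution _ hW
  have mfw : AEStronglyMeasurable (fun x ↦ f (w x)) := hf.continuous.comp_aestronglyMeasurable hw.1
  have hlim1 : Tendsto (fun n ↦ ∫ x, f (wn n x) * fderiv ℝ ψ x e) atTop
      (𝓝 (∫ x, f (w x) * fderiv ℝ ψ x e)) := by
    refine tendsto_integral_of_L1' _ (mfw.mul cψ'.aestronglyMeasurable)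
      (Eventually.of_forall fun n ↦ ?_) ?_
    · exact ((hf.continuous.comp (hwn1 n).continuous).mul cψ').integrable_of_hasCompactSupport
        kψ'.mul_left
    · have h2 : Tendsto (fun n ↦ ENNReal.ofReal (C' * L) * eLpNorm (fun x ↦ wn n x - w x) 1 volume)
          atTop (𝓝 0) := by
        simpa using ENNReal.Tendsto.const_mul hconv1 (Or.inr ENNReal.ofReal_ne_top)
      refine tendsto_of_tendsto_of_tendsto_of_le_of_le tendsto_const_nhds h2 (fun _ ↦ zero_le)
        fun n ↦ ?_
      refine eLpNorm_le_mul_eLpNorm_of_ae_le_mul (Eventually.of_forall fun x ↦ ?_) 1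
      simp only [Pi.sub_apply, Pi.mul_apply]
      rw [← sub_mul, norm_mul, Real.norm_eq_abs]
      calc |f (wn n x) - f (w x)| * ‖fderiv ℝ ψ x e‖ ≤ (L * |wn n x - w x|) * C' := by
            gcongr
            · exact hlip _ _
            · exact hC' x
        _ = C' * L * ‖wn n x - w x‖ := by rw [Real.norm_eq_abs]; ring
  have mf'w : AEStronglyMeasurable (fun x ↦ deriv f (w x)) := hf'.comp_aestronglyMeasurable hw.1
  have hWne : ∀ n, Integrable (fun x ↦ inner ℝ (Wn n x) e) := fun n ↦ (hWni n).inner_const e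
  have hWe : Integrable (fun x ↦ inner ℝ (W x) e) := hW.inner_const e
  have hlim2 : Tendsto (fun n ↦ ∫ x, ψ x * (deriv f (wn n x) * inner ℝ (Wn n x) e)) atTop
      (𝓝 (∫ x, ψ x * (deriv f (w x) * inner ℝ (W x) e))) := by
    have hA : Tendsto (fun n ↦ ∫ x, ψ x * (deriv f (wn n x) * inner ℝ (W x) e)) atTop
        (𝓝 (∫ x, ψ x * (deriv f (w x) * inner ℝ (W x) e))) := by
      refine tendsto_integral_of_dominated_convergence (fun x ↦ C * (L * ‖inner ℝ (W x) e‖))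
        (fun n ↦ ?_) ((hWe.norm.const_mul L).const_mul C) (fun n ↦ Eventually.of_forall fun x ↦ ?_)
        ?_
      · exact hψ1.continuous.aestronglyMeasurable.mul
          ((hf'.comp (hwn1 n).continuous).aestronglyMeasurable.mul hWe.1)
      · rw [norm_mul, norm_mul]
        gcongr
        · exact hC x
        · exact hL _
      · filter_upwards [ae_tendsto_mollifier hw.locallyIntegrable] with x hx
        exact (((hf'.tendsto _).comp hx).mul_const _).const_mul _
    have hi1 : ∀ n, Integrable (fun x ↦ ψ x * (deriv f (wn n x) * inner ℝ (W x) e)) := fun n ↦ by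
      refine Integrable.mono' ((hWe.norm.const_mul L).const_mul C)
        (hψ1.continuous.aestronglyMeasurable.mul
          ((hf'.comp (hwn1 n).continuous).aestronglyMeasurable.mul hWe.1))
        (Eventually.of_forall fun x ↦ ?_)
      rw [norm_mul, norm_mul]
      gcongr
      · exact hC x
      · exact hL _
    have hi2 : ∀ n, Integrable (fun x ↦ ψ x * (deriv f (wn n x) * inner ℝ (Wn n x) e)) := fun n ↦ by
      refine Integrable.mono' (((hWne n).norm.const_mul L).const_mul C)
        (hψ1.continuous.aestronglyMeasurable.mul
          ((hf'.comp (hwn1 n).continuous).aestronglyMeasurable.mul (hWne n).1))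
        (Eventually.of_forall fun x ↦ ?_)
      rw [norm_mul, norm_mul]
      gcongr
      · exact hC x
      · exact hL _
    have hB : Tendsto (fun n ↦ ∫ x, (ψ x * (deriv f (wn n x) * inner ℝ (Wn n x) e)
        - ψ x * (deriv f (wn n x) * inner ℝ (W x) e))) atTop (𝓝 (∫ _ : E3, (0 : ℝ))) := by
      refine tendsto_integral_of_L1' _ aestronglyMeasurable_zero
        (Eventually.of_forall fun n ↦ (hi2 n).sub (hi1 n)) ?_
      have h2 : Tendsto (fun n ↦ ENNReal.ofReal (C * (L * ‖e‖)) *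
          eLpNorm (fun x ↦ Wn n x - W x) 1 volume) atTop (𝓝 0) := by
        simpa using ENNReal.Tendsto.const_mul hconv2 (Or.inr ENNReal.ofReal_ne_top)
      refine tendsto_of_tendsto_of_tendsto_of_le_of_le tendsto_const_nhds h2 (fun _ ↦ zero_le)
        fun n ↦ ?_
      refine eLpNorm_le_mul_eLpNorm_of_ae_le_mul (Eventually.of_forall fun x ↦ ?_) 1
      simp only [Pi.sub_apply, Pi.zero_apply, sub_zero]
      rw [← mul_sub, ← mul_sub, ← inner_sub_left, norm_mul, norm_mul]
      calc ‖ψ x‖ * (‖deriv f (wn n x)‖ * ‖inner ℝ (Wn n x - W x) e‖)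
          ≤ C * (L * (‖Wn n x - W x‖ * ‖e‖)) := by
            gcongr
            · exact hC x
            · exact hL _
            · exact norm_inner_le_norm _ _
        _ = C * (L * ‖e‖) * ‖Wn n x - W x‖ := by ring
    have := hB.add hA
    rw [integral_zero, zero_add] at this
    refine this.congr fun n ↦ ?_
    rw [integral_sub (hi2 n) (hi1 n), sub_add_cancel]
  exact tendsto_nhds_unique (hlim1.congr hibp) hlim2.neg

/-- Chain rule for weak gradients. -/
theorem HasH1Gradient.comp {Ω : Set E3} (hΩ : IsOpen Ω) {u : E3 → ℝ}
    {G : E3 → E3} (h : HasH1Gradient Ω u G) {f : ℝ → ℝ} (hf : ContDiff ℝ 1 f) {L : ℝ}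
    (hL : ∀ s, |deriv f s| ≤ L) (hfu : MemLp (fun x ↦ f (u x)) 2 (volume.restrict Ω)) :
    HasH1Gradient Ω (fun x ↦ f (u x)) (fun x ↦ deriv f (u x) • G x) := by
  have hf' : Continuous (deriv f) := hf.continuous_deriv le_rfl
  have hb : MemLp (fun x ↦ deriv f (u x)) ⊤ (volume.restrict Ω) :=
    memLp_top_of_bound (hf'.comp_aestronglyMeasurable h.memLp.1) L (Eventually.of_forall fun x ↦ hL _)
  refine HasH1Gradient.of_integral_mul_fderiv hfu (h.memLp_grad.smul hb) fun ψ hψ hψc hs e ↦ ?_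
  -- Reduction to the whole space: `χ u`, extended by zero, has a global weak gradient, and where
  -- `ψ` does not vanish it agrees with `u` and its gradient with `G`.
  obtain ⟨χ, hχ, hχc, hχs, -, hχ1⟩ := exists_cutoff hψc hΩ hs
  have hP := h.smooth_mul hχ hχc
  have hts : ∀ x, x ∉ tsupport χ → χ x = 0 := fun x hx ↦ image_eq_zero_of_notMem_tsupport hx
  have htg : ∀ x, x ∉ tsupport χ → ∇ χ x = 0 := fun x hx ↦
    image_eq_zero_of_notMem_tsupport fun h ↦ hx (tsupport_gradient_subset χ h)
  have key : ∀ {E : Type} [NormedAddCommGroup E] (g : E3 → E), MemLp g 2 (volume.restrict Ω) →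
      (∀ x, x ∉ tsupport χ → g x = 0) → Integrable (Ω.indicator g) := by
    intro E _ g hg hg0
    have h1 : MemLp (Ω.indicator g) 2 volume := (memLp_indicator_iff_restrict hΩ.measurableSet).2 hg
    have h2 : Function.support (Ω.indicator g) ⊆ tsupport χ := by
      intro x hx
      by_contra hx'
      exact hx (by simp [indicator, hg0 x hx'])
    rw [← integrableOn_iff_integrable_of_support_subset h2]
    have hfin : IsFiniteMeasure (volume.restrict (tsupport χ)) :=
      ⟨by simpa using hχc.isCompact.measure_lt_top⟩
    exact (h1.restrict _).integrable one_le_two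
  have hw := key _ hP.memLp fun x hx ↦ by simp [hts x hx]
  have hW := key _ hP.memLp_grad fun x hx ↦ by simp [hts x hx, htg x hx]
  have main := integral_comp_mul_fderiv hf hL hw hW (fun ψ hψ _ e ↦
    h.integral_indicator_cutoff hΩ.measurableSet hχ hχc hχs hψ e) hψ hψc e
  have hψ0 : ∀ x, x ∉ tsupport ψ → ψ x = 0 := fun x hx ↦ image_eq_zero_of_notMem_tsupport hx
  have hψ'0 : ∀ x, x ∉ tsupport ψ → fderiv ℝ ψ x = 0 := fun x hx ↦
    image_eq_zero_of_notMem_tsupport fun h ↦ hx (tsupport_fderiv_subset ℝ h)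
  rw [← integral_indicator hΩ.measurableSet, ← integral_indicator hΩ.measurableSet]
  refine Eq.trans (integral_congr_ae (Eventually.of_forall fun x ↦ ?_))
    (main.trans (congrArg Neg.neg (integral_congr_ae (Eventually.of_forall fun x ↦ ?_))))
  · by_cases hx : x ∈ tsupport ψ
    · have hxχ : χ x = 1 := (hχ1 x hx).eq_of_nhds
      simp [indicator_of_mem (hs hx), hxχ]
    · have h0 : fderiv ℝ ψ x e = 0 := by rw [hψ'0 x hx]; rfl
      by_cases hxΩ : x ∈ Ω <;> simp [indicator_of_mem, indicator_of_notMem, hxΩ, h0]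
  · by_cases hx : x ∈ tsupport ψ
    · have hxχ : χ x = 1 := (hχ1 x hx).eq_of_nhds
      have hg : ∇ χ x = 0 := by
        rw [gradient_eq_toDual_symm]
        simp [(hχ1 x hx).fderiv_eq]
      simp [indicator_of_mem (hs hx), hxχ, hg, inner_smul_left]
    · by_cases hxΩ : x ∈ Ω <;> simp [indicator_of_mem, indicator_of_notMem, hxΩ, hψ0 x hx]

end HeatFlow

namespace HeatFlow

open Filter Topology ENNReal

/-! ### Geometry of the cylinder -/

/-- The projection `(x₁, x₂, x₃) ↦ (x₁, x₂)`. -/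
def horizontal (x : E3) : E2 := !₂[x 0, x 1]

theorem continuous_horizontal : Continuous horizontal := by
  refine (PiLp.continuous_toLp 2 _).comp (continuous_pi fun i ↦ ?_)
  fin_cases i <;> simp <;> fun_prop

theorem continuous_atHeight : Continuous fun p : E2 × ℝ ↦ atHeight p.1 p.2 := by
  refine (PiLp.continuous_toLp 2 _).comp (continuous_pi fun i ↦ ?_)
  fin_cases i <;> simp <;> fun_prop

theorem horizontal_atHeight (y : E2) (h : ℝ) : horizontal (atHeight y h) = y := by
  ext i; fin_cases i <;> simp [horizontal, atHeight]

theorem atHeight_two (y : E2) (h : ℝ) : atHeight y h 2 = h := by simp [atHeight]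

theorem horizontal_add_smul (x : E3) (s : ℝ) (g : E2) (h : ℝ) :
    horizontal (x + s • atHeight g h) = horizontal x + s • g := by
  ext i; fin_cases i <;> simp [horizontal, atHeight]

theorem mem_cylinder {φ₀ : E2 → ℝ} {c₀ a : ℝ} {x : E3} :
    x ∈ cylinder φ₀ c₀ a ↔ φ₀ (horizontal x) < c₀ ∧ -a < x 2 ∧ x 2 < a := Iff.rfl

variable {φ₀ : E2 → ℝ} {c₀ a : ℝ}

theorem IsCrossSection.isOpen_cylinder (hD : IsCrossSection φ₀ c₀) :
    IsOpen (cylinder φ₀ c₀ a) := by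
  have h1 : Continuous fun x : E3 ↦ φ₀ (horizontal x) :=
    hD.contDiff.continuous.comp continuous_horizontal
  have h2 : Continuous fun x : E3 ↦ x 2 := by fun_prop
  exact (isOpen_lt h1 continuous_const).inter
    ((isOpen_lt continuous_const h2).inter (isOpen_lt h2 continuous_const))

theorem IsCrossSection.isBounded_cylinder (hD : IsCrossSection φ₀ c₀) :
    Bornology.IsBounded (cylinder φ₀ c₀ a) := by
  obtain ⟨R, hR⟩ := hD.bounded.exists_norm_le
  rw [isBounded_iff_forall_norm_le]
  refine ⟨R + |a|, fun x hx ↦ ?_⟩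
  have h1 := hR _ hx.1
  have hR0 : 0 ≤ R := (norm_nonneg _).trans h1
  have h2 : |x 2| ≤ |a| := by
    have : |x 2| ≤ a := abs_le.2 ⟨hx.2.1.le, hx.2.2.le⟩
    exact this.trans (le_abs_self a)
  have h3 : x = atHeight (horizontal x) 0 + x 2 • atHeight 0 1 := by
    ext i; fin_cases i <;> simp [horizontal, atHeight]
  have n1 : ‖atHeight (horizontal x) 0‖ = ‖horizontal x‖ := by
    simp [EuclideanSpace.norm_eq, atHeight, Fin.sum_univ_succ]
  have n2 : ‖atHeight 0 1‖ = 1 := by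
    simp [EuclideanSpace.norm_eq, atHeight, Fin.sum_univ_succ]
  calc ‖x‖ ≤ ‖atHeight (horizontal x) 0‖ + ‖x 2 • atHeight 0 1‖ := by
        conv_lhs => rw [h3]
        exact norm_add_le _ _
    _ ≤ R + |a| := by
        rw [n1, norm_smul, n2, mul_one, Real.norm_eq_abs]
        exact add_le_add h1 h2

theorem IsCrossSection.closure_cylinder_subset (hD : IsCrossSection φ₀ c₀) :
    closure (cylinder φ₀ c₀ a) ⊆ {x | φ₀ (horizontal x) ≤ c₀ ∧ -a ≤ x 2 ∧ x 2 ≤ a} := by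
  have h1 : Continuous fun x : E3 ↦ φ₀ (horizontal x) :=
    hD.contDiff.continuous.comp continuous_horizontal
  have h2 : Continuous fun x : E3 ↦ x 2 := by fun_prop
  refine closure_minimal (fun x hx ↦ ⟨hx.1.le, hx.2.1.le, hx.2.2.le⟩) ?_
  exact (isClosed_le h1 continuous_const).inter
    ((isClosed_le continuous_const h2).inter (isClosed_le h2 continuous_const))

/-- Sublevel sets of a regular `C¹` function have the segment property, in the direction opposite
to the gradient. -/
theorem IsCrossSection.exists_shift_lt (hD : IsCrossSection φ₀ c₀) {y₀ : E2} (hy₀ : φ₀ y₀ ≤ c₀) :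
    ∃ r > 0, ∃ s₀ > 0, ∀ y, φ₀ y ≤ c₀ → dist y y₀ < r → ∀ s : ℝ, 0 < s → s < s₀ →
      φ₀ (y + s • -∇ φ₀ y₀) < c₀ := by
  set g := ∇ φ₀ y₀ with hg
  have hcont : Continuous fun p : E2 × ℝ ↦ p.1 + p.2 • -g := by fun_prop
  rcases hy₀.lt_or_eq with hlt | heq
  · have h1 : ∀ᶠ p : E2 × ℝ in 𝓝 (y₀, 0), φ₀ (p.1 + p.2 • -g) < c₀ := by
      refine ((hD.contDiff.continuous.comp hcont).tendsto (y₀, 0)).eventually_lt_const ?_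
      simpa using hlt
    obtain ⟨r, hr, h⟩ := Metric.eventually_nhds_iff.1 h1
    refine ⟨r, hr, r, hr, fun y _ hd s hs hs' ↦ h (y := (y, s)) ?_⟩
    rw [Prod.dist_eq]
    exact max_lt hd (by rw [Real.dist_eq, sub_zero, abs_of_pos hs]; exact hs')
  -- On the curve itself, the derivative along `g` stays positive near `y₀`, so `φ₀` decreases
  -- strictly along `y - τ g`. Even when `φ₀ y = c₀`, every positive `s` then gives a strict
  -- inequality.
  · have hg0 : g ≠ 0 := hD.regular y₀ heq
    have hf1 : Continuous fun y ↦ fderiv ℝ φ₀ y g :=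
      (hD.contDiff.continuous_fderiv one_ne_zero).clm_apply continuous_const
    have hpos : 0 < fderiv ℝ φ₀ y₀ g := by
      rw [← toDual_gradient, InnerProductSpace.toDual_apply_apply]
      exact real_inner_self_pos.2 hg0
    have h1 : ∀ᶠ p : E2 × ℝ in 𝓝 (y₀, 0), 0 < fderiv ℝ φ₀ (p.1 + p.2 • -g) g := by
      refine ((hf1.comp hcont).tendsto (y₀, 0)).eventually_const_lt ?_
      simpa using hpos
    obtain ⟨r, hr, h⟩ := Metric.eventually_nhds_iff.1 h1
    refine ⟨r, hr, r, hr, fun y hy hd s hs hs' ↦ ?_⟩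
    have hderiv : ∀ τ : ℝ, HasDerivAt (fun τ : ℝ ↦ φ₀ (y + τ • -g))
        (-fderiv ℝ φ₀ (y + τ • -g) g) τ := by
      intro τ
      have e1 : HasDerivAt (fun τ : ℝ ↦ y + τ • -g) (-g) τ := by
        simpa using ((hasDerivAt_id τ).smul_const (-g)).const_add y
      have := (hD.contDiff.differentiable one_ne_zero
        (y + τ • -g)).hasFDerivAt.comp_hasDerivAt τ e1
      rw [map_neg] at this
      exact this
    have hanti : StrictAntiOn (fun τ : ℝ ↦ φ₀ (y + τ • -g)) (Icc 0 s) := by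
      refine strictAntiOn_of_deriv_neg (convex_Icc 0 s)
        (fun τ _ ↦ (hderiv τ).continuousAt.continuousWithinAt) fun τ hτ ↦ ?_
      rw [interior_Icc] at hτ
      rw [(hderiv τ).deriv, neg_lt_zero]
      refine h (y := (y, τ)) ?_
      rw [Prod.dist_eq]
      exact max_lt hd (by
        rw [Real.dist_eq, sub_zero, abs_of_pos hτ.1]; exact hτ.2.trans hs')
    have := hanti (left_mem_Icc.2 hs.le) (right_mem_Icc.2 hs.le) hs
    simp only [zero_smul, add_zero] at this
    exact this.trans_le hy

/-- The shift by `-s z₀` points towards mid-height. At the end on the side of `z₀` it makes the weak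
inequality strict; at the other end, `|z - z₀| < a / 2` and `s < 1 / 2` leave room. -/
theorem exists_shift_mem_Ioo (ha : 0 < a) (z₀ : ℝ) (hz₀ : -a ≤ z₀ ∧ z₀ ≤ a) (z s : ℝ)
    (hz : -a ≤ z ∧ z ≤ a) (hd : |z - z₀| < a / 2) (hs : 0 < s) (hs' : s < 1 / 2) :
    -a < z + s * -z₀ ∧ z + s * -z₀ < a := by
  rw [abs_lt] at hd
  constructor
  · rcases lt_or_ge z₀ 0 with h | h
    · nlinarith
    · nlinarith
  · rcases lt_or_ge 0 z₀ with h | h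
    · nlinarith
    · nlinarith

/-- The cylinder has the segment property. -/
theorem IsCrossSection.exists_inward_shift (hD : IsCrossSection φ₀ c₀) (ha : 0 < a) {x₀ : E3}
    (hx₀ : x₀ ∈ closure (cylinder φ₀ c₀ a)) :
    ∃ r > 0, ∃ e : E3, ∃ s₀ > 0, ∀ x ∈ closure (cylinder φ₀ c₀ a), dist x x₀ < r →
      ∀ s : ℝ, 0 < s → s < s₀ → x + s • e ∈ cylinder φ₀ c₀ a := by
  have hx₀' := hD.closure_cylinder_subset hx₀
  obtain ⟨r₁, hr₁, s₁, hs₁, h1⟩ := hD.exists_shift_lt hx₀'.1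
  have h2 : ∀ᶠ x in 𝓝 x₀, dist (horizontal x) (horizontal x₀) < r₁ ∧ |x 2 - x₀ 2| < a / 2 := by
    refine Eventually.and (continuous_horizontal.tendsto x₀ (Metric.ball_mem_nhds _ hr₁)) ?_
    have hc : Continuous fun x : E3 ↦ x 2 := by fun_prop
    exact hc.tendsto x₀ (Metric.ball_mem_nhds (x₀ 2) (half_pos ha))
  obtain ⟨r, hr, h⟩ := Metric.eventually_nhds_iff.1 h2
  -- One vector combines descent of `φ₀` with motion towards mid-height, so the lateral surface, the
  -- bases and the edges where they meet need no separate treatment.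
  refine ⟨r, hr, atHeight (-∇ φ₀ (horizontal x₀)) (-x₀ 2), min s₁ (1 / 2), by positivity,
    fun x hx hd s hs hs' ↦ ?_⟩
  have hx' := hD.closure_cylinder_subset hx
  rw [mem_cylinder, horizontal_add_smul]
  refine ⟨h1 _ hx'.1 (h hd).1 s hs (hs'.trans_le (min_le_left _ _)), ?_⟩
  have := exists_shift_mem_Ioo ha (x₀ 2) hx₀'.2 (x 2) s hx'.2 (h hd).2 hs
    (hs'.trans_le (min_le_right _ _))
  simpa [atHeight] using this

/-! ### Integration over the cylinder and the trace on the lower base -/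

/-- The volume on the product of coordinates is split by `piFinSuccAbove` at the last index, which
puts the height first; hence the swap. -/
theorem measurePreserving_atHeight :
    MeasurePreserving (fun p : E2 × ℝ ↦ atHeight p.1 p.2) (volume.prod volume) volume := by
  have h1 : MeasurePreserving (Prod.swap : E2 × ℝ → ℝ × E2) (volume.prod volume)
    (volume.prod volume) := Measure.measurePreserving_swap
  have h2 : MeasurePreserving (Prod.map id (WithLp.ofLp : E2 → Fin 2 → ℝ))
      ((volume : Measure ℝ).prod volume) (volume.prod volume) :=
    (MeasurePreserving.id _).prod (PiLp.volume_preserving_ofLp (Fin 2))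
  have h3 := (volume_preserving_piFinSuccAbove (fun _ : Fin 3 ↦ ℝ) (Fin.last 2)).symm
  have h4 := PiLp.volume_preserving_toLp (Fin 3)
  have h5 : (fun p : E2 × ℝ ↦ atHeight p.1 p.2) = (WithLp.toLp 2 ∘
      (MeasurableEquiv.piFinSuccAbove (fun _ : Fin 3 ↦ ℝ) (Fin.last 2)).symm) ∘
      (Prod.map id (WithLp.ofLp : E2 → Fin 2 → ℝ)) ∘ Prod.swap := by
    funext p
    refine PiLp.ext fun i ↦ ?_
    fin_cases i
    · simp [atHeight, MeasurableEquiv.piFinSuccAbove, Fin.insertNthEquiv]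
      exact (Fin.insertNth_apply_succAbove (α := fun _ ↦ ℝ) (Fin.last 2) p.2 p.1.ofLp 0).symm
    · simp [atHeight, MeasurableEquiv.piFinSuccAbove, Fin.insertNthEquiv]
      exact (Fin.insertNth_apply_succAbove (α := fun _ ↦ ℝ) (Fin.last 2) p.2 p.1.ofLp 1).symm
    · simp [atHeight, MeasurableEquiv.piFinSuccAbove, Fin.insertNthEquiv]
  rw [h5]
  exact (h4.comp h3).comp (h2.comp h1)

theorem preimage_atHeight_cylinder :
    (fun p : E2 × ℝ ↦ atHeight p.1 p.2) ⁻¹' cylinder φ₀ c₀ a = section2 φ₀ c₀ ×ˢ Ioo (-a) a := by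
  ext p
  simp only [mem_preimage, mem_cylinder, horizontal_atHeight, atHeight_two, section2, mem_prod,
    mem_ofPred_eq, mem_Ioo]

theorem IsCrossSection.setIntegral_cylinder (hD : IsCrossSection φ₀ c₀) {g : E3 → ℝ}
    (hg : Continuous g) (hc : HasCompactSupport g) :
    IntegrableOn (fun y ↦ ∫ h in Ioo (-a) a, g (atHeight y h)) (section2 φ₀ c₀) ∧
    ∫ x in cylinder φ₀ c₀ a, g x
      = ∫ y in section2 φ₀ c₀, ∫ h in Ioo (-a) a, g (atHeight y h) := by
  have hmp := measurePreserving_atHeight.restrict_preimage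
    (hD.isOpen_cylinder (a := a)).measurableSet
  rw [preimage_atHeight_cylinder, ← Measure.prod_restrict] at hmp
  have hgi : Integrable g (volume.restrict (cylinder φ₀ c₀ a)) :=
    (hg.integrable_of_hasCompactSupport hc).restrict
  have hgi' := (hmp.integrable_comp hgi.1).2 hgi
  refine ⟨hgi'.integral_prod_left, ?_⟩
  rw [← hmp.map_eq, integral_map hmp.measurable.aemeasurable (by rw [hmp.map_eq]; exact hgi.1)]
  exact integral_prod _ hgi'

theorem norm_atHeight_zero_one : ‖atHeight 0 1‖ = 1 := by
  simp [EuclideanSpace.norm_eq, atHeight, Fin.sum_univ_succ]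

theorem hasDerivAt_comp_atHeight {ψ : E3 → ℝ} (hψ : ContDiff ℝ 1 ψ) (y : E2) (h : ℝ) :
    HasDerivAt (fun h ↦ ψ (atHeight y h)) (inner ℝ (∇ ψ (atHeight y h)) (atHeight 0 1)) h := by
  have e0 : (fun h ↦ atHeight y h) = fun h : ℝ ↦ atHeight y 0 + h • atHeight 0 1 := by
    ext h i; fin_cases i <;> simp [atHeight]
  have e1 : HasDerivAt (fun h : ℝ ↦ atHeight y h) (atHeight 0 1) h := by
    rw [e0]
    simpa using ((hasDerivAt_id h).smul_const (atHeight 0 1)).const_add (atHeight y 0)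
  rw [inner_gradient_eq]
  exact (hψ.differentiable one_ne_zero _).hasFDerivAt.comp_hasDerivAt h e1

/-- Trace inequality on the lower base of the cylinder. -/
theorem IsCrossSection.setIntegral_base_le (hD : IsCrossSection φ₀ c₀) (ha : 0 < a) {ψ : E3 → ℝ}
    (hψ : ContDiff ℝ 1 ψ) (hc : HasCompactSupport ψ) :
    ∫ y in section2 φ₀ c₀, ψ (atHeight y (-a))
      ≤ (2 * a)⁻¹ * (∫ x in cylinder φ₀ c₀ a, ψ x) + ∫ x in cylinder φ₀ c₀ a, ‖∇ ψ x‖ := by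
  have hgc : Continuous fun x ↦ ‖∇ ψ x‖ := (continuous_gradient hψ).norm
  obtain ⟨i1, e1⟩ := hD.setIntegral_cylinder (a := a) hψ.continuous hc
  obtain ⟨i2, e2⟩ := hD.setIntegral_cylinder (a := a) hgc (hasCompactSupport_gradient hc).norm
  have hat : ∀ y : E2, Continuous fun h : ℝ ↦ atHeight y h := fun y ↦
    continuous_atHeight.comp (by fun_prop : Continuous fun h : ℝ ↦ (y, h))
  have hfin : IsFiniteMeasure (volume.restrict (section2 φ₀ c₀)) :=
    ⟨by rw [Measure.restrict_apply_univ]; exact hD.bounded.measure_lt_top⟩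
  have hio : ∀ {g : ℝ → ℝ}, Continuous g → IntegrableOn g (Ioo (-a) a) := fun hg ↦
    (hg.continuousOn.integrableOn_compact isCompact_Icc).mono_set Ioo_subset_Icc_self
  -- On each vertical segment the value at the bottom exceeds the value at height `h` by at most the
  -- integral of the gradient. Averaging over `h` in an interval of length `2 * a` produces the
  -- factor `(2 * a)⁻¹`.
  have hpt : ∀ y, ψ (atHeight y (-a)) ≤ (2 * a)⁻¹ * (∫ h in Ioo (-a) a, ψ (atHeight y h))
      + ∫ h in Ioo (-a) a, ‖∇ ψ (atHeight y h)‖ := by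
    intro y
    set N := ∫ h in Ioo (-a) a, ‖∇ ψ (atHeight y h)‖ with hN
    have cg : Continuous fun h ↦ ‖∇ ψ (atHeight y h)‖ := hgc.comp (hat y)
    have cd : Continuous fun h ↦ inner ℝ (∇ ψ (atHeight y h)) (atHeight 0 1) :=
      ((continuous_gradient hψ).comp (hat y)).inner continuous_const
    have h1 : ∀ h ∈ Ioo (-a) a, ψ (atHeight y (-a)) - N ≤ ψ (atHeight y h) := by
      intro h hh
      have ftc := intervalIntegral.integral_eq_sub_of_hasDerivAt
        (fun τ (_ : τ ∈ uIcc (-a) h) ↦ hasDerivAt_comp_atHeight hψ y τ)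
        (cd.intervalIntegrable _ _)
      have hb : ‖∫ τ in (-a)..h, inner ℝ (∇ ψ (atHeight y τ)) (atHeight 0 1)‖ ≤ N := by
        rw [intervalIntegral.integral_of_le hh.1.le]
        refine (norm_integral_le_of_norm_le (g := fun τ ↦ ‖∇ ψ (atHeight y τ)‖)
          ((cg.continuousOn.integrableOn_compact isCompact_Icc).mono_set Ioc_subset_Icc_self)
          (Eventually.of_forall fun τ ↦ ?_)).trans ?_
        · refine (norm_inner_le_norm _ _).trans_eq ?_
          rw [norm_atHeight_zero_one, mul_one]
        · exact setIntegral_mono_set (hio cg) (Eventually.of_forall fun _ ↦ norm_nonneg _)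
            (Eventually.of_forall fun τ hτ ↦ ⟨hτ.1, hτ.2.trans_lt hh.2⟩)
      rw [ftc, Real.norm_eq_abs] at hb
      have := (abs_le.1 hb).1
      linarith
    have h2 := setIntegral_mono_on (hio (g := fun _ ↦ ψ (atHeight y (-a)) - N) continuous_const)
      (hio (hψ.continuous.comp (hat y))) measurableSet_Ioo h1
    rw [setIntegral_const, measureReal_def, Real.volume_Ioo,
      ENNReal.toReal_ofReal (by linarith), smul_eq_mul] at h2
    simp only [Function.comp_apply] at h2
    have h3 : a - -a = 2 * a := by ring
    rw [h3, ← le_inv_mul_iff₀ (by positivity)] at h2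
    linarith
  have cψ : Continuous fun y : E2 ↦ ψ (atHeight y (-a)) :=
    hψ.continuous.comp (continuous_atHeight.comp (by fun_prop : Continuous fun y : E2 ↦ (y, -a)))
  obtain ⟨C, hC⟩ := hc.exists_bound_of_continuous hψ.continuous
  have i0 : IntegrableOn (fun y ↦ ψ (atHeight y (-a))) (section2 φ₀ c₀) :=
    Integrable.of_bound cψ.aestronglyMeasurable C (Eventually.of_forall fun y ↦ hC _)
  calc _ ≤ ∫ y in section2 φ₀ c₀, ((2 * a)⁻¹ * (∫ h in Ioo (-a) a, ψ (atHeight y h))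
      + ∫ h in Ioo (-a) a, ‖∇ ψ (atHeight y h)‖) :=
        integral_mono i0 ((i1.const_mul _).add i2) hpt
    _ = _ := by
        rw [integral_add (i1.const_mul _) i2, integral_const_mul, e1, e2]

end HeatFlow

namespace HeatFlow

open Filter Topology ENNReal ContinuousLinearMap
open scoped Manifold

/-! ### The flux inequality for nonnegative functions in `H¹` -/

variable {φ₀ : E2 → ℝ} {c₀ a : ℝ}

/-- The weak form, at a fixed time, of `div v = 0` in the cylinder with normal traces `-d₁` on the
lower base, `d₂` on the upper base and `0` on the lateral boundary. -/
def HasNormalTraces (φ₀ : E2 → ℝ) (c₀ a : ℝ) (d₁ d₂ : E2 → ℝ) (v : E3 → E3) : Prop :=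
  ∀ ψ : E3 → ℝ, ContDiff ℝ ∞ ψ → HasCompactSupport ψ →
    ∫ x in cylinder φ₀ c₀ a, inner ℝ (v x) (∇ ψ x) =
      (∫ y in section2 φ₀ c₀, d₂ y * ψ (atHeight y a)) -
        ∫ y in section2 φ₀ c₀, d₁ y * ψ (atHeight y (-a))

/-- For smooth nonnegative `ψ`, Gauss-Green expresses the left side through the two bases: the
outflow has a favourable sign, and the inflow is at most `m` times the trace on the lower base. Only
volume integrals remain on the right, so that the bound can pass to limits. -/
theorem HasNormalTraces.neg_integral_le_of_smooth (hD : IsCrossSection φ₀ c₀) (ha : 0 < a)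
    {d₁ d₂ : E2 → ℝ} {v : E3 → E3} (hv : HasNormalTraces φ₀ c₀ a d₁ d₂ v) {m : ℝ} (hm : 0 ≤ m)
    (hd₁ : ∀ᵐ y ∂(volume.restrict (section2 φ₀ c₀)), d₁ y ≤ m)
    (hd₂ : ∀ᵐ y ∂(volume.restrict (section2 φ₀ c₀)), 0 ≤ d₂ y)
    {ψ : E3 → ℝ} (hψ : ContDiff ℝ ∞ ψ) (hc : HasCompactSupport ψ) (h0 : ∀ x, 0 ≤ ψ x) :
    -∫ x in cylinder φ₀ c₀ a, inner ℝ (v x) (∇ ψ x)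
      ≤ m * ((2 * a)⁻¹ * (∫ x in cylinder φ₀ c₀ a, ψ x) + ∫ x in cylinder φ₀ c₀ a, ‖∇ ψ x‖) := by
  have hψ1 : ContDiff ℝ 1 ψ := hψ.of_le (by exact_mod_cast le_top)
  have htr := hD.setIntegral_base_le ha hψ1 hc
  have hfin : IsFiniteMeasure (volume.restrict (section2 φ₀ c₀)) :=
    ⟨by rw [Measure.restrict_apply_univ]; exact hD.bounded.measure_lt_top⟩
  have cψ : Continuous fun y : E2 ↦ ψ (atHeight y (-a)) :=
    hψ.continuous.comp (continuous_atHeight.comp (by fun_prop : Continuous fun y : E2 ↦ (y, -a)))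
  obtain ⟨M, hM⟩ := hc.exists_bound_of_continuous hψ.continuous
  have i0 : Integrable (fun y ↦ ψ (atHeight y (-a))) (volume.restrict (section2 φ₀ c₀)) :=
    Integrable.of_bound cψ.aestronglyMeasurable M (Eventually.of_forall fun y ↦ hM _)
  have h1 : ∫ y in section2 φ₀ c₀, d₁ y * ψ (atHeight y (-a))
      ≤ m * ∫ y in section2 φ₀ c₀, ψ (atHeight y (-a)) := by
    rw [← integral_const_mul]
    have hp : 0 ≤ ∫ y in section2 φ₀ c₀, m * ψ (atHeight y (-a)) :=
      integral_nonneg fun y ↦ mul_nonneg hm (h0 _)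
    -- If the product is not integrable, its Bochner integral is zero and the bound still holds,
    -- because the right side is nonnegative.
    by_cases hi : Integrable (fun y ↦ d₁ y * ψ (atHeight y (-a)))
      (volume.restrict (section2 φ₀ c₀))
    · refine integral_mono_ae hi (i0.const_mul m) ?_
      filter_upwards [hd₁] with y hy
      exact mul_le_mul_of_nonneg_right hy (h0 _)
    · rw [integral_undef hi]
      exact hp
  have h2 : 0 ≤ ∫ y in section2 φ₀ c₀, d₂ y * ψ (atHeight y a) := by
    refine integral_nonneg_of_ae ?_
    filter_upwards [hd₂] with y hy
    exact mul_nonneg hy (h0 _)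
  have h3 := mul_le_mul_of_nonneg_left htr hm
  rw [hv ψ hψ hc]
  linarith

theorem tsupport_comp_sub_subset {φ : ContDiffBump (0 : E3)} (z : E3) :
    tsupport (fun y ↦ φ.normed volume (z - y)) ⊆ Metric.closedBall z φ.rOut := by
  refine closure_minimal (fun y hy ↦ ?_) Metric.isClosed_closedBall
  have : z - y ∈ Function.support (φ.normed volume) := hy
  rw [φ.support_normed_eq, mem_ball_zero_iff] at this
  rw [Metric.mem_closedBall, dist_comm, dist_eq_norm]
  exact this.le

theorem gradient_comp_add_right (g : E3 → ℝ) (c x : E3) :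
    ∇ (fun x ↦ g (x + c)) x = ∇ g (x + c) := by
  simp only [gradient_eq_toDual_symm]
  rw [fderiv_comp_add_right]

/-- The approximants are ψ(x) = (ρ ∗ 1_Ω u)(x + c) with c = s e pointing inwards. Although 1_Ω u may
have no weak gradient across the boundary, for x in Ω near x₀ the mollifier around x + c sees only
Ω, so ∇ψ(x) = (ρ ∗ 1_Ω G)(x + c). The right side of the smooth inequality does not grow under
mollification, since convolution with ρ contracts L¹ and u ≥ 0; the pairing with v converges weakly
in L². -/
theorem HasNormalTraces.neg_integral_le_of_local (hD : IsCrossSection φ₀ c₀) (ha : 0 < a)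
    {d₁ d₂ : E2 → ℝ} {v : E3 → E3} (hv : HasNormalTraces φ₀ c₀ a d₁ d₂ v)
    (hv2 : MemLp v 2 (volume.restrict (cylinder φ₀ c₀ a))) {m : ℝ} (hm : 0 ≤ m)
    (hd₁ : ∀ᵐ y ∂(volume.restrict (section2 φ₀ c₀)), d₁ y ≤ m)
    (hd₂ : ∀ᵐ y ∂(volume.restrict (section2 φ₀ c₀)), 0 ≤ d₂ y)
    {x₀ e : E3} {r s₀ : ℝ} (hr : 0 < r) (hs₀ : 0 < s₀)
    (hseg : ∀ x ∈ closure (cylinder φ₀ c₀ a), dist x x₀ < r → ∀ s : ℝ, 0 < s → s < s₀ →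
      x + s • e ∈ cylinder φ₀ c₀ a)
    {u : E3 → ℝ} {G : E3 → E3} (hu : HasH1Gradient (cylinder φ₀ c₀ a) u G)
    (hu0 : ∀ᵐ x ∂(volume.restrict (cylinder φ₀ c₀ a)), 0 ≤ u x)
    (hus : ∀ x, r / 2 ≤ dist x x₀ → u x = 0) (hGs : ∀ x, r / 2 ≤ dist x x₀ → G x = 0) :
    -∫ x in cylinder φ₀ c₀ a, inner ℝ (v x) (G x)
      ≤ m * ((2 * a)⁻¹ * (∫ x in cylinder φ₀ c₀ a, u x) + ∫ x in cylinder φ₀ c₀ a, ‖G x‖) := by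
  set Ω := cylinder φ₀ c₀ a with hΩdef
  have hΩo : IsOpen Ω := hD.isOpen_cylinder
  have hΩm := hΩo.measurableSet
  have hΩb : Bornology.IsBounded Ω := hD.isBounded_cylinder
  have hfin : IsFiniteMeasure (volume.restrict Ω) :=
    ⟨by rw [Measure.restrict_apply_univ]; exact hΩb.measure_lt_top⟩
  set w := Ω.indicator u with hw
  set W := Ω.indicator G with hW
  set v' := Ω.indicator v with hv'
  have hW2 : MemLp W 2 volume := (memLp_indicator_iff_restrict hΩm).2 hu.memLp_grad
  have hv'2 : MemLp v' 2 volume := (memLp_indicator_iff_restrict hΩm).2 hv2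
  have hw1 : Integrable w := (integrable_indicator_iff hΩm).2 (hu.memLp.integrable one_le_two)
  have hW1 : Integrable W := (integrable_indicator_iff hΩm).2 (hu.memLp_grad.integrable one_le_two)
  have hw0 : ∀ᵐ x, 0 ≤ w x := by
    filter_upwards [(ae_restrict_iff' hΩm).1 hu0] with x hx
    by_cases hxΩ : x ∈ Ω
    · simpa [hw, hxΩ] using hx hxΩ
    · simp [hw, hxΩ]
  have hpair : ∀ F : E3 → E3, ∫ x in Ω, inner ℝ (v x) (F x) = ∫ x, inner ℝ (v' x) (F x) := by
    intro F
    rw [← integral_indicator hΩm]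
    refine integral_congr_ae (Eventually.of_forall fun x ↦ ?_)
    by_cases hxΩ : x ∈ Ω <;> simp [hv', hxΩ]
  have hpairW : ∫ x in Ω, inner ℝ (v x) (G x) = ∫ x, inner ℝ (v' x) (W x) := by
    rw [← integral_indicator hΩm]
    refine integral_congr_ae (Eventually.of_forall fun x ↦ ?_)
    by_cases hxΩ : x ∈ Ω <;> simp [hv', hW, hxΩ]
  have hiu : ∫ x in Ω, u x = ∫ x, w x := (integral_indicator hΩm).symm
  have hiG : ∫ x in Ω, ‖G x‖ = ∫ x, ‖W x‖ := by
    rw [← integral_indicator hΩm]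
    refine integral_congr_ae (Eventually.of_forall fun x ↦ ?_)
    by_cases hxΩ : x ∈ Ω <;> simp [hW, hxΩ]
  rw [hpairW, hiu, hiG]
  refine le_of_forall_pos_le_add fun ε hε ↦ ?_
  obtain ⟨τ, hτ, hτ'⟩ := eventually_abs_integral_inner_convolution_sub_lt hv'2 hW2 hε
  obtain ⟨s, hs0, hss₀, hse⟩ : ∃ s : ℝ, 0 < s ∧ s < s₀ ∧ s * ‖e‖ < min (τ / 2) (r / 8) := by
    have h1 : Tendsto (fun s : ℝ ↦ s * ‖e‖) (𝓝[>] 0) (𝓝 0) := by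
      have : Tendsto (fun s : ℝ ↦ s * ‖e‖) (𝓝 0) (𝓝 (0 * ‖e‖)) := tendsto_id.mul_const _
      rw [zero_mul] at this
      exact this.mono_left nhdsWithin_le_nhds
    have h2 := h1.eventually_lt_const (show (0 : ℝ) < min (τ / 2) (r / 8) by positivity)
    obtain ⟨s, hs, hs'⟩ := (h2.and (Ioo_mem_nhdsGT hs₀)).exists
    exact ⟨s, hs'.1, hs'.2, hs⟩
  set c := s • e with hc
  have hcn : ‖c‖ < min (τ / 2) (r / 8) := by
    rw [hc, norm_smul, Real.norm_of_nonneg hs0.le]; exact hse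
  -- The radius `2 * r / 3` lies strictly between `r / 2`, beyond which `u` vanishes, and `r`,
  -- within which the segment property holds. Compactness turns the shifted set's inclusion in `Ω`
  -- into a uniform margin `δ`.
  have hK : IsCompact ((fun x ↦ x + c) '' (closure Ω ∩ Metric.closedBall x₀ (2 * r / 3))) :=
    ((isCompact_closedBall x₀ (2 * r / 3)).inter_left isClosed_closure).image (by fun_prop)
  have hKΩ : (fun x ↦ x + c) '' (closure Ω ∩ Metric.closedBall x₀ (2 * r / 3)) ⊆ Ω := by
    rintro _ ⟨x, ⟨hx1, hx2⟩, rfl⟩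
    refine hseg x hx1 (lt_of_le_of_lt hx2 (by linarith)) s hs0 hss₀
  obtain ⟨δ, hδ, hδΩ⟩ := hK.exists_thickening_subset_open hΩo hKΩ
  -- `δ / 2` keeps the balls around `x + c` in `Ω`, and `τ / 2` leaves room for `‖c‖ < τ / 2`. Since
  -- 2r/3 - r/8 - r/24 = r/2, the ball around `x + c` misses the set where `u` is nonzero as soon as
  -- `x` is farther than `2 * r / 3` from `x₀`.
  set δ' := min (δ / 2) (min (τ / 2) (r / 24)) with hδ'
  have hδ'0 : 0 < δ' := by positivity
  have hδ'1 : δ' ≤ δ / 2 := min_le_left _ _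
  have hδ'2 : δ' ≤ τ / 2 := (min_le_right _ _).trans (min_le_left _ _)
  have hδ'3 : δ' ≤ r / 24 := (min_le_right _ _).trans (min_le_right _ _)
  let φ : ContDiffBump (0 : E3) := ⟨δ' / 2, δ', by positivity, by linarith⟩
  have hφr : φ.rOut = δ' := rfl
  set ρ := φ.normed volume with hρ
  have hρs : ContDiff ℝ ∞ ρ := φ.contDiff_normed
  have hρc : HasCompactSupport ρ := φ.hasCompactSupport_normed
  set ψ : E3 → ℝ := fun x ↦ convolution ρ w (lsmul ℝ ℝ) volume (x + c) with hψ
  have hconvs : ContDiff ℝ ∞ (convolution ρ w (lsmul ℝ ℝ) volume) :=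
    hρc.contDiff_convolution_left _ hρs hw1.locallyIntegrable
  have hψs : ContDiff ℝ ∞ ψ := hconvs.comp (contDiff_id.add contDiff_const)
  have hwc : HasCompactSupport w :=
    HasCompactSupport.of_support_subset_isCompact hΩb.isCompact_closure
      (support_indicator_subset.trans subset_closure)
  have hψc : HasCompactSupport ψ :=
    (HasCompactSupport.convolution (lsmul ℝ ℝ) hρc hwc).comp_homeomorph (Homeomorph.addRight c)
  have hψ0 : ∀ x, 0 ≤ ψ x := by
    intro x
    simp only [hψ, convolution_lsmul_swap]
    refine integral_nonneg_of_ae ?_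
    filter_upwards [hw0] with y hy
    exact mul_nonneg (φ.nonneg_normed _) hy
  have hgrad : ∀ x ∈ Ω, ∇ ψ x = convolution ρ W (lsmul ℝ ℝ) volume (x + c) := by
    intro x hx
    simp only [hψ]
    rw [gradient_comp_add_right]
    refine gradient_convolution_eq hρs hρc hw1.locallyIntegrable hW1.locallyIntegrable _ fun e' ↦ ?_
    set ζ : E3 → ℝ := fun y ↦ ρ (x + c - y) with hζ
    have hts : tsupport ζ ⊆ Metric.closedBall (x + c) δ' := tsupport_comp_sub_subset (φ := φ) (x + c)
    have hζs : ContDiff ℝ ∞ ζ := hρs.comp (contDiff_const.sub contDiff_id)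
    have hζc : HasCompactSupport ζ := hρc.comp_homeomorph (Homeomorph.subLeft (x + c))
    rcases le_or_gt (dist x x₀) (2 * r / 3) with hd | hd
    · have hsub : tsupport ζ ⊆ Ω := by
        refine (hts.trans fun y hy ↦ ?_).trans hδΩ
        rw [Metric.mem_thickening_iff]
        exact ⟨x + c, ⟨x, ⟨subset_closure hx, hd⟩, rfl⟩, lt_of_le_of_lt hy (by linarith)⟩
      have key := hu.integral_mul_fderiv hζs hζc hsub e'
      rw [← integral_indicator hΩm, ← integral_indicator hΩm] at key
      refine Eq.trans (integral_congr_ae (Eventually.of_forall fun y ↦ ?_))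
        (key.trans (congrArg Neg.neg (integral_congr_ae (Eventually.of_forall fun y ↦ ?_))))
      · by_cases hy : y ∈ Ω <;> simp [hw, hy, hζ]
      · by_cases hy : y ∈ Ω <;> simp [hW, hy, hζ]
    · have hfar : ∀ y ∈ tsupport ζ, r / 2 ≤ dist y x₀ := by
        intro y hy
        have h1 : dist y (x + c) ≤ δ' := hts hy
        have h2 : dist (x + c) x = ‖c‖ := by simp [dist_eq_norm]
        have h3 : ‖c‖ < r / 8 := hcn.trans_le (min_le_right _ _)
        have h4 := dist_triangle x (x + c) x₀
        have h5 := dist_triangle (x + c) y x₀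
        rw [dist_comm x (x + c), h2] at h4
        rw [dist_comm (x + c) y] at h5
        linarith
      have z1 : ∀ y, w y * fderiv ℝ ζ y e' = 0 := by
        intro y
        by_cases hy : y ∈ tsupport ζ
        · have : w y = 0 := by
            by_cases hyΩ : y ∈ Ω <;> simp [hw, hyΩ, hus y (hfar y hy)]
          rw [this, zero_mul]
        · have : fderiv ℝ ζ y = 0 :=
            image_eq_zero_of_notMem_tsupport fun h ↦ hy (tsupport_fderiv_subset ℝ h)
          rw [this]; simp
      have z2 : ∀ y, ζ y * inner ℝ (W y) e' = 0 := by
        intro y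
        by_cases hy : y ∈ tsupport ζ
        · have : W y = 0 := by
            by_cases hyΩ : y ∈ Ω <;> simp [hW, hyΩ, hGs y (hfar y hy)]
          rw [this, inner_zero_left, mul_zero]
        · rw [image_eq_zero_of_notMem_tsupport hy, zero_mul]
      rw [integral_congr_ae (Eventually.of_forall z1), integral_congr_ae (Eventually.of_forall z2)]
      simp
  have hmain := hv.neg_integral_le_of_smooth hD ha hm hd₁ hd₂ hψs hψc hψ0
  have e1 : ∫ x in Ω, inner ℝ (v x) (∇ ψ x)
      = ∫ x, inner ℝ (v' x) (convolution ρ W (lsmul ℝ ℝ) volume (x + c)) := by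
    rw [← hpair]
    exact setIntegral_congr_fun hΩm fun x hx ↦ by simp only [hgrad x hx]
  have hρ1 : ∫ x, ‖ρ x‖ = 1 := by
    simp only [Real.norm_of_nonneg (φ.nonneg_normed _), hρ, φ.integral_normed]
  have hρi : Integrable ρ := φ.integrable_normed
  have b1 : ∫ x in Ω, ψ x ≤ ∫ x, w x := by
    calc ∫ x in Ω, ψ x ≤ ∫ x, ψ x := setIntegral_le_integral
          (hψs.continuous.integrable_of_hasCompactSupport hψc) (Eventually.of_forall hψ0)
      _ = ∫ x, convolution ρ w (lsmul ℝ ℝ) volume x :=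
          integral_add_right_eq_self (fun x ↦ convolution ρ w (lsmul ℝ ℝ) volume x) c
      _ = ∫ x, w x := by
          rw [integral_convolution (lsmul ℝ ℝ) hρi hw1]
          simp [hρ, φ.integral_normed]
  have b2 : ∫ x in Ω, ‖∇ ψ x‖ ≤ ∫ x, ‖W x‖ := by
    have hci : Integrable (convolution ρ W (lsmul ℝ ℝ) volume) := hρi.integrable_convolution _ hW1
    calc ∫ x in Ω, ‖∇ ψ x‖ = ∫ x in Ω, ‖convolution ρ W (lsmul ℝ ℝ) volume (x + c)‖ :=
          setIntegral_congr_fun hΩm fun x hx ↦ by simp only [hgrad x hx]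
      _ ≤ ∫ x, ‖convolution ρ W (lsmul ℝ ℝ) volume (x + c)‖ :=
          setIntegral_le_integral (hci.comp_add_right c).norm
            (Eventually.of_forall fun _ ↦ norm_nonneg _)
      _ = ∫ x, ‖convolution ρ W (lsmul ℝ ℝ) volume x‖ :=
          integral_add_right_eq_self (fun x ↦ ‖convolution ρ W (lsmul ℝ ℝ) volume x‖) c
      _ ≤ ∫ x, ‖W x‖ := by
          have := integral_norm_convolution_le hρi hW1
          rwa [hρ1, one_mul] at this
  have b3 := hτ' φ c (by
    rw [hφr]
    have := hcn.trans_le (min_le_left _ _)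
    linarith)
  rw [← hΩdef, e1] at hmain
  have b4 := (abs_le.1 b3).2
  have ha' : 0 ≤ (2 * a)⁻¹ := by positivity
  have b5 : m * ((2 * a)⁻¹ * (∫ x in Ω, ψ x) + ∫ x in Ω, ‖∇ ψ x‖)
      ≤ m * ((2 * a)⁻¹ * (∫ x, w x) + ∫ x, ‖W x‖) := by gcongr
  linarith

/-- Compactness of the closed cylinder leaves finitely many shift directions. The covering balls
have half the radius on which the segment property holds, which leaves space for the shift and the
mollifier. -/
theorem IsCrossSection.exists_partition (hD : IsCrossSection φ₀ c₀) (ha : 0 < a) :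
    ∃ (n : ℕ) (ζ : Fin n → E3 → ℝ), (∀ i, ContDiff ℝ ∞ (ζ i)) ∧ (∀ i, HasCompactSupport (ζ i)) ∧
      (∀ i x, 0 ≤ ζ i x ∧ ζ i x ≤ 1) ∧ (∀ x ∈ cylinder φ₀ c₀ a, ∑ i, ζ i x = 1) ∧
      ∀ i, ∃ r > 0, ∃ (x₀ e : E3), ∃ s₀ > 0, tsupport (ζ i) ⊆ Metric.ball x₀ (r / 2) ∧
        ∀ x ∈ closure (cylinder φ₀ c₀ a), dist x x₀ < r → ∀ s : ℝ, 0 < s → s < s₀ →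
          x + s • e ∈ cylinder φ₀ c₀ a := by
  set Ω := cylinder φ₀ c₀ a with hΩ
  have hK : IsCompact (closure Ω) := hD.isBounded_cylinder.isCompact_closure
  choose! r hr e s₀ hs₀ hseg using fun x (hx : x ∈ closure Ω) ↦ hD.exists_inward_shift ha hx
  obtain ⟨t, htK, ht⟩ := hK.elim_nhds_subcover (fun x ↦ Metric.ball x (r x / 2))
    fun x hx ↦ Metric.ball_mem_nhds x (half_pos (hr x hx))
  let ε := t.equivFin.symm
  obtain ⟨P, hP⟩ := SmoothPartitionOfUnity.exists_isSubordinate 𝓘(ℝ, E3) isClosed_closure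
    (fun i : Fin t.card ↦ Metric.ball (ε i : E3) (r (ε i) / 2)) (fun i ↦ Metric.isOpen_ball)
    (fun x hx ↦ by
      obtain ⟨y, hy, hxy⟩ := mem_iUnion₂.1 (ht hx)
      exact mem_iUnion.2 ⟨ε.symm ⟨y, hy⟩, by simpa using hxy⟩)
  refine ⟨t.card, fun i ↦ P i, fun i ↦ (P i).contMDiff.contDiff, fun i ↦ ?_,
    fun i x ↦ ⟨P.nonneg i x, P.le_one i x⟩, fun x hx ↦ ?_, fun i ↦ ?_⟩
  · exact (isCompact_closedBall (ε i : E3) (r (ε i) / 2)).of_isClosed_subset (isClosed_tsupport _)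
      ((hP i).trans Metric.ball_subset_closedBall)
  · have := P.sum_eq_one (subset_closure hx)
    rwa [finsum_eq_sum_of_fintype] at this
  · have hi : (ε i : E3) ∈ closure Ω := htK _ (ε i).2
    exact ⟨r (ε i), hr _ hi, ε i, e (ε i), s₀ (ε i), hs₀ _ hi, hP i, hseg _ hi⟩

/-- Flux inequality: only the inflow through the lower base can make `-∫ v · ∇u` positive, and it is
controlled by the `W^{1,1}` norm of `u`. -/
theorem IsCrossSection.exists_flux_const (hD : IsCrossSection φ₀ c₀) (ha : 0 < a) :
    ∃ C : ℝ, 0 ≤ C ∧ ∀ (d₁ d₂ : E2 → ℝ) (v : E3 → E3) (m : ℝ), HasNormalTraces φ₀ c₀ a d₁ d₂ v →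
      MemLp v 2 (volume.restrict (cylinder φ₀ c₀ a)) → 0 ≤ m →
      (∀ᵐ y ∂(volume.restrict (section2 φ₀ c₀)), d₁ y ≤ m) →
      (∀ᵐ y ∂(volume.restrict (section2 φ₀ c₀)), 0 ≤ d₂ y) →
      ∀ (u : E3 → ℝ) (G : E3 → E3), HasH1Gradient (cylinder φ₀ c₀ a) u G →
        (∀ᵐ x ∂(volume.restrict (cylinder φ₀ c₀ a)), 0 ≤ u x) →
        -∫ x in cylinder φ₀ c₀ a, inner ℝ (v x) (G x)
          ≤ m * (C * ∫ x in cylinder φ₀ c₀ a, (u x + ‖G x‖)) := by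
  obtain ⟨n, ζ, hζs, hζc, hζ01, hζ1, hζloc⟩ := hD.exists_partition ha
  set Ω := cylinder φ₀ c₀ a with hΩdef
  have hΩo : IsOpen Ω := hD.isOpen_cylinder
  have hΩm := hΩo.measurableSet
  have hfin : IsFiniteMeasure (volume.restrict Ω) :=
    ⟨by rw [Measure.restrict_apply_univ]; exact hD.isBounded_cylinder.measure_lt_top⟩
  have hζ1s : ∀ i, ContDiff ℝ 1 (ζ i) := fun i ↦ (hζs i).of_le (by exact_mod_cast le_top)
  have hM : ∀ i, ∃ M, ∀ x, ‖∇ (ζ i) x‖ ≤ M := fun i ↦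
    (hasCompactSupport_gradient (hζc i)).exists_bound_of_continuous (continuous_gradient (hζ1s i))
  choose M hM using hM
  have hM0 : ∀ i, 0 ≤ M i := fun i ↦ (norm_nonneg _).trans (hM i 0)
  have ha' : 0 ≤ (2 * a)⁻¹ := by positivity
  -- For each piece, `(2 * a)⁻¹` comes from the trace inequality, `M i` from the gradient of `ζ i`
  -- falling on `u`, and 1 from `ζ i • G`.
  refine ⟨∑ i, ((2 * a)⁻¹ + M i + 1), Finset.sum_nonneg fun i _ ↦ by linarith [hM0 i], ?_⟩
  intro d₁ d₂ v m hv hv2 hm hd₁ hd₂ u G hu hu0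
  have hui : Integrable u (volume.restrict Ω) := hu.memLp.integrable one_le_two
  have hGi : Integrable (fun x ↦ ‖G x‖) (volume.restrict Ω) :=
    (hu.memLp_grad.integrable one_le_two).norm
  have hPi : ∀ i, HasH1Gradient Ω (fun x ↦ ζ i x * u x)
      (fun x ↦ ζ i x • G x + u x • ∇ (ζ i) x) := fun i ↦ hu.smooth_mul (hζs i) (hζc i)
  -- The `ζ i` add up to 1 on the open set `Ω`, so their gradients cancel and the localised
  -- gradients add up to `G`.
  have hsumgrad : ∀ x ∈ Ω, ∑ i, ∇ (ζ i) x = 0 := by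
    intro x hx
    have h1 : (fun y ↦ ∑ i, ζ i y) =ᶠ[𝓝 x] fun _ ↦ 1 := by
      filter_upwards [hΩo.mem_nhds hx] with y hy using hζ1 y hy
    have h2 : fderiv ℝ (fun y ↦ ∑ i, ζ i y) x = 0 := by rw [h1.fderiv_eq]; simp
    rw [fderiv_fun_sum fun i _ ↦ (hζ1s i).differentiable one_ne_zero x] at h2
    simp only [gradient_eq_toDual_symm, ← map_sum, h2, map_zero]
  have hsplit : ∫ x in Ω, inner ℝ (v x) (G x)
      = ∑ i, ∫ x in Ω, inner ℝ (v x) (ζ i x • G x + u x • ∇ (ζ i) x) := by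
    rw [← integral_finsetSum]
    · refine setIntegral_congr_fun hΩm fun x hx ↦ ?_
      simp only [← inner_sum, Finset.sum_add_distrib, ← Finset.sum_smul, ← Finset.smul_sum,
        hζ1 x hx, hsumgrad x hx, one_smul, smul_zero, add_zero]
    · exact fun i _ ↦ integrable_inner_of_memLp (p := 2) (q := 2) hv2 (hPi i).memLp_grad
  have hloc : ∀ i, -∫ x in Ω, inner ℝ (v x) (ζ i x • G x + u x • ∇ (ζ i) x)
      ≤ m * (((2 * a)⁻¹ + M i + 1) * ∫ x in Ω, (u x + ‖G x‖)) := by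
    intro i
    obtain ⟨r, hr, x₀, e, s₀, hs₀, hts, hseg⟩ := hζloc i
    have hz : ∀ x, r / 2 ≤ dist x x₀ → x ∉ tsupport (ζ i) := fun x hx hx' ↦
      absurd (hts hx') (by rw [Metric.mem_ball]; exact not_lt.2 hx)
    have hz1 : ∀ x, r / 2 ≤ dist x x₀ → ζ i x = 0 := fun x hx ↦
      image_eq_zero_of_notMem_tsupport (hz x hx)
    have hz2 : ∀ x, r / 2 ≤ dist x x₀ → ∇ (ζ i) x = 0 := fun x hx ↦
      image_eq_zero_of_notMem_tsupport fun h ↦ hz x hx (tsupport_gradient_subset _ h)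
    have key := hv.neg_integral_le_of_local hD ha hv2 hm hd₁ hd₂ hr hs₀ hseg (hPi i)
      (by filter_upwards [hu0] with x hx using mul_nonneg (hζ01 i x).1 hx)
      (fun x hx ↦ by rw [hz1 x hx, zero_mul]) (fun x hx ↦ by simp [hz1 x hx, hz2 x hx])
    refine key.trans (mul_le_mul_of_nonneg_left ?_ hm)
    rw [← hΩdef, ← integral_const_mul, ← integral_const_mul, ← integral_add]
    · refine integral_mono_ae ?_ ((hui.add hGi).const_mul _) ?_
      · exact (((hPi i).memLp.integrable one_le_two).const_mul _).add
          ((hPi i).memLp_grad.integrable one_le_two).norm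
      · filter_upwards [hu0] with x hx
        have h1 : ‖ζ i x • G x + u x • ∇ (ζ i) x‖ ≤ ‖G x‖ + u x * M i := by
          refine (norm_add_le _ _).trans (add_le_add ?_ ?_)
          · rw [norm_smul, Real.norm_of_nonneg (hζ01 i x).1]
            exact mul_le_of_le_one_left (norm_nonneg _) (hζ01 i x).2
          · rw [norm_smul, Real.norm_of_nonneg hx]
            exact mul_le_mul_of_nonneg_left (hM i x) hx
        have h2 : (2 * a)⁻¹ * (ζ i x * u x) ≤ (2 * a)⁻¹ * u x :=
          mul_le_mul_of_nonneg_left (mul_le_of_le_one_left hx (hζ01 i x).2) ha'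
        have h3 : 0 ≤ ((2 * a)⁻¹ + M i) * ‖G x‖ :=
          mul_nonneg (add_nonneg ha' (hM0 i)) (norm_nonneg _)
        nlinarith
    · exact ((hPi i).memLp.integrable one_le_two).const_mul _
    · exact ((hPi i).memLp_grad.integrable one_le_two).norm
  rw [hsplit, ← Finset.sum_neg_distrib, Finset.sum_mul, Finset.mul_sum]
  exact Finset.sum_le_sum fun i _ ↦ hloc i

end HeatFlow

namespace HeatFlow

open Filter Topology ENNReal ContinuousLinearMap

theorem exists_forall_le_abs_eq_zero {χ : ℝ → ℝ} (hχ : HasCompactSupport χ) :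
    ∃ L : ℝ, 0 < L ∧ ∀ t, L ≤ |t| → χ t = 0 := by
  obtain ⟨R, hR⟩ := hχ.isCompact.isBounded.exists_norm_le
  refine ⟨max R 0 + 1, by positivity, fun t ht ↦ image_eq_zero_of_notMem_tsupport fun h ↦ ?_⟩
  have := hR t h
  rw [Real.norm_eq_abs] at this
  linarith [le_max_left R 0]

/-! ### A distributional ordinary differential equation -/

/-- Du Bois-Reymond lemma: the hypothesis says that `p` plus the primitive of `Q` has zero
distributional derivative on (-1, 1), hence is constant there. Since `Q` is continuous, `p` is then
classically differentiable at 0. -/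
theorem hasDerivAt_of_forall_integral_eq_zero {p Q : ℝ → ℝ} (hp : Continuous p) (hQ : Continuous Q)
    (h : ∀ A : ℝ → ℝ, ContDiff ℝ ∞ A → (∀ r, 1 ≤ |r| → A r = 0) →
      -(∫ r, deriv A r * p r) + ∫ r, A r * Q r = 0) :
    HasDerivAt p (-Q 0) 0 := by
  set k : ℝ → ℝ := fun r ↦ p r + ∫ σ in (0 : ℝ)..r, Q σ with hk
  have hQd : ∀ r, HasDerivAt (fun r ↦ ∫ σ in (0 : ℝ)..r, Q σ) (Q r) r := fun r ↦
    (hQ.integral_hasStrictDerivAt 0 r).hasDerivAt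
  have hQc : Continuous fun r ↦ ∫ σ in (0 : ℝ)..r, Q σ :=
    continuous_iff_continuousAt.2 fun r ↦ (hQd r).continuousAt
  have hkc : Continuous k := hp.add hQc
  have hk0 : ∀ A : ℝ → ℝ, ContDiff ℝ ∞ A → (∀ r, 1 ≤ |r| → A r = 0) →
      ∫ r, deriv A r * k r = 0 := by
    intro A hA hA0
    have hAc : HasCompactSupport A := by
      refine HasCompactSupport.of_support_subset_isCompact (isCompact_Icc (a := -1) (b := 1))
        fun r hr ↦ ?_
      by_contra hr'
      refine hr (hA0 r ?_)
      by_contra hlt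
      have := abs_lt.1 (not_le.1 hlt)
      exact hr' ⟨this.1.le, this.2.le⟩
    have hA1 : ContDiff ℝ 1 A := hA.of_le (by exact_mod_cast le_top)
    have hA' : Continuous (deriv A) := hA1.continuous_deriv le_rfl
    have hA'c : HasCompactSupport (deriv A) := hAc.deriv
    have i1 : Integrable (fun r ↦ deriv A r * p r) :=
      (hA'.mul hp).integrable_of_hasCompactSupport hA'c.mul_right
    have i2 : Integrable (fun r ↦ deriv A r * ∫ σ in (0 : ℝ)..r, Q σ) :=
      (hA'.mul hQc).integrable_of_hasCompactSupport hA'c.mul_right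
    have i3 : Integrable (fun r ↦ A r * Q r) :=
      (hA1.continuous.mul hQ).integrable_of_hasCompactSupport hAc.mul_right
    have i4 : Integrable (fun r ↦ A r * ∫ σ in (0 : ℝ)..r, Q σ) :=
      (hA1.continuous.mul hQc).integrable_of_hasCompactSupport hAc.mul_right
    have ibp := integral_mul_deriv_eq_deriv_mul_of_integrable
      (u := A) (v := fun r ↦ ∫ σ in (0 : ℝ)..r, Q σ) (u' := deriv A) (v' := Q)
      (fun r _ ↦ (hA1.differentiable one_ne_zero r).hasDerivAt) (fun r _ ↦ hQd r) i3 i2 i4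
    have e1 : ∀ r, deriv A r * k r = deriv A r * p r + deriv A r * ∫ σ in (0 : ℝ)..r, Q σ :=
      fun r ↦ mul_add _ _ _
    simp only [e1]
    rw [integral_add i1 i2]
    have := h A hA hA0
    linarith
  have hconst : ∀ x ∈ Ioo (-1 : ℝ) 1, k x = k 0 := by
    intro x hx
    have hx1 : |x| < 1 := abs_lt.2 hx
    -- Radii at most `(1 - |x|) / 2` keep the bumps centred at `x` and at 0 inside (-1, 1).
    let φ : ℕ → ContDiffBump (0 : ℝ) := fun n ↦
      ⟨(1 - |x|) / 2 / (n + 1) / 2, (1 - |x|) / 2 / (n + 1), by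
        have : 0 < 1 - |x| := by linarith
        positivity, half_lt_self (by
        have : 0 < 1 - |x| := by linarith
        positivity)⟩
    have hφ : Tendsto (fun n ↦ (φ n).rOut) atTop (𝓝 0) := by
      have := (tendsto_one_div_add_atTop_nhds_zero_nat (𝕜 := ℝ)).const_mul ((1 - |x|) / 2)
      simpa [φ, div_eq_mul_inv] using this
    have hφr : ∀ n, (φ n).rOut ≤ (1 - |x|) / 2 := fun n ↦
      div_le_self (by linarith) (by linarith [(Nat.cast_nonneg n : (0 : ℝ) ≤ n)])
    have t1 := ContDiffBump.convolution_tendsto_right_of_continuous (μ := volume) hφ hkc x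
    have t0 := ContDiffBump.convolution_tendsto_right_of_continuous (μ := volume) hφ hkc 0
    refine tendsto_nhds_unique t1 (t0.congr fun n ↦ ?_)
    set ρ := (φ n).normed volume with hρ
    have hρs : ContDiff ℝ ∞ ρ := (φ n).contDiff_normed
    have hρz : ∀ r, (φ n).rOut ≤ |r| → ρ r = 0 := fun r hr ↦ by
      rw [← Function.notMem_support, hρ, (φ n).support_normed_eq, mem_ball_zero_iff,
        Real.norm_eq_abs]
      exact not_lt.2 hr
    set b : ℝ → ℝ := fun r ↦ ρ (x - r) - ρ (0 - r) with hb
    have hbs : ContDiff ℝ ∞ b :=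
      (hρs.comp (contDiff_const.sub contDiff_id)).sub (hρs.comp (contDiff_const.sub contDiff_id))
    have hbz : ∀ r, (1 + |x|) / 2 ≤ |r| → b r = 0 := by
      intro r hr
      have h1 := hφr n
      have h2 : |r| - |x| ≤ |x - r| := by
        rw [abs_sub_comm]; exact abs_sub_abs_le_abs_sub r x
      have h3 : |0 - r| = |r| := by simp
      simp only [hb]
      rw [hρz _ (by linarith), hρz _ (by rw [h3]; linarith [abs_nonneg x]), sub_zero]
    have hρi : Integrable ρ := (φ n).integrable_normed
    have hbi : ∫ r, b r = 0 := by
      simp only [hb]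
      rw [integral_sub (hρi.comp_sub_left x) (hρi.comp_sub_left 0),
        integral_sub_left_eq_self ρ volume x, integral_sub_left_eq_self ρ volume 0, sub_self]
    -- The difference of the two bumps has integral zero, so its primitive vanishes outside (-1, 1)
    -- and is an admissible test function. It equates the mollifications of `k` at `x` and at 0.
    set A : ℝ → ℝ := fun r ↦ ∫ σ in (-1 : ℝ)..r, b σ with hA
    have hAd : ∀ r, HasDerivAt A (b r) r := fun r ↦
      (hbs.continuous.integral_hasStrictDerivAt (-1) r).hasDerivAt
    have hA' : deriv A = b := funext fun r ↦ (hAd r).deriv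
    have hAs : ContDiff ℝ ∞ A := by
      rw [contDiff_infty_iff_deriv, hA']
      exact ⟨fun r ↦ (hAd r).differentiableAt, hbs⟩
    have hAz : ∀ r, 1 ≤ |r| → A r = 0 := by
      intro r hr
      rcases le_abs'.1 hr with hr1 | hr1
      · simp only [hA]
        refine intervalIntegral.integral_zero_ae (Eventually.of_forall fun σ hσ ↦ hbz σ ?_)
        rw [uIoc_of_ge hr1] at hσ
        have hσ1 : |σ| = -σ := abs_of_nonpos (by linarith [hσ.2])
        linarith [hσ.2]
      · simp only [hA]
        rw [← hbi, intervalIntegral.integral_of_le (by linarith),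
          setIntegral_eq_integral_of_forall_compl_eq_zero]
        intro σ hσ
        refine hbz σ ?_
        by_contra hlt
        have := abs_lt.1 (not_le.1 hlt)
        exact hσ ⟨by linarith [this.1], by linarith [this.2]⟩
    have hz := hk0 A hAs hAz
    rw [hA'] at hz
    simp only [convolution_lsmul_swap, smul_eq_mul]
    have i1 : ∀ y, Integrable (fun r ↦ ρ (y - r) * k r) := fun y ↦
      ((hρs.continuous.comp (continuous_const.sub continuous_id)).mul
        hkc).integrable_of_hasCompactSupport
        (((φ n).hasCompactSupport_normed.comp_homeomorph (Homeomorph.subLeft y)).mul_right)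
    have e1 : ∀ r, b r * k r = ρ (x - r) * k r - ρ (0 - r) * k r := fun r ↦ sub_mul _ _ _
    simp only [e1] at hz
    rw [integral_sub (i1 x) (i1 0)] at hz
    linarith
  have hpe : p =ᶠ[𝓝 0] fun r ↦ k 0 - ∫ σ in (0 : ℝ)..r, Q σ := by
    filter_upwards [Ioo_mem_nhds (show (-1 : ℝ) < 0 by norm_num) one_pos] with r hr
    have := hconst r hr
    simp only [hk] at this ⊢
    linarith
  exact ((hQd 0).const_sub (k 0)).congr_of_eventuallyEq hpe

/-! ### Translation in time on space-time -/

/-- The translation by `r` in time. -/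
def timeShift (r : ℝ) (z : ℝ × E3) : ℝ × E3 := (z.1 + r, z.2)

theorem continuous_timeShift : Continuous (Function.uncurry timeShift) :=
  (continuous_snd.fst.add continuous_fst).prodMk continuous_snd.snd

variable {μ : Measure E3} [IsFiniteMeasure μ]

theorem measurePreserving_timeShift (r : ℝ) :
    MeasurePreserving (timeShift r) ((volume : Measure ℝ).prod μ) (volume.prod μ) :=
  (measurePreserving_add_right volume r).prod (MeasurePreserving.id μ)

/-- Each shift preserves the measure, so null sets pull back to null sets jointly in shift and
point. This gives joint measurability of shifted functions that are only almost everywhere strongly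
measurable. -/
theorem quasiMeasurePreserving_timeShift :
    Measure.QuasiMeasurePreserving (Function.uncurry timeShift)
      ((volume : Measure ℝ).prod ((volume : Measure ℝ).prod μ)) (volume.prod μ) := by
  have h := MeasurePreserving.skew_product (μa := (volume : Measure ℝ)) (μb := volume)
    (μc := (volume : Measure ℝ).prod μ) (μd := (volume : Measure ℝ).prod μ)
    (f := id) (MeasurePreserving.id _)
    (g := timeShift) continuous_timeShift.measurable
    (Eventually.of_forall fun r ↦ (measurePreserving_timeShift r).map_eq)
  exact Measure.quasiMeasurePreserving_snd.comp h.quasiMeasurePreserving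

/-- Fubini with `t` outermost: the weak identity is available for the test function frozen at almost
every `t`, so the shift and the space variable have to be integrated first. -/
theorem integral_integral_prod_eq {K : ℝ → ℝ × E3 → ℝ}
    (hK : Integrable (Function.uncurry K) ((volume : Measure ℝ).prod ((volume : Measure ℝ).prod μ))) :
    ∫ r, ∫ z, K r z ∂(volume.prod μ) = ∫ t, ∫ r, ∫ x, K r (t, x) ∂μ := by
  have hassoc : Integrable (fun w : (ℝ × ℝ) × E3 ↦ K w.1.1 (w.1.2, w.2))
      (((volume : Measure ℝ).prod (volume : Measure ℝ)).prod μ) :=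
    (measurePreserving_prodAssoc (volume : Measure ℝ) (volume : Measure ℝ) μ).integrable_comp_of_integrable
      hK
  have h2 : Integrable (fun w : ℝ × ℝ ↦ ∫ x, K w.1 (w.2, x) ∂μ) (volume.prod volume) :=
    hassoc.integral_prod_left
  refine Eq.trans (integral_congr_ae ?_)
    (integral_integral_swap (f := fun r t ↦ ∫ x, K r (t, x) ∂μ) h2)
  filter_upwards [hK.prod_right_ae] with r hr
  exact integral_prod _ hr

/-- Supplies the hypothesis of `integral_integral_prod_eq`: the integral of the norms is continuous
in the shift, and `B` confines the shift to a compact set. -/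
theorem integrable_mul_inner_timeShift {E : Type*} [NormedAddCommGroup E] [InnerProductSpace ℝ E]
    {p q : ℝ≥0∞} [p.HolderTriple q 1] (hq1 : 1 ≤ q) (hq : q ≠ ⊤) {B : ℝ → ℝ} (hB : Continuous B)
    (hBc : HasCompactSupport B) {a b : ℝ × E3 → E}
    (ha : MemLp a p ((volume : Measure ℝ).prod μ)) (hb : MemLp b q ((volume : Measure ℝ).prod μ)) :
    Integrable (Function.uncurry fun r z ↦ B r * inner ℝ (a z) (b (timeShift r z)))
      ((volume : Measure ℝ).prod ((volume : Measure ℝ).prod μ)) := by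
  have hmeas : AEStronglyMeasurable (Function.uncurry fun r z ↦ B r * inner ℝ (a z) (b (timeShift r z)))
      ((volume : Measure ℝ).prod ((volume : Measure ℝ).prod μ)) :=
    (hB.aestronglyMeasurable.comp_fst).mul (ha.1.comp_snd.inner
      (hb.1.comp_quasiMeasurePreserving quasiMeasurePreserving_timeShift))
  have hbs : ∀ r, MemLp (fun z ↦ b (timeShift r z)) q ((volume : Measure ℝ).prod μ) := fun r ↦
    hb.comp_measurePreserving (measurePreserving_timeShift r)
  have hcont : Continuous fun r ↦ ∫ z, ‖a z‖ * ‖b (timeShift r z)‖ ∂((volume : Measure ℝ).prod μ) := by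
    have := continuous_integral_inner_comp (E := ℝ) (p := p) (q := q) timeShift
      continuous_timeShift (fun r ↦ measurePreserving_timeShift (μ := μ) r) hq1 hq ha.norm hb.norm
    simpa [mul_comm] using this
  rw [integrable_prod_iff hmeas]
  refine ⟨Eventually.of_forall fun r ↦ (integrable_inner_of_memLp ha (hbs r)).const_mul (B r), ?_⟩
  have hbd : Integrable (fun r ↦ ‖B r‖ * ∫ z, ‖a z‖ * ‖b (timeShift r z)‖
      ∂((volume : Measure ℝ).prod μ)) :=
    (hB.norm.mul hcont).integrable_of_hasCompactSupport hBc.norm.mul_right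
  refine hbd.mono' hmeas.norm.integral_prod_right' (Eventually.of_forall fun r ↦ ?_)
  rw [Real.norm_of_nonneg (integral_nonneg fun _ ↦ norm_nonneg _), ← integral_const_mul]
  refine integral_mono_of_nonneg (Eventually.of_forall fun _ ↦ norm_nonneg _)
    ((MemLp.integrable_mul ha.norm (hbs r).norm).const_mul _) (Eventually.of_forall fun z ↦ ?_)
  simp only [Function.uncurry, norm_mul]
  gcongr
  exact norm_inner_le_norm _ _

end HeatFlow

namespace HeatFlow

open Filter Topology ENNReal

variable {μ : Measure E3} [IsFiniteMeasure μ]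

/-! ### The entropy inequality -/

/-- The time slab `(-T, T)` with the measure `μ` in space. -/
noncomputable abbrev slab (μ : Measure E3) (T : ℝ) : Measure (ℝ × E3) :=
  (volume.restrict (Ioo (-T) T)).prod μ

theorem slab_eq (T : ℝ) :
    slab μ T = ((volume : Measure ℝ).prod μ).restrict (Ioo (-T) T ×ˢ univ) := by
  rw [slab, ← Measure.prod_restrict, Measure.restrict_univ]

theorem measurableSet_slab (T : ℝ) : MeasurableSet (Ioo (-T) T ×ˢ univ : Set (ℝ × E3)) :=
  measurableSet_Ioo.prod MeasurableSet.univ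

/-- Multiplication by a bounded function of time with support in the slab makes a function that is
`L^p` on the slab `L^p` on the whole space-time. -/
theorem memLp_mul_of_slab {E : Type*} [NormedAddCommGroup E] [NormedSpace ℝ E] {p : ℝ≥0∞} {T : ℝ}
    {u : ℝ × E3 → E} (hu : MemLp u p (slab μ T)) {χ : ℝ → ℝ} (hχ : Continuous χ) {C : ℝ}
    (hC : ∀ t, |χ t| ≤ C) (h0 : ∀ t, T ≤ |t| → χ t = 0) :
    MemLp (fun z ↦ χ z.1 • u z) p ((volume : Measure ℝ).prod μ) := by
  rw [slab_eq, ← memLp_indicator_iff_restrict (measurableSet_slab T)] at hu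
  have hb : MemLp (fun z : ℝ × E3 ↦ χ z.1) ⊤ ((volume : Measure ℝ).prod μ) :=
    memLp_top_of_bound (hχ.comp continuous_fst).aestronglyMeasurable C
      (Eventually.of_forall fun z ↦ hC z.1)
  refine (hu.smul (r := p) hb).ae_eq (Eventually.of_forall fun z ↦ ?_)
  by_cases hz : z ∈ (Ioo (-T) T ×ˢ univ : Set (ℝ × E3))
  · simp [indicator_of_mem hz]
  · have : χ z.1 = 0 := by
      refine h0 _ ?_
      by_contra hlt
      exact hz ⟨abs_lt.1 (not_le.1 hlt), mem_univ _⟩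
    simp [this]

/-- In `heq` the test function is frozen at time t while s runs. Taking η(s) = A(s - t), weighting
with χ(t) and integrating over t shows that the correlation p(r) = ∫ χ(t) f(Θ(t)) Θ(t + r) satisfies
p'(0) = -Q(0), and -Q(0) is the right side of the claim. Time regularity of Θ is replaced by
continuity of translations in L^p. The tangent inequality `hF` bounds p(0) - p(-h) below by ∫ χ(t)
(F(Θ(t)) - F(Θ(t - h))); moving the shift onto χ, dividing by h and letting h tend to 0 gives the
left side. -/
theorem entropy_inequality {Θ P : ℝ × E3 → ℝ} {g H : ℝ × E3 → E3} {f F : ℝ → ℝ}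
    (hΘ : ∀ T, 0 < T → MemLp Θ 2 (slab μ T)) (hP : ∀ T, 0 < T → MemLp P 1 (slab μ T))
    (hg : ∀ T, 0 < T → MemLp g 2 (slab μ T)) (hH : ∀ T, 0 < T → MemLp H 2 (slab μ T))
    (hf : Continuous f) {M : ℝ} (hM : ∀ s, |f s| ≤ M) (hF : ∀ a b, F a - F b ≤ f a * (a - b))
    (hFΘ : ∀ T, 0 < T → MemLp (fun z ↦ F (Θ z)) 1 (slab μ T))
    (heq : ∀ᵐ t : ℝ, ∀ η : ℝ → ℝ, ContDiff ℝ ∞ η → HasCompactSupport η →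
      -(∫ s, deriv η s * ∫ x, Θ (s, x) * f (Θ (t, x)) ∂μ)
        + ∫ s, η s * ∫ x, (inner ℝ (g (s, x)) (H (t, x)) + P (s, x) * f (Θ (t, x))) ∂μ = 0)
    {χ : ℝ → ℝ} (hχ : ContDiff ℝ ∞ χ) (hχc : HasCompactSupport χ) (hχ0 : ∀ t, 0 ≤ χ t) :
    -∫ z, deriv χ z.1 * F (Θ z) ∂((volume : Measure ℝ).prod μ)
      ≤ -∫ z, χ z.1 * (inner ℝ (g z) (H z) + P z * f (Θ z)) ∂((volume : Measure ℝ).prod μ) := by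
  set ν : Measure (ℝ × E3) := (volume : Measure ℝ).prod μ with hν
  have hχ1 : ContDiff ℝ 1 χ := hχ.of_le (by exact_mod_cast le_top)
  have hχ' : Continuous (deriv χ) := hχ1.continuous_deriv le_rfl
  obtain ⟨L, hL, hLχ⟩ := exists_forall_le_abs_eq_zero hχc
  obtain ⟨Cχ, hCχ⟩ := hχc.exists_bound_of_continuous hχ1.continuous
  obtain ⟨C', hC'⟩ := hχc.deriv.exists_bound_of_continuous hχ'
  have hM0 : 0 ≤ M := (abs_nonneg _).trans (hM 0)
  -- Times where `χ` is nonzero satisfy `|t| < L` and shifts are at most 1, so all points involved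
  -- lie in this slab and the cut-off functions may stand for the original ones.
  set T := L + 2 with hT
  have hT0 : 0 < T := by linarith
  set I : Set (ℝ × E3) := Ioo (-T) T ×ˢ univ with hI
  have hIm : MeasurableSet I := measurableSet_slab T
  have memI : ∀ z : ℝ × E3, |z.1| < T → z ∈ I := fun z hz ↦ ⟨abs_lt.1 hz, mem_univ _⟩
  set Θc := I.indicator Θ with hΘc
  set gc := I.indicator g with hgc
  set Pc := I.indicator P with hPc
  set Fc := I.indicator (fun z ↦ F (Θ z)) with hFc
  have mΘc : MemLp Θc 2 ν := by
    have := hΘ T hT0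
    rwa [slab_eq, ← memLp_indicator_iff_restrict hIm] at this
  have mgc : MemLp gc 2 ν := by
    have := hg T hT0
    rwa [slab_eq, ← memLp_indicator_iff_restrict hIm] at this
  have mPc : MemLp Pc 1 ν := by
    have := hP T hT0
    rwa [slab_eq, ← memLp_indicator_iff_restrict hIm] at this
  have mFc : Integrable Fc ν := by
    have := hFΘ T hT0
    rwa [slab_eq, ← memLp_indicator_iff_restrict hIm, memLp_one_iff_integrable] at this
  set a : ℝ × E3 → ℝ := fun z ↦ χ z.1 * f (Θ z) with ha
  set b : ℝ × E3 → E3 := fun z ↦ χ z.1 • H z with hb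
  have hfm : AEStronglyMeasurable (fun z ↦ f (Θ z)) (slab μ L) :=
    hf.comp_aestronglyMeasurable (hΘ L hL).1
  have mb : MemLp b 2 ν := memLp_mul_of_slab (hH L hL) hχ1.continuous hCχ hLχ
  -- Boundedness of `f` enters here: `a` is paired in L² with `Θ`, but in L^∞ with `P`, which is
  -- only integrable.
  have ma : ∀ p : ℝ≥0∞, MemLp a p ν := fun p ↦
    memLp_mul_of_slab (MemLp.of_bound hfm M (Eventually.of_forall fun z ↦ hM _))
      hχ1.continuous hCχ hLχ
  set p : ℝ → ℝ := fun r ↦ ∫ z, inner ℝ (a z) (Θc (timeShift r z)) ∂ν with hp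
  set Q : ℝ → ℝ := fun r ↦ (∫ z, inner ℝ (b z) (gc (timeShift r z)) ∂ν)
    + ∫ z, inner ℝ (a z) (Pc (timeShift r z)) ∂ν with hQ
  have hpc : Continuous p := continuous_integral_inner_comp (p := 2) (q := 2) timeShift
    continuous_timeShift (fun r ↦ measurePreserving_timeShift r) one_le_two (by simp) (ma 2) mΘc
  have hQc : Continuous Q :=
    (continuous_integral_inner_comp (p := 2) (q := 2) timeShift continuous_timeShift
      (fun r ↦ measurePreserving_timeShift r) one_le_two (by simp) mb mgc).add
    (continuous_integral_inner_comp (p := ⊤) (q := 1) timeShift continuous_timeShift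
      (fun r ↦ measurePreserving_timeShift r) le_rfl (by simp) (ma ⊤) mPc)
  have ib : ∀ r, Integrable (fun z ↦ inner ℝ (b z) (gc (timeShift r z))) ν := fun r ↦
    integrable_inner_of_memLp (p := 2) (q := 2) mb
      (mgc.comp_measurePreserving (measurePreserving_timeShift r))
  have ia : ∀ r, Integrable (fun z ↦ inner ℝ (a z) (Pc (timeShift r z))) ν := fun r ↦
    integrable_inner_of_memLp (p := ⊤) (q := 1) (ma ⊤)
      (mPc.comp_measurePreserving (measurePreserving_timeShift r))
  have iΘ : ∀ r, Integrable (fun z ↦ inner ℝ (a z) (Θc (timeShift r z))) ν := fun r ↦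
    integrable_inner_of_memLp (p := 2) (q := 2) (ma 2)
      (mΘc.comp_measurePreserving (measurePreserving_timeShift r))
  have hderiv : HasDerivAt p (-Q 0) 0 := by
    refine hasDerivAt_of_forall_integral_eq_zero hpc hQc fun A hA hA0 ↦ ?_
    have hAc : HasCompactSupport A := by
      refine HasCompactSupport.of_support_subset_isCompact (isCompact_Icc (a := -1) (b := 1))
        fun r hr ↦ ?_
      by_contra hr'
      refine hr (hA0 r ?_)
      by_contra hlt
      have := abs_lt.1 (not_le.1 hlt)
      exact hr' ⟨this.1.le, this.2.le⟩
    have hA1 : ContDiff ℝ 1 A := hA.of_le (by exact_mod_cast le_top)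
    have hA' : Continuous (deriv A) := hA1.continuous_deriv le_rfl
    have hA'0 : ∀ r, 1 < |r| → deriv A r = 0 := by
      intro r hr
      have : A =ᶠ[𝓝 r] fun _ ↦ 0 := by
        filter_upwards [(continuous_abs.tendsto r).eventually_const_lt hr] with s hs
          using hA0 s hs.le
      rw [this.deriv_eq]; simp
    have k1 := integrable_mul_inner_timeShift (p := 2) (q := 2) one_le_two (by simp) hA' hAc.deriv
      (ma 2) mΘc
    have k2 := (integrable_mul_inner_timeShift (p := 2) (q := 2) one_le_two (by simp)
      hA1.continuous hAc mb mgc).add (integrable_mul_inner_timeShift (p := ⊤) (q := 1) le_rfl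
      (by simp) hA1.continuous hAc (ma ⊤) mPc)
    have e1 := integral_integral_prod_eq
      (K := fun r z ↦ deriv A r * inner ℝ (a z) (Θc (timeShift r z))) k1
    have e2 := integral_integral_prod_eq
      (K := fun r z ↦ A r * inner ℝ (b z) (gc (timeShift r z))
        + A r * inner ℝ (a z) (Pc (timeShift r z))) k2
    have f1 : ∫ r, deriv A r * p r = ∫ r, ∫ z, deriv A r * inner ℝ (a z) (Θc (timeShift r z)) ∂ν := by
      simp only [integral_const_mul, hp]
    have f2 : ∫ r, A r * Q r = ∫ r, ∫ z, (A r * inner ℝ (b z) (gc (timeShift r z))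
        + A r * inner ℝ (a z) (Pc (timeShift r z))) ∂ν := by
      refine integral_congr_ae (Eventually.of_forall fun r ↦ ?_)
      simp only [hQ]
      rw [integral_add ((ib r).const_mul _) ((ia r).const_mul _), integral_const_mul,
        integral_const_mul, mul_add]
    rw [f1, f2, e1, e2, neg_add_eq_zero]
    refine integral_congr_ae ?_
    filter_upwards [heq] with t ht
    by_cases htL : L ≤ |t|
    · have hz : χ t = 0 := hLχ t htL
      simp [ha, hb, hz]
    have htL' : |t| < L := not_le.1 htL
    have hηs : ContDiff ℝ ∞ fun s ↦ A (s - t) := hA.comp (contDiff_id.sub contDiff_const)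
    have hηc : HasCompactSupport fun s ↦ A (s - t) :=
      hAc.comp_homeomorph (Homeomorph.subRight t)
    have key := ht _ hηs hηc
    have hdη : ∀ s, deriv (fun s ↦ A (s - t)) s = deriv A (s - t) := fun s ↦ by
      rw [deriv_comp_sub_const]
    simp only [hdη] at key
    have hin : ∀ r : ℝ, |r| ≤ 1 → ∀ x : E3, timeShift r (t, x) ∈ I := by
      intro r hr x
      refine memI _ ?_
      simp only [timeShift]
      refine (abs_add_le _ _).trans_lt ?_
      linarith
    have s1 : ∫ r, ∫ x, deriv A r * inner ℝ (a (t, x)) (Θc (timeShift r (t, x))) ∂μ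
        = χ t * ∫ s, deriv A (s - t) * ∫ x, Θ (s, x) * f (Θ (t, x)) ∂μ := by
      rw [← integral_add_right_eq_self
        (fun s ↦ deriv A (s - t) * ∫ x, Θ (s, x) * f (Θ (t, x)) ∂μ) t, ← integral_const_mul]
      refine integral_congr_ae (Eventually.of_forall fun r ↦ ?_)
      simp only [add_sub_cancel_right]
      rw [← integral_const_mul, ← integral_const_mul]
      rcases lt_or_ge 1 |r| with hr | hr
      · simp [hA'0 r hr]
      · refine integral_congr_ae (Eventually.of_forall fun x ↦ ?_)
        simp only [hΘc, indicator_of_mem (hin r hr x), ha]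
        simp only [timeShift, add_comm t r, RCLike.inner_apply]
        simp
        ring
    have s2 : ∫ r, ∫ x, (A r * inner ℝ (b (t, x)) (gc (timeShift r (t, x)))
          + A r * inner ℝ (a (t, x)) (Pc (timeShift r (t, x)))) ∂μ
        = χ t * ∫ s, A (s - t) * ∫ x, (inner ℝ (g (s, x)) (H (t, x))
          + P (s, x) * f (Θ (t, x))) ∂μ := by
      rw [← integral_add_right_eq_self
        (fun s ↦ A (s - t) * ∫ x, (inner ℝ (g (s, x)) (H (t, x))
          + P (s, x) * f (Θ (t, x))) ∂μ) t, ← integral_const_mul]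
      refine integral_congr_ae (Eventually.of_forall fun r ↦ ?_)
      simp only [add_sub_cancel_right]
      rw [← integral_const_mul, ← integral_const_mul]
      rcases lt_or_ge 1 |r| with hr | hr
      · simp [hA0 r hr.le]
      · refine integral_congr_ae (Eventually.of_forall fun x ↦ ?_)
        simp only [hgc, hPc, indicator_of_mem (hin r hr x), ha, hb, inner_smul_left]
        simp only [timeShift, add_comm t r, real_inner_comm (g _) (H _)]
        simp
        ring
    rw [s1, s2, neg_add_eq_zero.1 key]
  -- The tangent is taken at `Θ (t, x)`, where `f` is evaluated, so the backward difference carries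
  -- the inequality in the required direction.
  have hconv : ∀ h : ℝ, |h| ≤ 1 →
      -∫ z, (χ (z.1 + h) - χ z.1) * Fc z ∂ν ≤ p 0 - p (-h) := by
    intro h hh
    have hC1 : MemLp (fun z : ℝ × E3 ↦ χ z.1) ⊤ ν :=
      memLp_top_of_bound (hχ1.continuous.comp continuous_fst).aestronglyMeasurable Cχ
        (Eventually.of_forall fun z ↦ hCχ z.1)
    have hC2 : MemLp (fun z : ℝ × E3 ↦ χ (z.1 + h)) ⊤ ν :=
      memLp_top_of_bound (hχ1.continuous.comp
        (continuous_fst.add continuous_const)).aestronglyMeasurable Cχ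
        (Eventually.of_forall fun z ↦ hCχ _)
    have mF1 : MemLp Fc 1 ν := memLp_one_iff_integrable.2 mFc
    have i1 : Integrable (fun z ↦ χ z.1 * Fc z) ν := hC1.integrable_mul mF1
    have i2 : Integrable (fun z ↦ χ (z.1 + h) * Fc z) ν := hC2.integrable_mul mF1
    have i3 : Integrable (fun z ↦ χ z.1 * Fc (timeShift (-h) z)) ν :=
      hC1.integrable_mul (mF1.comp_measurePreserving (measurePreserving_timeShift (-h)))
    have e2 : ∫ z, χ (z.1 + h) * Fc z ∂ν = ∫ z, χ z.1 * Fc (timeShift (-h) z) ∂ν := by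
      have hmp := measurePreserving_timeShift (μ := μ) (-h)
      have := integral_map (μ := ν) (φ := timeShift (-h)) hmp.measurable.aemeasurable
        (f := fun z ↦ χ (z.1 + h) * Fc z) (by rw [hmp.map_eq]; exact i2.1)
      rw [hmp.map_eq] at this
      rw [this]
      simp [timeShift]
    have e1 : -∫ z, (χ (z.1 + h) - χ z.1) * Fc z ∂ν
        = ∫ z, (χ z.1 * Fc z - χ z.1 * Fc (timeShift (-h) z)) ∂ν := by
      simp only [sub_mul]
      rw [integral_sub i2 i1, integral_sub i1 i3, e2]
      ring
    simp only [hp]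
    rw [e1, ← integral_sub (iΘ 0) (iΘ (-h))]
    refine integral_mono (i1.sub i3) ((iΘ 0).sub (iΘ (-h))) fun z ↦ ?_
    by_cases hz : L ≤ |z.1|
    · simp [ha, hLχ _ hz]
    have hzL : |z.1| < L := not_le.1 hz
    have m0 : z ∈ I := memI _ (by linarith)
    have m0' : timeShift 0 z = z := by simp [timeShift]
    have m1 : timeShift (-h) z ∈ I := by
      refine memI _ ?_
      simp only [timeShift]
      refine (abs_add_le _ _).trans_lt ?_
      rw [abs_neg]
      linarith
    simp only [m0', hFc, hΘc, indicator_of_mem m0, indicator_of_mem m1, ha]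
    have := mul_le_mul_of_nonneg_left (hF (Θ z) (Θ (timeShift (-h) z))) (hχ0 z.1)
    simp only [RCLike.inner_apply, conj_trivial]
    linarith
  have hlim1 : Tendsto (fun n : ℕ ↦ (1 / ((n : ℝ) + 1))⁻¹ *
      (p 0 - p (-(1 / ((n : ℝ) + 1))))) atTop (𝓝 (-Q 0)) := by
    have h1 := hderiv.tendsto_slope_zero
    have h2 : Tendsto (fun n : ℕ ↦ -(1 / ((n : ℝ) + 1))) atTop (𝓝[≠] 0) := by
      rw [tendsto_nhdsWithin_iff]
      refine ⟨by simpa using (tendsto_one_div_add_atTop_nhds_zero_nat (𝕜 := ℝ)).neg,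
        Eventually.of_forall fun n ↦ ?_⟩
      have : 0 < 1 / ((n : ℝ) + 1) := by positivity
      exact (neg_neg_of_pos this).ne
    refine (h1.comp h2).congr fun n ↦ ?_
    simp only [Function.comp_apply, zero_add, smul_eq_mul, inv_neg]
    ring
  have hlim2 : Tendsto (fun n : ℕ ↦ (1 / ((n : ℝ) + 1))⁻¹ *
      -∫ z, (χ (z.1 + 1 / ((n : ℝ) + 1)) - χ z.1) * Fc z ∂ν) atTop
      (𝓝 (-∫ z, deriv χ z.1 * Fc z ∂ν)) := by
    simp only [mul_neg]
    refine Tendsto.neg ?_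
    simp only [← integral_const_mul]
    refine tendsto_integral_of_dominated_convergence (fun z ↦ C' * ‖Fc z‖) (fun n ↦ ?_)
      (mFc.norm.const_mul C') (fun n ↦ Eventually.of_forall fun z ↦ ?_)
      (Eventually.of_forall fun z ↦ ?_)
    · refine AEStronglyMeasurable.const_mul (AEStronglyMeasurable.mul ?_ mFc.1) _
      exact (by fun_prop : Continuous fun z : ℝ × E3 ↦
        χ (z.1 + 1 / ((n : ℝ) + 1)) - χ z.1).aestronglyMeasurable
    · have hn : 0 < 1 / ((n : ℝ) + 1) := by positivity
      have := convex_univ.norm_image_sub_le_of_norm_deriv_le (f := χ) (C := C')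
        (fun x _ ↦ hχ1.differentiable one_ne_zero x) (fun x _ ↦ hC' x) (mem_univ z.1)
        (mem_univ (z.1 + 1 / ((n : ℝ) + 1)))
      rw [add_sub_cancel_left, Real.norm_of_nonneg hn.le] at this
      rw [← mul_assoc, norm_mul, norm_mul, Real.norm_of_nonneg (inv_pos.2 hn).le]
      refine mul_le_mul_of_nonneg_right ?_ (norm_nonneg _)
      rw [inv_mul_le_iff₀ hn, mul_comm]
      exact this
    · have h1 := (hχ1.differentiable one_ne_zero z.1).hasDerivAt.tendsto_slope_zero
      have h2 : Tendsto (fun n : ℕ ↦ 1 / ((n : ℝ) + 1)) atTop (𝓝[≠] 0) := by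
        rw [tendsto_nhdsWithin_iff]
        refine ⟨tendsto_one_div_add_atTop_nhds_zero_nat, Eventually.of_forall fun n ↦ ?_⟩
        have : 0 < 1 / ((n : ℝ) + 1) := by positivity
        exact this.ne'
      refine ((h1.comp h2).mul_const (Fc z)).congr fun n ↦ ?_
      simp only [Function.comp_apply, smul_eq_mul]
      ring
  have hfinal : -∫ z, deriv χ z.1 * Fc z ∂ν ≤ -Q 0 := by
    refine le_of_tendsto_of_tendsto' hlim2 hlim1 fun n ↦ ?_
    have hn : 0 < 1 / ((n : ℝ) + 1) := by positivity
    refine mul_le_mul_of_nonneg_left (hconv _ ?_) (inv_pos.2 hn).le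
    rw [abs_of_pos hn, div_le_one (by positivity)]
    linarith [(Nat.cast_nonneg n : (0 : ℝ) ≤ n)]
  have hχ'0 : ∀ t, L < |t| → deriv χ t = 0 := by
    intro t ht
    have : χ =ᶠ[𝓝 t] fun _ ↦ 0 := by
      filter_upwards [(continuous_abs.tendsto t).eventually_const_lt ht] with s hs
        using hLχ s hs.le
    rw [this.deriv_eq]; simp
  have hE : ∫ z, deriv χ z.1 * F (Θ z) ∂ν = ∫ z, deriv χ z.1 * Fc z ∂ν := by
    refine integral_congr_ae (Eventually.of_forall fun z ↦ ?_)
    rcases lt_or_ge L |z.1| with hz | hz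
    · simp [hχ'0 _ hz]
    · simp [hFc, indicator_of_mem (memI z (by linarith))]
  have hR : ∫ z, χ z.1 * (inner ℝ (g z) (H z) + P z * f (Θ z)) ∂ν = Q 0 := by
    simp only [hQ]
    rw [← integral_add (ib 0) (ia 0)]
    refine integral_congr_ae (Eventually.of_forall fun z ↦ ?_)
    have m0' : timeShift 0 z = z := by simp [timeShift]
    by_cases hz : L ≤ |z.1|
    · simp [ha, hb, hLχ _ hz]
    · have m0 : z ∈ I := memI _ (by linarith [not_le.1 hz])
      simp only [m0', hgc, hPc, indicator_of_mem m0, ha, hb, inner_smul_left,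
        real_inner_comm (g z) (H z)]
      simp
      ring
  rw [hE, hR]
  exact hfinal

end HeatFlow

namespace HeatFlow

open Filter Topology ENNReal ContinuousLinearMap

/-! ### A distributional Grönwall lemma -/

/-- A smooth step function, the primitive of a mollifier. -/
theorem exists_smooth_step (φ : ContDiffBump (0 : ℝ)) :
    ∃ Φ : ℝ → ℝ, ContDiff ℝ ∞ Φ ∧ (∀ s, HasDerivAt Φ (φ.normed volume s) s) ∧ Monotone Φ ∧
      (∀ s, 0 ≤ Φ s ∧ Φ s ≤ 1) ∧ (∀ s, s ≤ -φ.rOut → Φ s = 0) ∧ ∀ s, φ.rOut ≤ s → Φ s = 1 := by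
  set ρ := φ.normed volume with hρ
  have hρs : ContDiff ℝ ∞ ρ := φ.contDiff_normed
  have hρz : ∀ r, φ.rOut ≤ |r| → ρ r = 0 := fun r hr ↦ by
    rw [← Function.notMem_support, hρ, φ.support_normed_eq, mem_ball_zero_iff, Real.norm_eq_abs]
    exact not_lt.2 hr
  set Φ : ℝ → ℝ := fun s ↦ ∫ σ in (-φ.rOut)..s, ρ σ with hΦ
  have hd : ∀ s, HasDerivAt Φ (ρ s) s := fun s ↦
    (hρs.continuous.integral_hasStrictDerivAt (-φ.rOut) s).hasDerivAt
  have hd' : deriv Φ = ρ := funext fun s ↦ (hd s).deriv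
  have hmono : Monotone Φ := by
    refine monotone_of_deriv_nonneg (fun s ↦ (hd s).differentiableAt) fun s ↦ ?_
    rw [hd']
    exact φ.nonneg_normed s
  have h0 : ∀ s, s ≤ -φ.rOut → Φ s = 0 := by
    intro s hs
    refine intervalIntegral.integral_zero_ae (Eventually.of_forall fun σ hσ ↦ hρz σ ?_)
    rw [uIoc_of_ge hs] at hσ
    exact (by linarith [hσ.2] : φ.rOut ≤ -σ).trans (neg_le_abs σ)
  have h1 : ∀ s, φ.rOut ≤ s → Φ s = 1 := by
    intro s hs
    have := φ.rOut_pos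
    simp only [hΦ]
    rw [intervalIntegral.integral_of_le (by linarith),
      setIntegral_eq_integral_of_forall_compl_eq_zero, hρ, φ.integral_normed]
    intro σ hσ
    rcases lt_or_ge s σ with h | h
    · exact hρz σ ((by linarith : φ.rOut ≤ σ).trans (le_abs_self σ))
    · have h' : σ ≤ -φ.rOut := by
        by_contra hlt
        exact hσ ⟨not_le.1 hlt, h⟩
      exact hρz σ ((by linarith : φ.rOut ≤ -σ).trans (neg_le_abs σ))
  refine ⟨Φ, ?_, hd, hmono, fun s ↦ ⟨?_, ?_⟩, h0, h1⟩
  · rw [contDiff_infty_iff_deriv, hd']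
    exact ⟨fun s ↦ (hd s).differentiableAt, hρs⟩
  · rw [← h0 _ (min_le_right s _)]
    exact hmono (min_le_left _ _)
  · rw [← h1 _ (le_max_right s _)]
    exact hmono (le_max_left _ _)

/-- The test function approximates the indicator of the times before `t`; its fall at `t` recovers
`E t` as a limit of mollifications, for almost every `t`. The zero initial value is encoded by `E`
and `b` vanishing at nonpositive times. -/
theorem ae_le_intervalIntegral_of_distributional {E b : ℝ → ℝ} (hE : LocallyIntegrable E)
    (hb : LocallyIntegrable b) (hE0 : ∀ t ≤ 0, E t = 0) (hb0 : ∀ t ≤ 0, b t = 0)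
    (hbn : ∀ t, 0 ≤ b t)
    (h : ∀ χ : ℝ → ℝ, ContDiff ℝ ∞ χ → HasCompactSupport χ → (∀ t, 0 ≤ χ t) →
      -∫ t, deriv χ t * E t ≤ ∫ t, χ t * b t) :
    ∀ᵐ t, 0 < t → E t ≤ ∫ σ in (0 : ℝ)..t, b σ := by
  let φ : ℕ → ContDiffBump (0 : ℝ) := fun n ↦
    ⟨1 / ((n : ℝ) + 1) / 2, 1 / ((n : ℝ) + 1), by positivity, half_lt_self (by positivity)⟩
  have hφ : Tendsto (fun n ↦ (φ n).rOut) atTop (𝓝 0) := tendsto_one_div_add_atTop_nhds_zero_nat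
  have hφ1 : ∀ n, (φ n).rOut ≤ 1 := fun n ↦
    (div_le_one (by positivity)).2 (by linarith [(Nat.cast_nonneg n : (0 : ℝ) ≤ n)])
  have hae := ContDiffBump.ae_convolution_tendsto_right_of_locallyIntegrable (μ := volume) (K := 2)
    hφ (Eventually.of_forall fun n ↦ by simp only [φ]; linarith) hE
  have hbi : ∀ x y : ℝ, IntervalIntegrable b volume x y := fun x y ↦ (hb.integrableOn_isCompact isCompact_uIcc).intervalIntegrable
  filter_upwards [hae] with t ht ht0
  have hlim : Tendsto (fun n ↦ ∫ σ in (0 : ℝ)..(t + (φ n).rOut), b σ) atTop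
      (𝓝 (∫ σ in (0 : ℝ)..t, b σ)) := by
    have hc := intervalIntegral.continuous_primitive hbi 0
    have := (hc.tendsto (t + 0)).comp (hφ.const_add t)
    simpa [Function.comp_def] using this
  refine le_of_tendsto_of_tendsto' ht hlim fun n ↦ ?_
  obtain ⟨Φ, hΦs, hΦd, hΦm, hΦ01, hΦ0, hΦ1⟩ := exists_smooth_step (φ n)
  have hr0 := (φ n).rOut_pos
  have hr1 := hφ1 n
  set ρ := (φ n).normed volume with hρ
  -- The rise is centred at -2 and has radius at most 1, so it lies where `E` vanishes. The fall at
  -- `t` contributes exactly the mollification of `E` at `t`.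
  set χ : ℝ → ℝ := fun s ↦ Φ (s + 2) - Φ (s - t) with hχ
  have hχs : ContDiff ℝ ∞ χ := (hΦs.comp (contDiff_id.add contDiff_const)).sub
    (hΦs.comp (contDiff_id.sub contDiff_const))
  have hχ0 : ∀ s, 0 ≤ χ s := fun s ↦ sub_nonneg.2 (hΦm (by linarith))
  have hχ1 : ∀ s, χ s ≤ 1 := fun s ↦ by
    have h1 := (hΦ01 (s + 2)).2
    have h2 := (hΦ01 (s - t)).1
    simp only [hχ]; linarith
  have hχz : ∀ s, t + (φ n).rOut ≤ s → χ s = 0 := fun s hs ↦ by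
    simp only [hχ]
    rw [hΦ1 _ (by linarith), hΦ1 _ (by linarith), sub_self]
  have hχz' : ∀ s, s ≤ -3 → χ s = 0 := fun s hs ↦ by
    simp only [hχ]
    rw [hΦ0 _ (by linarith), hΦ0 _ (by linarith), sub_self]
  have hχc : HasCompactSupport χ := by
    refine HasCompactSupport.of_support_subset_isCompact (isCompact_Icc (a := -3)
      (b := t + (φ n).rOut)) fun s hs ↦ ?_
    by_contra hs'
    rcases lt_or_ge s (-3) with h1 | h1
    · exact hs (hχz' s h1.le)
    · exact hs (hχz s (by
        by_contra h2
        exact hs' ⟨h1, (not_le.1 h2).le⟩))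
  have hχd : ∀ s, deriv χ s = ρ (s + 2) - ρ (s - t) := fun s ↦ by
    have h1 := (hΦd (s + 2)).comp_add_const s 2
    have h2 := (hΦd (s - t)).comp_sub_const s t
    exact (h1.sub h2).deriv
  have key := h χ hχs hχc hχ0
  have e1 : -∫ s, deriv χ s * E s = convolution ρ E (lsmul ℝ ℝ) volume t := by
    rw [← integral_neg, convolution_lsmul_swap]
    refine integral_congr_ae (Eventually.of_forall fun s ↦ ?_)
    simp only [hχd, smul_eq_mul]
    have e3 : ρ (t - s) = ρ (s - t) := by
      rw [← neg_sub s t, hρ, (φ n).normed_neg]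
    rcases le_or_gt s 0 with hs | hs
    · simp [hE0 s hs]
    · have : ρ (s + 2) = 0 := by
        rw [← Function.notMem_support, hρ, (φ n).support_normed_eq, mem_ball_zero_iff,
          Real.norm_eq_abs, abs_of_pos (by linarith)]
        linarith
      rw [this, e3]
      ring
  have hχb : Integrable (fun s ↦ χ s * b s) := by
    have := hb.integrable_smul_left_of_hasCompactSupport hχs.continuous hχc
    simpa using this
  have e2 : ∫ s, χ s * b s ≤ ∫ σ in (0 : ℝ)..(t + (φ n).rOut), b σ := by
    have hle : 0 ≤ t + (φ n).rOut := by linarith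
    rw [intervalIntegral.integral_of_le hle, ← integral_indicator measurableSet_Ioc]
    refine integral_mono hχb ?_ fun s ↦ ?_
    · rw [integrable_indicator_iff measurableSet_Ioc]
      exact (hbi 0 _).1
    · by_cases hs : s ∈ Ioc 0 (t + (φ n).rOut)
      · rw [indicator_of_mem hs]
        exact mul_le_of_le_one_left (hbn s) (hχ1 s)
      · rw [indicator_of_notMem hs]
        rcases le_or_gt s 0 with hs0 | hs0
        · simp [hb0 s hs0]
        · have : t + (φ n).rOut ≤ s := by
            by_contra hlt
            exact hs ⟨hs0, (not_le.1 hlt).le⟩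
          simp [hχz s this]
  rw [e1] at key
  exact key.trans e2

/-- Integral Grönwall. The primitive `Y` is monotone, so Y(t) ≤ Y(S) + Y(t) ∫ g over (S, t). Where
that integral is at most 1/2, Y(S) = 0 forces Y(t) = 0, and uniform continuity of the primitive of
`g` gives one step length valid up to `T`. -/
theorem eq_zero_of_le_intervalIntegral {g E : ℝ → ℝ} (hg : LocallyIntegrable g)
    (hgn : ∀ t, 0 ≤ g t) (hEn : ∀ t, 0 ≤ E t) (hgE : LocallyIntegrable fun t ↦ g t * E t)
    (h : ∀ᵐ t, 0 < t → E t ≤ ∫ σ in (0 : ℝ)..t, g σ * E σ) :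
    ∀ᵐ t, 0 < t → E t = 0 := by
  set Y : ℝ → ℝ := fun t ↦ ∫ σ in (0 : ℝ)..t, g σ * E σ with hY
  have hbi : ∀ x y : ℝ, IntervalIntegrable (fun t ↦ g t * E t) volume x y := fun x y ↦
    (hgE.integrableOn_isCompact isCompact_uIcc).intervalIntegrable
  have hgi : ∀ x y : ℝ, IntervalIntegrable g volume x y := fun x y ↦ (hg.integrableOn_isCompact isCompact_uIcc).intervalIntegrable
  have hYc : Continuous Y := intervalIntegral.continuous_primitive hbi 0
  have hYsub : ∀ s t, Y t = Y s + ∫ σ in s..t, g σ * E σ := fun s t ↦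
    (intervalIntegral.integral_add_adjacent_intervals (hbi 0 s) (hbi s t)).symm
  have hYm : Monotone Y := fun s t hst ↦ by
    rw [hYsub s t]
    linarith [intervalIntegral.integral_nonneg_of_forall (μ := volume) hst
      fun σ ↦ mul_nonneg (hgn σ) (hEn σ)]
  have hY0 : Y 0 = 0 := intervalIntegral.integral_same
  have hΓc : Continuous fun t ↦ ∫ σ in (0 : ℝ)..t, g σ :=
    intervalIntegral.continuous_primitive hgi 0
  have hzero : ∀ T : ℝ, 0 < T → Y T = 0 := by
    intro T hT
    have huc := isCompact_Icc (a := (0 : ℝ)) (b := T) |>.uniformContinuousOn_of_continuous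
      hΓc.continuousOn
    obtain ⟨δ, hδ, hδ'⟩ := Metric.uniformContinuousOn_iff.1 huc (1 / 2) (by norm_num)
    have hstep : ∀ S t, 0 ≤ S → S ≤ t → t ≤ T → t - S < δ → Y S = 0 → Y t = 0 := by
      intro S t hS hSt htT hd hYS
      have h1 : ∫ σ in S..t, g σ ≤ 1 / 2 := by
        have := hδ' t ⟨hS.trans hSt, htT⟩ S ⟨hS, hSt.trans htT⟩ (by
          rw [Real.dist_eq, abs_of_nonneg (by linarith)]; exact hd)
        rw [Real.dist_eq, intervalIntegral.integral_interval_sub_left (hgi 0 t) (hgi 0 S)] at this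
        exact (le_abs_self _).trans this.le
      have h2 : ∫ σ in S..t, g σ * E σ ≤ ∫ σ in S..t, g σ * Y t := by
        rw [intervalIntegral.integral_of_le hSt, intervalIntegral.integral_of_le hSt]
        refine setIntegral_mono_on_ae (hbi S t).1 ((hgi S t).1.mul_const _) measurableSet_Ioc ?_
        filter_upwards [h] with σ hσ hσt
        exact mul_le_mul_of_nonneg_left ((hσ (hS.trans_lt hσt.1)).trans (hYm hσt.2)) (hgn σ)
      rw [intervalIntegral.integral_mul_const] at h2
      have h3 : 0 ≤ Y t := hY0 ▸ hYm (hS.trans hSt)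
      have h4 := hYsub S t
      nlinarith
    -- Steps of `δ / 2` satisfy the strict bound by `δ`; the minimum with `T` keeps them where `δ`
    -- is valid.
    have hind : ∀ j : ℕ, Y (min T (j * (δ / 2))) = 0 := by
      intro j
      induction j with
      | zero => simp [hT.le, hY0]
      | succ j ih =>
        have hmono : min T (j * (δ / 2)) ≤ min T ((j + 1 : ℕ) * (δ / 2)) := by
          refine min_le_min le_rfl ?_
          gcongr
          exact Nat.le_succ j
        refine hstep _ _ (le_min hT.le (by positivity)) hmono (min_le_left _ _) ?_ ih
        have : min T ((j + 1 : ℕ) * (δ / 2)) ≤ min T (j * (δ / 2)) + δ / 2 := by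
          push_cast
          rw [min_add]
          exact min_le_min (by linarith) (by linarith)
        linarith
    obtain ⟨j, hj⟩ := exists_nat_gt (T / (δ / 2))
    rw [div_lt_iff₀ (by positivity)] at hj
    have := hind j
    rwa [min_eq_left hj.le] at this
  filter_upwards [h] with t ht ht0
  exact le_antisymm ((ht ht0).trans_eq (hzero t ht0)) (hEn t)

end HeatFlow

namespace HeatFlow

open Filter Topology ENNReal

/-! ### Smooth truncations of the positive part -/

/-- A continuous function with values in `[0, 1]` that vanishes outside `[0, n + 1]` and tends to
the indicator function of `(0, ∞)`. -/
def rampDeriv (n : ℕ) (s : ℝ) : ℝ := max 0 (min 1 (min (n * s) (n + 1 - s)))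

/-- A bounded `C¹` approximation from below of the positive part. -/
noncomputable def ramp (n : ℕ) (s : ℝ) : ℝ := ∫ σ in (0 : ℝ)..s, rampDeriv n σ

/-- A convex approximation from below of half the square of the positive part. -/
noncomputable def rampInt (n : ℕ) (s : ℝ) : ℝ := ∫ σ in (0 : ℝ)..s, ramp n σ

theorem continuous_rampDeriv (n : ℕ) : Continuous (rampDeriv n) := by
  unfold rampDeriv; fun_prop

theorem rampDeriv_nonneg (n : ℕ) (s : ℝ) : 0 ≤ rampDeriv n s := le_max_left _ _

theorem rampDeriv_le_one (n : ℕ) (s : ℝ) : rampDeriv n s ≤ 1 :=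
  max_le zero_le_one (min_le_left _ _)

theorem rampDeriv_of_nonpos (n : ℕ) {s : ℝ} (hs : s ≤ 0) : rampDeriv n s = 0 :=
  max_eq_left ((min_le_right _ _).trans ((min_le_left _ _).trans
    (mul_nonpos_of_nonneg_of_nonpos n.cast_nonneg hs)))

theorem rampDeriv_of_le (n : ℕ) {s : ℝ} (hs : (n : ℝ) + 1 ≤ s) : rampDeriv n s = 0 :=
  max_eq_left ((min_le_right _ _).trans ((min_le_right _ _).trans (by linarith)))

theorem tendsto_rampDeriv (s : ℝ) :
    Tendsto (fun n ↦ rampDeriv n s) atTop (𝓝 (if 0 < s then 1 else 0)) := by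
  split_ifs with hs
  · refine tendsto_const_nhds.congr' ?_
    obtain ⟨N, hN⟩ := exists_nat_gt (max s (1 / s))
    filter_upwards [eventually_ge_atTop N] with n hn
    have hn' : max s (1 / s) < n := hN.trans_le (by exact_mod_cast hn)
    have h1 : s < n := (le_max_left _ _).trans_lt hn'
    have h2 : 1 / s < n := (le_max_right _ _).trans_lt hn'
    rw [div_lt_iff₀ hs] at h2
    have h3 : min 1 (min (n * s) (n + 1 - s)) = 1 :=
      min_eq_left (le_min h2.le (by linarith))
    rw [rampDeriv, h3, max_eq_right zero_le_one]
  · simp only [rampDeriv_of_nonpos _ (not_lt.1 hs), tendsto_const_nhds]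

theorem hasDerivAt_ramp (n : ℕ) (s : ℝ) : HasDerivAt (ramp n) (rampDeriv n s) s :=
  ((continuous_rampDeriv n).integral_hasStrictDerivAt 0 s).hasDerivAt

theorem deriv_ramp (n : ℕ) : deriv (ramp n) = rampDeriv n :=
  funext fun s ↦ (hasDerivAt_ramp n s).deriv

theorem contDiff_ramp (n : ℕ) : ContDiff ℝ 1 (ramp n) := by
  rw [contDiff_one_iff_deriv, deriv_ramp]
  exact ⟨fun s ↦ (hasDerivAt_ramp n s).differentiableAt, continuous_rampDeriv n⟩

theorem monotone_ramp (n : ℕ) : Monotone (ramp n) := by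
  refine monotone_of_deriv_nonneg (fun s ↦ (hasDerivAt_ramp n s).differentiableAt) fun s ↦ ?_
  rw [deriv_ramp]
  exact rampDeriv_nonneg n s

theorem ramp_of_nonpos (n : ℕ) {s : ℝ} (hs : s ≤ 0) : ramp n s = 0 := by
  refine intervalIntegral.integral_zero_ae (Eventually.of_forall fun σ hσ ↦ ?_)
  rw [uIoc_of_ge hs] at hσ
  exact rampDeriv_of_nonpos n hσ.2

theorem ramp_nonneg (n : ℕ) (s : ℝ) : 0 ≤ ramp n s := by
  rw [← ramp_of_nonpos n (min_le_right s 0)]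
  exact monotone_ramp n (min_le_left _ _)

theorem ramp_le_posPart (n : ℕ) (s : ℝ) : ramp n s ≤ max s 0 := by
  rcases le_or_gt s 0 with hs | hs
  · rw [ramp_of_nonpos n hs]; exact le_max_right _ _
  · rw [max_eq_left hs.le]
    have := intervalIntegral.integral_mono_on (μ := volume) hs.le
      ((continuous_rampDeriv n).intervalIntegrable 0 s)
      (continuous_const.intervalIntegrable (u := fun _ : ℝ ↦ (1 : ℝ)) 0 s)
      (fun σ _ ↦ rampDeriv_le_one n σ)
    simpa [ramp] using this

theorem ramp_le (n : ℕ) (s : ℝ) : ramp n s ≤ n + 1 := by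
  have hn : (0 : ℝ) ≤ n + 1 := by positivity
  rcases le_total s (n + 1) with hs | hs
  · exact (ramp_le_posPart n s).trans (max_le hs hn)
  · have h1 : ramp n s = ramp n (n + 1) := by
      have h2 := intervalIntegral.integral_add_adjacent_intervals
        ((continuous_rampDeriv n).intervalIntegrable (μ := volume) 0 ((n : ℝ) + 1))
        ((continuous_rampDeriv n).intervalIntegrable ((n : ℝ) + 1) s)
      have h3 : ∫ σ in ((n : ℝ) + 1)..s, rampDeriv n σ = 0 := by
        refine intervalIntegral.integral_zero_ae (Eventually.of_forall fun σ hσ ↦ ?_)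
        rw [uIoc_of_le hs] at hσ
        exact rampDeriv_of_le n hσ.1.le
      rw [h3, add_zero] at h2
      exact h2.symm
    rw [h1]
    exact (ramp_le_posPart n _).trans (max_le le_rfl hn)

theorem abs_ramp_le (n : ℕ) (s : ℝ) : |ramp n s| ≤ n + 1 := by
  rw [abs_of_nonneg (ramp_nonneg n s)]; exact ramp_le n s

theorem tendsto_ramp (s : ℝ) : Tendsto (fun n ↦ ramp n s) atTop (𝓝 (max s 0)) := by
  rcases le_or_gt s 0 with hs | hs
  · simp only [ramp_of_nonpos _ hs, max_eq_right hs, tendsto_const_nhds]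
  · rw [max_eq_left hs.le]
    have : Tendsto (fun n ↦ ∫ σ in (0 : ℝ)..s, rampDeriv n σ) atTop
        (𝓝 (∫ σ in (0 : ℝ)..s, (1 : ℝ))) := by
      refine intervalIntegral.tendsto_integral_filter_of_dominated_convergence (fun _ ↦ 1)
        (Eventually.of_forall fun n ↦ (continuous_rampDeriv n).aestronglyMeasurable)
        (Eventually.of_forall fun n ↦ Eventually.of_forall fun σ _ ↦ ?_) (by simp)
        (Eventually.of_forall fun σ hσ ↦ ?_)
      · rw [Real.norm_of_nonneg (rampDeriv_nonneg n σ)]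
        exact rampDeriv_le_one n σ
      · rw [uIoc_of_le hs.le] at hσ
        simpa [hσ.1] using tendsto_rampDeriv σ
    simpa [ramp] using this

theorem hasDerivAt_rampInt (n : ℕ) (s : ℝ) : HasDerivAt (rampInt n) (ramp n s) s :=
  ((contDiff_ramp n).continuous.integral_hasStrictDerivAt 0 s).hasDerivAt

theorem deriv_rampInt (n : ℕ) : deriv (rampInt n) = ramp n :=
  funext fun s ↦ (hasDerivAt_rampInt n s).deriv

theorem contDiff_rampInt (n : ℕ) : ContDiff ℝ 1 (rampInt n) := by
  rw [contDiff_one_iff_deriv, deriv_rampInt]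
  exact ⟨fun s ↦ (hasDerivAt_rampInt n s).differentiableAt, (contDiff_ramp n).continuous⟩

theorem rampInt_of_nonpos (n : ℕ) {s : ℝ} (hs : s ≤ 0) : rampInt n s = 0 := by
  refine intervalIntegral.integral_zero_ae (Eventually.of_forall fun σ hσ ↦ ?_)
  rw [uIoc_of_ge hs] at hσ
  exact ramp_of_nonpos n hσ.2

theorem rampInt_nonneg (n : ℕ) (s : ℝ) : 0 ≤ rampInt n s := by
  rcases le_total s 0 with hs | hs
  · rw [rampInt_of_nonpos n hs]
  · exact intervalIntegral.integral_nonneg_of_forall hs fun σ ↦ ramp_nonneg n σ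

theorem rampInt_le (n : ℕ) (s : ℝ) : rampInt n s ≤ max s 0 ^ 2 / 2 := by
  rcases le_or_gt s 0 with hs | hs
  · rw [rampInt_of_nonpos n hs]; positivity
  · rw [max_eq_left hs.le]
    have := intervalIntegral.integral_mono_on (μ := volume) hs.le
      ((contDiff_ramp n).continuous.intervalIntegrable 0 s)
      (continuous_id.intervalIntegrable 0 s)
      (fun σ hσ ↦ (ramp_le_posPart n σ).trans_eq (max_eq_left hσ.1))
    simpa [rampInt] using this

theorem tendsto_rampInt (s : ℝ) :
    Tendsto (fun n ↦ rampInt n s) atTop (𝓝 (max s 0 ^ 2 / 2)) := by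
  rcases le_or_gt s 0 with hs | hs
  · simp [rampInt_of_nonpos _ hs, max_eq_right hs]
  · rw [max_eq_left hs.le]
    have : Tendsto (fun n ↦ ∫ σ in (0 : ℝ)..s, ramp n σ) atTop
        (𝓝 (∫ σ in (0 : ℝ)..s, σ)) := by
      refine intervalIntegral.tendsto_integral_filter_of_dominated_convergence (fun _ ↦ s)
        (Eventually.of_forall fun n ↦ (contDiff_ramp n).continuous.aestronglyMeasurable)
        (Eventually.of_forall fun n ↦ Eventually.of_forall fun σ hσ ↦ ?_) (by simp)
        (Eventually.of_forall fun σ hσ ↦ ?_)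
      · rw [uIoc_of_le hs.le] at hσ
        rw [Real.norm_of_nonneg (ramp_nonneg n σ)]
        exact (ramp_le_posPart n σ).trans (max_le hσ.2 hs.le)
      · rw [uIoc_of_le hs.le] at hσ
        simpa [hσ.1.le] using tendsto_ramp σ
    simpa [rampInt] using this

/-- Tangent inequality from monotonicity of `ramp n`; this is the convexity used in
`entropy_inequality`. -/
theorem rampInt_sub_le (n : ℕ) (a b : ℝ) : rampInt n a - rampInt n b ≤ ramp n a * (a - b) := by
  have hi : ∀ x y : ℝ, IntervalIntegrable (ramp n) volume x y := fun x y ↦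
    (contDiff_ramp n).continuous.intervalIntegrable x y
  have h1 : rampInt n a - rampInt n b = ∫ σ in b..a, ramp n σ :=
    intervalIntegral.integral_interval_sub_left (hi 0 a) (hi 0 b)
  rw [h1]
  rcases le_total b a with h | h
  · have := intervalIntegral.integral_mono_on (μ := volume) h (hi b a)
      (continuous_const.intervalIntegrable (u := fun _ : ℝ ↦ ramp n a) b a)
      (fun σ hσ ↦ monotone_ramp n hσ.2)
    rw [intervalIntegral.integral_const, smul_eq_mul] at this
    linarith
  · have := intervalIntegral.integral_mono_on (μ := volume) h
      (continuous_const.intervalIntegrable (u := fun _ : ℝ ↦ ramp n a) a b) (hi a b)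
      (fun σ hσ ↦ monotone_ramp n hσ.1)
    rw [intervalIntegral.integral_const, smul_eq_mul] at this
    rw [intervalIntegral.integral_symm]
    linarith

/-! ### Measurability of the supremum norm of a slice -/

/-- The norm of a slice is at most `c` exactly when the slice of the set where the function exceeds
`c` in norm is null, and the measure of a slice of a measurable set is a measurable function of `t`.
-/
theorem aemeasurable_eLpNorm_top_slice {α β : Type*} [MeasurableSpace α] [MeasurableSpace β]
    {ν : Measure α} {μ : Measure β} [SFinite μ] [SFinite ν] {d : α → β → ℝ}
    (hd : AEStronglyMeasurable (Function.uncurry d) (ν.prod μ)) :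
    AEMeasurable (fun t ↦ eLpNorm (d t) ⊤ μ) ν := by
  obtain ⟨d', hd', hdd'⟩ := hd
  refine ⟨fun t ↦ eLpNorm (fun y ↦ d' (t, y)) ⊤ μ, ?_, ?_⟩
  · refine measurable_of_Iic fun c ↦ ?_
    have hm : MeasurableSet {z : α × β | c < ‖d' z‖ₑ} :=
      measurableSet_lt measurable_const hd'.measurable.enorm
    have := measurable_measure_prodMk_left (ν := μ) hm
    convert this (measurableSet_singleton 0) using 1
    ext t
    simp only [mem_preimage, mem_Iic, mem_singleton_iff, eLpNorm_exponent_top]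
    constructor
    · intro h
      have h1 : ∀ᵐ y ∂μ, ‖d' (t, y)‖ₑ ≤ c := by
        filter_upwards [ae_le_eLpNormEssSup (f := fun y ↦ d' (t, y)) (μ := μ)] with y hy
        exact hy.trans h
      rw [ae_iff] at h1
      simpa using h1
    · intro h
      refine essSup_le_of_ae_le c ?_
      rw [EventuallyLE, ae_iff]
      simpa using h
  · filter_upwards [Measure.ae_ae_of_ae_prod hdd'] with t ht
    exact eLpNorm_congr_ae ht

theorem ae_memLp_two_slice {α β E : Type*} [MeasurableSpace α] [MeasurableSpace β]
    [NormedAddCommGroup E] {ν : Measure α} {μ : Measure β} [SFinite μ] [SFinite ν] {u : α → β → E}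
    (hu : MemLp (Function.uncurry u) 2 (ν.prod μ)) : ∀ᵐ t ∂ν, MemLp (u t) 2 μ := by
  have h1 := (memLp_two_iff_integrable_sq_norm hu.1).1 hu
  filter_upwards [h1.prod_right_ae, hu.1.prodMk_left] with t ht hm
  exact (memLp_two_iff_integrable_sq_norm hm).2 ht

theorem ae_memLp_two_slice_of_restrict {E : Type*} [NormedAddCommGroup E] {Ω : Set E3} {T : ℝ}
    {u : ℝ → E3 → E}
    (hu : MemLp (Function.uncurry u) 2 (volume.restrict (Ioo 0 T ×ˢ Ω))) :
    ∀ᵐ t ∂(volume.restrict (Ioo 0 T)), MemLp (u t) 2 (volume.restrict Ω) := by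
  rw [show (volume.restrict (Ioo 0 T ×ˢ Ω) : Measure (ℝ × E3))
    = (volume.restrict (Ioo 0 T)).prod (volume.restrict Ω) by rw [Measure.prod_restrict]; rfl] at hu
  exact ae_memLp_two_slice hu

theorem ae_restrict_Ioi_of_forall_Ioo {p : ℝ → Prop}
    (h : ∀ T : ℝ, 0 < T → ∀ᵐ t ∂(volume.restrict (Ioo 0 T)), p t) :
    ∀ᵐ t ∂(volume.restrict (Ioi (0 : ℝ))), p t := by
  have h1 : Ioi (0 : ℝ) = ⋃ n : ℕ, Ioo 0 ((n : ℝ) + 1) := by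
    ext t
    simp only [mem_Ioi, mem_iUnion, mem_Ioo]
    refine ⟨fun ht ↦ ?_, fun ⟨n, hn⟩ ↦ hn.1⟩
    obtain ⟨n, hn⟩ := exists_nat_gt t
    exact ⟨n, ht, by linarith⟩
  rw [h1, ae_restrict_iUnion_iff]
  exact fun n ↦ h _ (by positivity)

theorem locallyIntegrable_of_forall_Ioo {E : Type*} [NormedAddCommGroup E] {f : ℝ → E}
    (h : ∀ T : ℝ, 0 < T → IntegrableOn f (Ioo (-T) T)) : LocallyIntegrable f := by
  intro t
  have ht : 0 < |t| + 1 := by positivity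
  refine ⟨Ioo (-(|t| + 1)) (|t| + 1), Ioo_mem_nhds ?_ ?_, h _ ht⟩
  · linarith [neg_abs_le t]
  · linarith [le_abs_self t]

/-! ### Extension to negative times -/

/-- The function that is `u` for positive times and the time-independent `u₀` before. -/
noncomputable def extendPast {E : Type*} (u : ℝ → E3 → E) (u₀ : E3 → E) (z : ℝ × E3) : E :=
  open Classical in if 0 < z.1 then u z.1 z.2 else u₀ z.2

theorem extendPast_of_pos {E : Type*} {u : ℝ → E3 → E} {u₀ : E3 → E} {t : ℝ} (ht : 0 < t) (x : E3) :
    extendPast u u₀ (t, x) = u t x := if_pos ht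

theorem extendPast_of_nonpos {E : Type*} {u : ℝ → E3 → E} {u₀ : E3 → E} {t : ℝ} (ht : t ≤ 0)
    (x : E3) : extendPast u u₀ (t, x) = u₀ x := if_neg (not_lt.2 ht)

theorem memLp_extendPast {E : Type*} [NormedAddCommGroup E] {Ω : Set E3}
    [IsFiniteMeasure (volume.restrict Ω)] {p : ℝ≥0∞} {u : ℝ → E3 → E} {u₀ : E3 → E} {T : ℝ}
    (hu : MemLp (Function.uncurry u) p (volume.restrict (Ioo 0 T ×ˢ Ω)))
    (hu₀ : MemLp u₀ p (volume.restrict Ω)) :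
    MemLp (extendPast u u₀) p (slab (volume.restrict Ω) T) := by
  set S : Set (ℝ × E3) := Ioi 0 ×ˢ univ with hS
  have hSm : MeasurableSet S := measurableSet_Ioi.prod MeasurableSet.univ
  have h1 : MemLp (S.indicator (Function.uncurry u)) p (slab (volume.restrict Ω) T) := by
    rw [memLp_indicator_iff_restrict hSm, slab, hS, ← Measure.prod_restrict, Measure.restrict_univ,
      Measure.restrict_restrict measurableSet_Ioi]
    have h2 : (volume.restrict (Ioo 0 T ×ˢ Ω) : Measure (ℝ × E3))
        = (volume.restrict (Ioo 0 T)).prod (volume.restrict Ω) := by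
      rw [Measure.prod_restrict]; rfl
    rw [h2] at hu
    refine hu.mono_measure (Measure.prod_mono ?_ le_rfl)
    have hsub : Ioi 0 ∩ Ioo (-T) T ⊆ Ioo 0 T := fun t ht ↦ ⟨ht.1, ht.2.2⟩
    exact Measure.restrict_mono hsub le_rfl
  have h3 : MemLp (Sᶜ.indicator fun z ↦ u₀ z.2) p (slab (volume.restrict Ω) T) :=
    (hu₀.comp_snd _).indicator hSm.compl
  refine (h1.add h3).ae_eq (Eventually.of_forall fun z ↦ ?_)
  by_cases hz : 0 < z.1
  · have : z ∈ S := ⟨hz, mem_univ _⟩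
    simp [extendPast, hz, this, Function.uncurry]
  · have : z ∉ S := fun h ↦ hz h.1
    simp [extendPast, hz, this]

end HeatFlow

namespace HeatFlow

open Filter Topology ENNReal

/-! ### The truncated energy inequality -/

section Weak

variable {Ω : Set E3} [IsFiniteMeasure (volume.restrict Ω)] {ϰ : ℝ} {v G : ℝ → E3 → E3}
  {θ : ℝ → E3 → ℝ} {θ₀ : E3 → ℝ}

/-- The weak formulation on the whole time axis, with the solution extended by its initial value. -/
theorem weak_identity_extendPast
    (hΘ : ∀ T, 0 < T → MemLp (extendPast θ θ₀) 2 (slab (volume.restrict Ω) T))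
    {φ : E3 → ℝ} {Φ : E3 → E3} (hφ : MemLp φ 2 (volume.restrict Ω)) {η : ℝ → ℝ}
    (hη : ContDiff ℝ ∞ η) (hηc : HasCompactSupport η)
    (h : -(∫ t in Ioi (0 : ℝ), deriv η t * ∫ x in Ω, θ t x * φ x)
          + (∫ t in Ioi (0 : ℝ), η t *
              ∫ x in Ω, (ϰ * inner ℝ (G t x) (Φ x) + inner ℝ (v t x) (G t x) * φ x))
          = η 0 * ∫ x in Ω, θ₀ x * φ x) :
    -(∫ s, deriv η s * ∫ x in Ω, extendPast θ θ₀ (s, x) * φ x)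
      + ∫ s, η s * ∫ x in Ω, (inner ℝ (ϰ • extendPast G 0 (s, x)) (Φ x)
        + inner ℝ (extendPast v 0 (s, x)) (extendPast G 0 (s, x)) * φ x) = 0 := by
  have hη1 : ContDiff ℝ 1 η := hη.of_le (by exact_mod_cast le_top)
  have hη' : Continuous (deriv η) := hη1.continuous_deriv le_rfl
  obtain ⟨L, hL, hL0⟩ := exists_forall_le_abs_eq_zero hηc.deriv
  obtain ⟨C, hC⟩ := hηc.deriv.exists_bound_of_continuous hη'
  have i1 : Integrable (fun s ↦ deriv η s * ∫ x in Ω, extendPast θ θ₀ (s, x) * φ x) := by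
    have m1 : MemLp (fun z : ℝ × E3 ↦ φ z.2 * extendPast θ θ₀ z) 1
        (slab (volume.restrict Ω) L) := (hΘ L hL).mul (hφ.comp_snd _)
    have m2 := memLp_mul_of_slab m1 hη' hC hL0
    rw [memLp_one_iff_integrable] at m2
    refine m2.integral_prod_left.congr (Eventually.of_forall fun s ↦ ?_)
    simp only [smul_eq_mul, integral_const_mul, mul_comm (φ _)]
  -- Before time 0 the extension is constant in time and the integral of `deriv η` is `η 0`, which
  -- reproduces the initial term; the gradient and velocity are extended by zero and add nothing.
  have e1 : ∫ s, deriv η s * ∫ x in Ω, extendPast θ θ₀ (s, x) * φ x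
      = η 0 * (∫ x in Ω, θ₀ x * φ x)
        + ∫ t in Ioi (0 : ℝ), deriv η t * ∫ x in Ω, θ t x * φ x := by
    rw [← intervalIntegral.integral_Iic_add_Ioi (b := 0) i1.integrableOn i1.integrableOn]
    congr 1
    · rw [← hηc.integral_Iic_deriv_eq hη1 0, ← integral_mul_const]
      refine setIntegral_congr_fun measurableSet_Iic fun s hs ↦ ?_
      simp only [extendPast_of_nonpos (mem_Iic.1 hs)]
    · refine setIntegral_congr_fun measurableSet_Ioi fun s hs ↦ ?_
      simp only [extendPast_of_pos (mem_Ioi.1 hs)]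
  have e2 : ∫ s, η s * ∫ x in Ω, (inner ℝ (ϰ • extendPast G 0 (s, x)) (Φ x)
        + inner ℝ (extendPast v 0 (s, x)) (extendPast G 0 (s, x)) * φ x)
      = ∫ t in Ioi (0 : ℝ), η t *
        ∫ x in Ω, (ϰ * inner ℝ (G t x) (Φ x) + inner ℝ (v t x) (G t x) * φ x) := by
    rw [← setIntegral_eq_integral_of_forall_compl_eq_zero (s := Ioi (0 : ℝ))]
    · refine setIntegral_congr_fun measurableSet_Ioi fun s hs ↦ ?_
      simp only [extendPast_of_pos (mem_Ioi.1 hs), real_inner_smul_left]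
    · intro s hs
      simp [extendPast_of_nonpos (not_lt.1 hs)]
  rw [e1, e2]
  linarith

end Weak

theorem ae_slice_of_ae_restrict_Ioi {p : ℝ → Prop}
    (h : ∀ᵐ t ∂(volume.restrict (Ioi (0 : ℝ))), p t) : ∀ᵐ t : ℝ, 0 < t → p t :=
  (ae_restrict_iff' measurableSet_Ioi).1 h

variable {φ₀ : E2 → ℝ} {c₀ a ϰ : ℝ} {d₁ d₂ : ℝ → E2 → ℝ} {v G : ℝ → E3 → E3}
  {θ : ℝ → E3 → ℝ} {θ₀ : E3 → ℝ} {k : ℝ}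

theorem IsCrossSection.isFiniteMeasure_cylinder (hD : IsCrossSection φ₀ c₀) :
    IsFiniteMeasure (volume.restrict (cylinder φ₀ c₀ a)) :=
  ⟨by rw [Measure.restrict_apply_univ]; exact hD.isBounded_cylinder.measure_lt_top⟩

/-- The square integral of an `L²` function is bounded by the square of its norm. -/
theorem integral_sq_le_of_eLpNorm_le {α : Type*} [MeasurableSpace α] {μ : Measure α} {u : α → ℝ}
    (hu : MemLp u 2 μ) {B : ℝ≥0} (h : eLpNorm u 2 μ ≤ B) : ∫ x, u x ^ 2 ∂μ ≤ (B : ℝ) ^ 2 := by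
  have h1 := hu.eLpNorm_eq_integral_rpow_norm two_ne_zero ENNReal.ofNat_ne_top
  rw [h1, ENNReal.ofReal_le_coe] at h
  simp only [ENNReal.toReal_ofNat, Real.rpow_two, Real.norm_eq_abs, sq_abs] at h
  have h2 : 0 ≤ ∫ x, u x ^ 2 ∂μ := integral_nonneg fun x ↦ sq_nonneg _
  have h3 : (∫ x, u x ^ 2 ∂μ) ^ (2⁻¹ : ℝ) = Real.sqrt (∫ x, u x ^ 2 ∂μ) := by
    rw [Real.sqrt_eq_rpow, one_div]
  rw [h3] at h
  calc ∫ x, u x ^ 2 ∂μ = Real.sqrt (∫ x, u x ^ 2 ∂μ) ^ 2 := (Real.sq_sqrt h2).symm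
    _ ≤ (B : ℝ) ^ 2 := by
      gcongr

end HeatFlow

/-! ### Inflow bound in time and the truncated balance at a fixed time -/

namespace HeatFlow

open Filter Topology ENNReal

/-- Multiplication by a square integrable function of time preserves `L²`, for functions that are
bounded in time with values in `L²`. -/
theorem memLp_mul_of_integral_sq_le {μ : Measure E3} [SFinite μ] {m : ℝ → ℝ}
    (hm : MemLp m 2 volume) {W : ℝ × E3 → ℝ} {T B : ℝ} (hW : MemLp W 2 (slab μ T))
    (hB : ∀ᵐ t ∂(volume.restrict (Ioo (-T) T)), ∫ x, W (t, x) ^ 2 ∂μ ≤ B) :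
    MemLp (fun z ↦ m z.1 * W z) 2 (slab μ T) := by
  have hmT : MemLp m 2 (volume.restrict (Ioo (-T) T)) := hm.restrict _
  have hmeas : AEStronglyMeasurable (fun z : ℝ × E3 ↦ m z.1 * W z) (slab μ T) :=
    hmT.1.comp_fst.mul hW.1
  have hW' := (memLp_two_iff_integrable_sq hW.1).1 hW
  have hsq : AEStronglyMeasurable (fun z : ℝ × E3 ↦ (m z.1 * W z) ^ 2) (slab μ T) := hmeas.pow 2
  rw [memLp_two_iff_integrable_sq hmeas, slab, integrable_prod_iff hsq]
  constructor
  · filter_upwards [hW'.prod_right_ae] with t ht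
    simp only [mul_pow]
    exact ht.const_mul _
  · have h2 : Integrable (fun t ↦ m t ^ 2 * B) (volume.restrict (Ioo (-T) T)) :=
      ((memLp_two_iff_integrable_sq hmT.1).1 hmT).mul_const _
    refine h2.mono' hsq.norm.integral_prod_right' ?_
    filter_upwards [hB] with t ht
    have h3 : ∀ x, ‖(m t * W (t, x)) ^ 2‖ = m t ^ 2 * W (t, x) ^ 2 := fun x ↦ by
      rw [Real.norm_of_nonneg (sq_nonneg _), mul_pow]
    simp only [h3]
    rw [integral_const_mul, Real.norm_of_nonneg
      (mul_nonneg (sq_nonneg _) (integral_nonneg fun x ↦ sq_nonneg _))]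
    exact mul_le_mul_of_nonneg_left ht (sq_nonneg _)

/-- The inflow is bounded by a square integrable function of time. -/
theorem IsFluxData.exists_inflow_bound {D : Set E2} {d₁ d₂ : ℝ → E2 → ℝ} (hd : IsFluxData D d₁ d₂) :
    ∃ m : ℝ → ℝ, (∀ t, 0 ≤ m t) ∧ MemLp m 2 volume ∧
      ∀ᵐ t : ℝ, 0 < t → (∀ᵐ y ∂(volume.restrict D), d₁ t y ≤ m t) ∧
        ∀ᵐ y ∂(volume.restrict D), 0 ≤ d₂ t y := by
  have hprod : (volume.restrict (Ioi (0 : ℝ) ×ˢ D) : Measure (ℝ × E2))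
      = (volume.restrict (Ioi 0)).prod (volume.restrict D) := by
    rw [Measure.prod_restrict]; rfl
  have hms := hd.measurable₁
  have hn2 := hd.nonneg₂
  rw [hprod] at hms hn2
  have hN := aemeasurable_eLpNorm_top_slice hms
  have hfin : ∀ᵐ t ∂(volume.restrict (Ioi (0 : ℝ))),
      eLpNorm (d₁ t) ⊤ (volume.restrict D) < ⊤ := by
    filter_upwards [ae_lt_top' (hN.pow_const 2) hd.memL2Linfty₁.ne] with t ht
    exact (ENNReal.pow_lt_top_iff).1 ht |>.resolve_right two_ne_zero
  -- The bound is the sup norm of the slice, set to zero for nonpositive times. `toReal` turns an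
  -- infinite norm into 0, which by `hfin` affects only a null set of times.
  refine ⟨(Ioi (0 : ℝ)).indicator fun t ↦ (eLpNorm (d₁ t) ⊤ (volume.restrict D)).toReal,
    fun t ↦ indicator_nonneg (fun _ _ ↦ ENNReal.toReal_nonneg) t, ?_, ?_⟩
  · rw [memLp_indicator_iff_restrict measurableSet_Ioi]
    refine ⟨hN.ennreal_toReal.aestronglyMeasurable, ?_⟩
    rw [eLpNorm_lt_top_iff_lintegral_rpow_enorm_lt_top two_ne_zero ENNReal.ofNat_ne_top]
    refine lt_of_le_of_lt (lintegral_mono fun t ↦ ?_) hd.memL2Linfty₁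
    rw [ENNReal.toReal_ofNat, ENNReal.rpow_two, Real.enorm_of_nonneg ENNReal.toReal_nonneg]
    gcongr
    exact ENNReal.ofReal_toReal_le
  · filter_upwards [ae_slice_of_ae_restrict_Ioi hfin,
      ae_slice_of_ae_restrict_Ioi (Measure.ae_ae_of_ae_prod hn2)] with t h1 h2 ht
    refine ⟨?_, h2 ht⟩
    rw [indicator_of_mem (mem_Ioi.2 ht)]
    filter_upwards [ae_le_eLpNormEssSup (f := d₁ t) (μ := volume.restrict D)] with y hy
    rw [← eLpNorm_exponent_top] at hy
    refine (le_abs_self _).trans ?_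
    rw [← Real.norm_eq_abs, ← toReal_enorm]
    exact ENNReal.toReal_mono (h1 ht).ne hy

theorem rampInt_le_mul_abs (n : ℕ) (s : ℝ) : rampInt n s ≤ (n + 1) * |s| := by
  have h := rampInt_sub_le n s 0
  rw [rampInt_of_nonpos n le_rfl, sub_zero, sub_zero] at h
  refine h.trans ((mul_le_mul_of_nonneg_left (le_abs_self s) (ramp_nonneg n s)).trans ?_)
  exact mul_le_mul_of_nonneg_right (ramp_le n s) (abs_nonneg s)

section Slice

variable {Ω : Set E3} [IsFiniteMeasure (volume.restrict Ω)] {u : E3 → ℝ} {G : E3 → E3}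

theorem HasH1Gradient.ramp (hΩ : IsOpen Ω) (h : HasH1Gradient Ω u G) (n : ℕ) (k : ℝ) :
    HasH1Gradient Ω (fun x ↦ ramp n (u x - k)) (fun x ↦ rampDeriv n (u x - k) • G x) := by
  have hd : ∀ s, deriv (fun s ↦ HeatFlow.ramp n (s - k)) s = rampDeriv n (s - k) := fun s ↦ by
    rw [deriv_comp_sub_const, deriv_ramp]
  have hc : ContDiff ℝ 1 fun s ↦ HeatFlow.ramp n (s - k) :=
    (contDiff_ramp n).comp (contDiff_id.sub contDiff_const)
  have := h.comp hΩ hc (L := 1) (fun s ↦ ?_) ?_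
  · simpa only [hd] using this
  · rw [hd, abs_of_nonneg (rampDeriv_nonneg n _)]
    exact rampDeriv_le_one n _
  · exact MemLp.of_bound (hc.continuous.comp_aestronglyMeasurable h.memLp.1) (n + 1)
      (Eventually.of_forall fun x ↦ abs_ramp_le n _)

/-- The derivative is bounded by `n + 1`, so the composition grows linearly and stays in H¹. The
untruncated square need not lie in H¹, where the flux inequality is stated. -/
theorem HasH1Gradient.rampInt (hΩ : IsOpen Ω) (h : HasH1Gradient Ω u G) (n : ℕ) (k : ℝ) :
    HasH1Gradient Ω (fun x ↦ rampInt n (u x - k)) (fun x ↦ HeatFlow.ramp n (u x - k) • G x) := by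
  have hd : ∀ s, deriv (fun s ↦ HeatFlow.rampInt n (s - k)) s = HeatFlow.ramp n (s - k) :=
    fun s ↦ by rw [deriv_comp_sub_const, deriv_rampInt]
  have hc : ContDiff ℝ 1 fun s ↦ HeatFlow.rampInt n (s - k) :=
    (contDiff_rampInt n).comp (contDiff_id.sub contDiff_const)
  have := h.comp hΩ hc (L := n + 1) (fun s ↦ ?_) ?_
  · simpa only [hd] using this
  · rw [hd]
    exact abs_ramp_le n _
  · refine MemLp.of_le_mul (c := n + 1) (h.memLp.sub (memLp_const k))
      (hc.continuous.comp_aestronglyMeasurable h.memLp.1) (Eventually.of_forall fun x ↦ ?_)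
    rw [Real.norm_of_nonneg (rampInt_nonneg n _)]
    exact rampInt_le_mul_abs n _

end Slice

/-- The dissipation minus the flux term at a fixed time. -/
theorem integral_neg_dissipation_add_flux_le {Ω : Set E3} [IsFiniteMeasure (volume.restrict Ω)]
    (hΩ : IsOpen Ω) {u : E3 → ℝ} {G v : E3 → E3} (hu : HasH1Gradient Ω u G)
    (hv : MemLp v 2 (volume.restrict Ω)) {ϰ m C k : ℝ} (n : ℕ)
    (hflux : ∀ (w : E3 → ℝ) (H : E3 → E3), HasH1Gradient Ω w H →
      (∀ᵐ x ∂(volume.restrict Ω), 0 ≤ w x) →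
      -∫ x in Ω, inner ℝ (v x) (H x) ≤ m * (C * ∫ x in Ω, (w x + ‖H x‖))) :
    ∫ x in Ω, -(inner ℝ (ϰ • G x) (rampDeriv n (u x - k) • G x)
        + inner ℝ (v x) (G x) * ramp n (u x - k))
      ≤ ∫ x in Ω, (-(ϰ * (rampDeriv n (u x - k) * ‖G x‖ ^ 2))
        + m * (C * (rampInt n (u x - k) + ramp n (u x - k) * ‖G x‖))) := by
  have h1 := hu.ramp hΩ n k
  have h2 := hu.rampInt hΩ n k
  -- The convective term `inner (v x) (G x) * ramp n (u x - k)` is `v` paired with the gradient of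
  -- `rampInt n (u - k)`, a nonnegative H¹ function, so it is a flux.
  have h3 := hflux _ _ h2 (Eventually.of_forall fun x ↦ rampInt_nonneg n _)
  have i1 : Integrable (fun x ↦ inner ℝ (G x) (rampDeriv n (u x - k) • G x))
      (volume.restrict Ω) := integrable_inner_of_memLp (p := 2) (q := 2) hu.memLp_grad h1.memLp_grad
  have i1' : Integrable (fun x ↦ -(ϰ * inner ℝ (G x) (rampDeriv n (u x - k) • G x)))
      (volume.restrict Ω) := (i1.const_mul ϰ).neg
  have i2 : Integrable (fun x ↦ inner ℝ (v x) (ramp n (u x - k) • G x))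
      (volume.restrict Ω) := integrable_inner_of_memLp (p := 2) (q := 2) hv h2.memLp_grad
  have i3 : Integrable (fun x ↦ rampInt n (u x - k) + ‖ramp n (u x - k) • G x‖)
      (volume.restrict Ω) :=
    (h2.memLp.integrable one_le_two).add (h2.memLp_grad.integrable one_le_two).norm
  have e1 : ∫ x in Ω, -(inner ℝ (ϰ • G x) (rampDeriv n (u x - k) • G x)
        + inner ℝ (v x) (G x) * ramp n (u x - k))
      = -(ϰ * ∫ x in Ω, inner ℝ (G x) (rampDeriv n (u x - k) • G x))
        - ∫ x in Ω, inner ℝ (v x) (ramp n (u x - k) • G x) := by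
    rw [← integral_const_mul, ← integral_neg, ← integral_sub i1' i2]
    refine integral_congr_ae (Eventually.of_forall fun x ↦ ?_)
    simp only [real_inner_smul_left, real_inner_smul_right]
    ring
  have e2 : ∫ x in Ω, (-(ϰ * (rampDeriv n (u x - k) * ‖G x‖ ^ 2))
        + m * (C * (rampInt n (u x - k) + ramp n (u x - k) * ‖G x‖)))
      = -(ϰ * ∫ x in Ω, inner ℝ (G x) (rampDeriv n (u x - k) • G x))
        + m * (C * ∫ x in Ω, (rampInt n (u x - k) + ‖ramp n (u x - k) • G x‖)) := by
    rw [← integral_const_mul, ← integral_neg, ← integral_const_mul C, ← integral_const_mul m,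
      ← integral_add i1' ((i3.const_mul C).const_mul m)]
    refine integral_congr_ae (Eventually.of_forall fun x ↦ ?_)
    simp only [real_inner_smul_right, real_inner_self_eq_norm_sq, norm_smul,
      Real.norm_of_nonneg (ramp_nonneg n _)]
  rw [e1, e2]
  linarith

end HeatFlow

namespace HeatFlow

open Filter Topology ENNReal

/-! ### Truncated energy inequality, with bounds uniform in the truncation -/

section Truncated

variable {Ω : Set E3} [IsFiniteMeasure (volume.restrict Ω)] {ϰ C k : ℝ} {v G : ℝ → E3 → E3}
  {θ : ℝ → E3 → ℝ} {θ₀ : E3 → ℝ} {m : ℝ → ℝ}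

theorem InEnergyClass.memLp_extendPast (hE : InEnergyClass Ω θ G)
    (hθ₀ : MemLp θ₀ 2 (volume.restrict Ω)) (T : ℝ) (hT : 0 < T) :
    MemLp (extendPast θ θ₀) 2 (slab (volume.restrict Ω) T) :=
  HeatFlow.memLp_extendPast (hE.memLp T hT) hθ₀

theorem InEnergyClass.memLp_extendPast_grad (hE : InEnergyClass Ω θ G) (T : ℝ) (hT : 0 < T) :
    MemLp (extendPast G 0) 2 (slab (volume.restrict Ω) T) :=
  HeatFlow.memLp_extendPast (hE.memLp_grad T hT) MemLp.zero

theorem InEnergyClass.memLp_posPart (hE : InEnergyClass Ω θ G)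
    (hθ₀ : MemLp θ₀ 2 (volume.restrict Ω)) (T : ℝ) (hT : 0 < T) :
    MemLp (fun z ↦ max (extendPast θ θ₀ z - k) 0) 2 (slab (volume.restrict Ω) T) :=
  ((hE.memLp_extendPast hθ₀ T hT).sub (memLp_const k)).pos_part

/-- A common bound for the terms of the truncated energy inequalities. -/
theorem abs_dissipation_add_flux_le {r' r R W m g : ℝ} (hϰ : 0 ≤ ϰ) (hC : 0 ≤ C) (hm : 0 ≤ m)
    (hr' : 0 ≤ r') (hr'1 : r' ≤ 1) (hr : 0 ≤ r) (hrW : r ≤ W) (hR : 0 ≤ R) (hRW : R ≤ W ^ 2 / 2)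
    (hg : 0 ≤ g) :
    |-(ϰ * (r' * g ^ 2)) + m * (C * (R + r * g))|
      ≤ ϰ * (g * g) + C * (m * W * W + m * W * g) := by
  have h1 : ϰ * (r' * g ^ 2) ≤ ϰ * (g * g) := by
    rw [← sq]
    exact mul_le_mul_of_nonneg_left (mul_le_of_le_one_left (sq_nonneg g) hr'1) hϰ
  have h2 : 0 ≤ ϰ * (r' * g ^ 2) := by positivity
  have h3 : 0 ≤ m * (C * (R + r * g)) := by positivity
  have h4 : m * (C * (R + r * g)) ≤ m * (C * (W ^ 2 + W * g)) := by
    have : R ≤ W ^ 2 := hRW.trans (by linarith [sq_nonneg W])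
    gcongr
  have h5 : m * (C * (W ^ 2 + W * g)) = C * (m * W * W + m * W * g) := by ring
  rw [abs_le]
  constructor <;> linarith

/-- The dominating function for the limit in `n`, which it does not involve. `hmW` makes `m W`
square integrable, so that its products with `W` and with the gradient are integrable. -/
theorem memLp_dissipation_bound (hE : InEnergyClass Ω θ G) (hθ₀ : MemLp θ₀ 2 (volume.restrict Ω))
    (hmW : ∀ T : ℝ, 0 < T → MemLp (fun z ↦ m z.1 * max (extendPast θ θ₀ z - k) 0) 2
      (slab (volume.restrict Ω) T)) (T : ℝ) (hT : 0 < T) :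
    MemLp (fun z ↦ ϰ * (‖extendPast G 0 z‖ * ‖extendPast G 0 z‖)
      + C * (m z.1 * max (extendPast θ θ₀ z - k) 0 * max (extendPast θ θ₀ z - k) 0
        + m z.1 * max (extendPast θ θ₀ z - k) 0 * ‖extendPast G 0 z‖)) 1
      (slab (volume.restrict Ω) T) := by
  have hG := (hE.memLp_extendPast_grad T hT).norm
  have hW := hE.memLp_posPart (k := k) hθ₀ T hT
  have h1 : MemLp (fun z ↦ ‖extendPast G 0 z‖ * ‖extendPast G 0 z‖) 1
    (slab (volume.restrict Ω) T) := hG.mul hG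
  have h2 : MemLp (fun z ↦ m z.1 * max (extendPast θ θ₀ z - k) 0 * max (extendPast θ θ₀ z - k) 0) 1
    (slab (volume.restrict Ω) T) := hW.mul (hmW T hT)
  have h3 : MemLp (fun z ↦ m z.1 * max (extendPast θ θ₀ z - k) 0 * ‖extendPast G 0 z‖) 1
    (slab (volume.restrict Ω) T) := hG.mul (hmW T hT)
  exact (h1.const_mul ϰ).add ((h2.add h3).const_mul C)

theorem aestronglyMeasurable_dissipation (hE : InEnergyClass Ω θ G)
    (hθ₀ : MemLp θ₀ 2 (volume.restrict Ω)) (hm : AEStronglyMeasurable m volume) (n : ℕ) (T : ℝ)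
    (hT : 0 < T) :
    AEStronglyMeasurable (fun z ↦
        -(ϰ * (rampDeriv n (extendPast θ θ₀ z - k) * ‖extendPast G 0 z‖ ^ 2))
        + m z.1 * (C * (rampInt n (extendPast θ θ₀ z - k)
          + ramp n (extendPast θ θ₀ z - k) * ‖extendPast G 0 z‖)))
      (slab (volume.restrict Ω) T) := by
  have hΘ := ((hE.memLp_extendPast hθ₀ T hT).sub (memLp_const k)).1
  have hG := (hE.memLp_extendPast_grad T hT).1.norm
  have h1 := (continuous_rampDeriv n).comp_aestronglyMeasurable hΘ
  have h2 := (contDiff_ramp n).continuous.comp_aestronglyMeasurable hΘ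
  have h3 := (contDiff_rampInt n).continuous.comp_aestronglyMeasurable hΘ
  have h4 : AEStronglyMeasurable (fun z : ℝ × E3 ↦ m z.1) (slab (volume.restrict Ω) T) :=
    hm.restrict.comp_fst
  exact ((h1.mul (hG.pow 2)).const_mul ϰ).neg.add (h4.mul ((h3.add (h2.mul hG)).const_mul C))

theorem memLp_dissipation (hϰ : 0 ≤ ϰ) (hC : 0 ≤ C) (hm0 : ∀ t, 0 ≤ m t)
    (hE : InEnergyClass Ω θ G) (hθ₀ : MemLp θ₀ 2 (volume.restrict Ω))
    (hm : AEStronglyMeasurable m volume)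
    (hmW : ∀ T : ℝ, 0 < T → MemLp (fun z ↦ m z.1 * max (extendPast θ θ₀ z - k) 0) 2
      (slab (volume.restrict Ω) T)) (n : ℕ) (T : ℝ) (hT : 0 < T) :
    MemLp (fun z ↦
        -(ϰ * (rampDeriv n (extendPast θ θ₀ z - k) * ‖extendPast G 0 z‖ ^ 2))
        + m z.1 * (C * (rampInt n (extendPast θ θ₀ z - k)
          + ramp n (extendPast θ θ₀ z - k) * ‖extendPast G 0 z‖))) 1
      (slab (volume.restrict Ω) T) := by
  refine (memLp_dissipation_bound (ϰ := ϰ) (C := C) hE hθ₀ hmW T hT).mono'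
    (aestronglyMeasurable_dissipation hE hθ₀ hm n T hT) (Eventually.of_forall fun z ↦ ?_)
  exact abs_dissipation_add_flux_le hϰ hC (hm0 _) (rampDeriv_nonneg n _) (rampDeriv_le_one n _)
    (ramp_nonneg n _) (ramp_le_posPart n _) (rampInt_nonneg n _) (rampInt_le n _) (norm_nonneg _)

/-- The energy inequality for the smooth truncations of `(θ - k)₊`. -/
theorem truncated_energy_inequality (hΩ : IsOpen Ω) (hϰ : 0 ≤ ϰ) (hC : 0 ≤ C)
    (hm0 : ∀ t, 0 ≤ m t) (hm : AEStronglyMeasurable m volume)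
    (hE : InEnergyClass Ω θ G) (hθ₀ : MemLp θ₀ 2 (volume.restrict Ω))
    (hk : ∀ᵐ x ∂(volume.restrict Ω), θ₀ x ≤ k)
    (hv : ∀ T : ℝ, 0 < T → MemLp (Function.uncurry v) 2 (volume.restrict (Ioo 0 T ×ˢ Ω)))
    (hmW : ∀ T : ℝ, 0 < T → MemLp (fun z ↦ m z.1 * max (extendPast θ θ₀ z - k) 0) 2
      (slab (volume.restrict Ω) T))
    (hflux : ∀ᵐ t : ℝ, 0 < t → ∀ (w : E3 → ℝ) (H : E3 → E3), HasH1Gradient Ω w H →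
      (∀ᵐ x ∂(volume.restrict Ω), 0 ≤ w x) →
      -∫ x in Ω, inner ℝ (v t x) (H x) ≤ m t * (C * ∫ x in Ω, (w x + ‖H x‖)))
    (hweak : ∀ (φ : E3 → ℝ) (Φ : E3 → E3), HasH1Gradient Ω φ Φ →
      (∃ M : ℝ, ∀ᵐ x ∂(volume.restrict Ω), |φ x| ≤ M) →
      ∀ η : ℝ → ℝ, ContDiff ℝ ∞ η → HasCompactSupport η →
        -(∫ t in Ioi (0 : ℝ), deriv η t * ∫ x in Ω, θ t x * φ x)
          + (∫ t in Ioi (0 : ℝ), η t *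
              ∫ x in Ω, (ϰ * inner ℝ (G t x) (Φ x) + inner ℝ (v t x) (G t x) * φ x))
          = η 0 * ∫ x in Ω, θ₀ x * φ x)
    (n : ℕ) {χ : ℝ → ℝ} (hχ : ContDiff ℝ ∞ χ) (hχc : HasCompactSupport χ) (hχ0 : ∀ t, 0 ≤ χ t) :
    -∫ z, deriv χ z.1 * rampInt n (extendPast θ θ₀ z - k)
        ∂((volume : Measure ℝ).prod (volume.restrict Ω))
      ≤ ∫ z, χ z.1 *
        (-(ϰ * (rampDeriv n (extendPast θ θ₀ z - k) * ‖extendPast G 0 z‖ ^ 2))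
          + m z.1 * (C * (rampInt n (extendPast θ θ₀ z - k)
            + ramp n (extendPast θ θ₀ z - k) * ‖extendPast G 0 z‖)))
        ∂((volume : Measure ℝ).prod (volume.restrict Ω)) := by
  have hΘ := hE.memLp_extendPast hθ₀
  have hG := hE.memLp_extendPast_grad
  have hV : ∀ T : ℝ, 0 < T → MemLp (extendPast v 0) 2 (slab (volume.restrict Ω) T) := fun T hT ↦
    memLp_extendPast (hv T hT) MemLp.zero
  have hP : ∀ T : ℝ, 0 < T → MemLp (fun z ↦ inner ℝ (extendPast v 0 z) (extendPast G 0 z)) 1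
      (slab (volume.restrict Ω) T) := fun T hT ↦
    memLp_one_iff_integrable.2 (integrable_inner_of_memLp (p := 2) (q := 2) (hV T hT) (hG T hT))
  have hg : ∀ T : ℝ, 0 < T → MemLp (fun z ↦ ϰ • extendPast G 0 z) 2
      (slab (volume.restrict Ω) T) := fun T hT ↦ (hG T hT).const_smul ϰ
  have hΘk : ∀ T : ℝ, 0 < T → MemLp (fun z ↦ extendPast θ θ₀ z - k) 2
      (slab (volume.restrict Ω) T) := fun T hT ↦ (hΘ T hT).sub (memLp_const k)
  have hH : ∀ T : ℝ, 0 < T → MemLp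
      (fun z ↦ rampDeriv n (extendPast θ θ₀ z - k) • extendPast G 0 z) 2
      (slab (volume.restrict Ω) T) := fun T hT ↦ by
    refine (hG T hT).mono (((continuous_rampDeriv n).comp_aestronglyMeasurable
      (hΘk T hT).1).smul (hG T hT).1) (Eventually.of_forall fun z ↦ ?_)
    rw [norm_smul, Real.norm_of_nonneg (rampDeriv_nonneg n _)]
    exact mul_le_of_le_one_left (norm_nonneg _) (rampDeriv_le_one n _)
  have hF : ∀ T : ℝ, 0 < T → MemLp (fun z ↦ rampInt n (extendPast θ θ₀ z - k)) 1
      (slab (volume.restrict Ω) T) := fun T hT ↦ by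
    refine MemLp.of_le_mul (c := n + 1) ((hΘk T hT).mono_exponent one_le_two)
      ((contDiff_rampInt n).continuous.comp_aestronglyMeasurable (hΘk T hT).1)
      (Eventually.of_forall fun z ↦ ?_)
    rw [Real.norm_of_nonneg (rampInt_nonneg n _)]
    exact rampInt_le_mul_abs n _
  have hgrad := ae_slice_of_ae_restrict_Ioi hE.hasGradient
  have heq : ∀ᵐ t : ℝ, ∀ η : ℝ → ℝ, ContDiff ℝ ∞ η → HasCompactSupport η →
      -(∫ s, deriv η s * ∫ x in Ω, extendPast θ θ₀ (s, x) * ramp n (extendPast θ θ₀ (t, x) - k))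
        + ∫ s, η s * ∫ x in Ω, (inner ℝ (ϰ • extendPast G 0 (s, x))
            (rampDeriv n (extendPast θ θ₀ (t, x) - k) • extendPast G 0 (t, x))
          + inner ℝ (extendPast v 0 (s, x)) (extendPast G 0 (s, x))
            * ramp n (extendPast θ θ₀ (t, x) - k)) = 0 := by
    filter_upwards [hgrad] with t ht η hη hηc
    rcases lt_or_ge 0 t with h0 | h0
    · have h1 := (ht h0).ramp hΩ n k
      have := weak_identity_extendPast hΘ h1.memLp hη hηc (hweak _ _ h1
        ⟨n + 1, Eventually.of_forall fun x ↦ abs_ramp_le n _⟩ η hη hηc)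
      simpa only [extendPast_of_pos h0] using this
    -- For `t ≤ 0` the frozen test function is `ramp n (θ₀ - k)`, which vanishes because `θ₀ ≤ k`;
    -- this is where the bound on the initial data enters.
    · have hr : ∀ᵐ x ∂(volume.restrict Ω), ramp n (θ₀ x - k) = 0 := by
        filter_upwards [hk] with x hx
        exact ramp_of_nonpos n (by linarith)
      have z1 : ∀ s, ∫ x in Ω, extendPast θ θ₀ (s, x) * ramp n (extendPast θ θ₀ (t, x) - k) = 0 :=
        fun s ↦ integral_eq_zero_of_ae <| by
          filter_upwards [hr] with x hx
          rw [extendPast_of_nonpos h0, hx, mul_zero, Pi.zero_apply]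
      have z2 : ∀ s, ∫ x in Ω, (inner ℝ (ϰ • extendPast G 0 (s, x))
            (rampDeriv n (extendPast θ θ₀ (t, x) - k) • extendPast G 0 (t, x))
          + inner ℝ (extendPast v 0 (s, x)) (extendPast G 0 (s, x))
            * ramp n (extendPast θ θ₀ (t, x) - k)) = 0 :=
        fun s ↦ integral_eq_zero_of_ae <| by
          filter_upwards [hr] with x hx
          rw [extendPast_of_nonpos (u := θ) h0, hx, mul_zero, extendPast_of_nonpos h0,
            Pi.zero_apply, Pi.zero_apply, smul_zero, inner_zero_right, add_zero]
      simp only [z1, z2, mul_zero, integral_zero, neg_zero, add_zero]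
  have key := entropy_inequality (f := fun s ↦ ramp n (s - k)) (F := fun s ↦ rampInt n (s - k))
    (M := n + 1) hΘ hP hg hH ((contDiff_ramp n).continuous.comp (continuous_sub_right k))
    (fun s ↦ abs_ramp_le n _) (fun b c ↦ by simpa using rampInt_sub_le n (b - k) (c - k)) hF heq
    hχ hχc hχ0
  refine key.trans ?_
  obtain ⟨L, hL, hL0⟩ := exists_forall_le_abs_eq_zero hχc
  obtain ⟨B, hB⟩ := hχc.exists_bound_of_continuous hχ.continuous
  have i1 := memLp_one_iff_integrable.1 (memLp_mul_of_slab
    (memLp_dissipation (n := n) hϰ hC hm0 hE hθ₀ hm hmW L hL) hχ.continuous hB hL0)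
  have j1 : MemLp (fun z ↦ inner ℝ (ϰ • extendPast G 0 z)
        (rampDeriv n (extendPast θ θ₀ z - k) • extendPast G 0 z)
      + inner ℝ (extendPast v 0 z) (extendPast G 0 z) * ramp n (extendPast θ θ₀ z - k)) 1
      (slab (volume.restrict Ω) L) := by
    refine (memLp_one_iff_integrable.2
      (integrable_inner_of_memLp (p := 2) (q := 2) (hg L hL) (hH L hL))).add ?_
    refine MemLp.of_le_mul (c := n + 1) (hP L hL) ((hP L hL).1.mul
      ((contDiff_ramp n).continuous.comp_aestronglyMeasurable (hΘk L hL).1))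
      (Eventually.of_forall fun z ↦ ?_)
    rw [norm_mul, mul_comm]
    exact mul_le_mul_of_nonneg_right (abs_ramp_le n _) (norm_nonneg _)
  have i2 := memLp_one_iff_integrable.1 (memLp_mul_of_slab j1.neg hχ.continuous hB hL0)
  simp only [smul_eq_mul, Pi.neg_apply] at i1 i2
  rw [← integral_neg]
  refine (integral_congr_ae (Eventually.of_forall fun z ↦ (mul_neg _ _).symm)).trans_le ?_
  rw [integral_prod _ i1, integral_prod _ i2]
  refine integral_mono_ae i2.integral_prod_left i1.integral_prod_left ?_
  have hvs : ∀ᵐ t : ℝ, 0 < t → MemLp (v t) 2 (volume.restrict Ω) := by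
    refine ae_slice_of_ae_restrict_Ioi (ae_restrict_Ioi_of_forall_Ioo fun T hT ↦ ?_)
    exact ae_memLp_two_slice_of_restrict (hv T hT)
  filter_upwards [hgrad, hvs, hflux] with t ht hvt hft
  simp only [integral_const_mul]
  refine mul_le_mul_of_nonneg_left ?_ (hχ0 t)
  rcases lt_or_ge 0 t with h0 | h0
  · simp only [extendPast_of_pos h0]
    exact integral_neg_dissipation_add_flux_le hΩ (ht h0) (hvt h0) n (hft h0)
  -- At nonpositive times the extended gradient is zero, so the left side is zero and only the
  -- nonnegative `rampInt` term is left on the right.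
  · simp only [extendPast_of_nonpos h0, Pi.zero_apply, smul_zero, inner_zero_right, zero_mul,
      add_zero, neg_zero, integral_zero, norm_zero, mul_zero]
    refine integral_nonneg fun x ↦ ?_
    have := rampInt_nonneg n (θ₀ x - k)
    have := hm0 t
    simp only [ne_eq, OfNat.ofNat_ne_zero, not_false_eq_true, zero_pow, mul_zero, neg_zero,
      zero_add, Pi.zero_apply]
    positivity

end Truncated

end HeatFlow

namespace HeatFlow

open Filter Topology ENNReal

/-! ### Passage to the positive part and the maximum principle -/

section EnergyInequality

variable {Ω : Set E3} [IsFiniteMeasure (volume.restrict Ω)] {ϰ C k : ℝ} {v G : ℝ → E3 → E3}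
  {θ : ℝ → E3 → ℝ} {θ₀ : E3 → ℝ} {m : ℝ → ℝ}

/-- Young's inequality absorbs the flux term into the dissipation. -/
theorem dissipation_add_flux_le {W m g : ℝ} (hϰ : 0 < ϰ) :
    -(ϰ * (1 * g ^ 2)) + m * (C * (W ^ 2 / 2 + W * g))
      ≤ (C * m + C ^ 2 / (2 * ϰ) * m ^ 2) * (W ^ 2 / 2) := by
  -- Completing the square in `g`: the cross term `C m W g` costs C² m² W²/(4ϰ), which is C²/(2ϰ) m²
  -- times W²/2.
  have h : (C * m + C ^ 2 / (2 * ϰ) * m ^ 2) * (W ^ 2 / 2)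
      - (-(ϰ * (1 * g ^ 2)) + m * (C * (W ^ 2 / 2 + W * g)))
      = (2 * ϰ * g - C * m * W) ^ 2 / (4 * ϰ) := by
    field_simp
    ring
  have : 0 ≤ (2 * ϰ * g - C * m * W) ^ 2 / (4 * ϰ) := by positivity
  linarith

/-- The energy inequality for the positive part `(θ - k)₊`, in the sense of distributions in time. -/
theorem energy_inequality (hΩ : IsOpen Ω) (hϰ : 0 < ϰ) (hC : 0 ≤ C)
    (hm0 : ∀ t, 0 ≤ m t) (hm : AEStronglyMeasurable m volume)
    (hE : InEnergyClass Ω θ G) (hθ₀ : MemLp θ₀ 2 (volume.restrict Ω))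
    (hk : ∀ᵐ x ∂(volume.restrict Ω), θ₀ x ≤ k)
    (hv : ∀ T : ℝ, 0 < T → MemLp (Function.uncurry v) 2 (volume.restrict (Ioo 0 T ×ˢ Ω)))
    (hmW : ∀ T : ℝ, 0 < T → MemLp (fun z ↦ m z.1 * max (extendPast θ θ₀ z - k) 0) 2
      (slab (volume.restrict Ω) T))
    (hflux : ∀ᵐ t : ℝ, 0 < t → ∀ (w : E3 → ℝ) (H : E3 → E3), HasH1Gradient Ω w H →
      (∀ᵐ x ∂(volume.restrict Ω), 0 ≤ w x) →
      -∫ x in Ω, inner ℝ (v t x) (H x) ≤ m t * (C * ∫ x in Ω, (w x + ‖H x‖)))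
    (hweak : ∀ (φ : E3 → ℝ) (Φ : E3 → E3), HasH1Gradient Ω φ Φ →
      (∃ M : ℝ, ∀ᵐ x ∂(volume.restrict Ω), |φ x| ≤ M) →
      ∀ η : ℝ → ℝ, ContDiff ℝ ∞ η → HasCompactSupport η →
        -(∫ t in Ioi (0 : ℝ), deriv η t * ∫ x in Ω, θ t x * φ x)
          + (∫ t in Ioi (0 : ℝ), η t *
              ∫ x in Ω, (ϰ * inner ℝ (G t x) (Φ x) + inner ℝ (v t x) (G t x) * φ x))
          = η 0 * ∫ x in Ω, θ₀ x * φ x)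
    {χ : ℝ → ℝ} (hχ : ContDiff ℝ ∞ χ) (hχc : HasCompactSupport χ) (hχ0 : ∀ t, 0 ≤ χ t) :
    -∫ z, deriv χ z.1 * (max (extendPast θ θ₀ z - k) 0 ^ 2 / 2)
        ∂((volume : Measure ℝ).prod (volume.restrict Ω))
      ≤ ∫ z, χ z.1 * ((C * m z.1 + C ^ 2 / (2 * ϰ) * m z.1 ^ 2)
          * (max (extendPast θ θ₀ z - k) 0 ^ 2 / 2))
        ∂((volume : Measure ℝ).prod (volume.restrict Ω)) := by
  have hχ1 : ContDiff ℝ 1 χ := hχ.of_le (by exact_mod_cast le_top)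
  have hχ' : Continuous (deriv χ) := hχ1.continuous_deriv le_rfl
  obtain ⟨L, hL, hL0⟩ := exists_forall_le_abs_eq_zero hχc
  obtain ⟨L', hL', hL0'⟩ := exists_forall_le_abs_eq_zero hχc.deriv
  obtain ⟨B, hB⟩ := hχc.exists_bound_of_continuous hχ.continuous
  obtain ⟨B', hB'⟩ := hχc.deriv.exists_bound_of_continuous hχ'
  have hsq : ∀ T : ℝ, 0 < T → MemLp (fun z ↦ max (extendPast θ θ₀ z - k) 0 ^ 2 / 2) 1
      (slab (volume.restrict Ω) T) := fun T hT ↦ by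
    have h := hE.memLp_posPart (k := k) hθ₀ T hT
    exact memLp_one_iff_integrable.2 (((memLp_two_iff_integrable_sq h.1).1 h).div_const 2)
  -- the left-hand side
  have lim1 : Tendsto (fun n ↦ -∫ z, deriv χ z.1 * rampInt n (extendPast θ θ₀ z - k)
        ∂((volume : Measure ℝ).prod (volume.restrict Ω))) atTop
      (𝓝 (-∫ z, deriv χ z.1 * (max (extendPast θ θ₀ z - k) 0 ^ 2 / 2)
        ∂((volume : Measure ℝ).prod (volume.restrict Ω)))) := by
    have i1 := memLp_one_iff_integrable.1 (memLp_mul_of_slab (hsq L' hL') hχ' hB' hL0')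
    refine (tendsto_integral_of_dominated_convergence _ (fun n ↦ ?_) i1.norm (fun n ↦ ?_) ?_).neg
    · have hR : MemLp (fun z ↦ rampInt n (extendPast θ θ₀ z - k)) 1
          (slab (volume.restrict Ω) L') := by
        refine (hsq L' hL').mono ((contDiff_rampInt n).continuous.comp_aestronglyMeasurable
          ((hE.memLp_extendPast hθ₀ L' hL').sub (memLp_const k)).1)
          (Eventually.of_forall fun z ↦ ?_)
        rw [Real.norm_of_nonneg (rampInt_nonneg n _), Real.norm_of_nonneg (by positivity)]
        exact rampInt_le n _
      exact (memLp_mul_of_slab hR hχ' hB' hL0').1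
    · refine Eventually.of_forall fun z ↦ ?_
      rw [norm_mul, norm_smul]
      refine mul_le_mul_of_nonneg_left ?_ (norm_nonneg _)
      rw [Real.norm_of_nonneg (rampInt_nonneg n _), Real.norm_of_nonneg (by positivity)]
      exact rampInt_le n _
    · exact Eventually.of_forall fun z ↦ (tendsto_rampInt _).const_mul _
  -- the right-hand side
  have hbd : ∀ n z, ‖χ z.1 * (-(ϰ * (rampDeriv n (extendPast θ θ₀ z - k) * ‖extendPast G 0 z‖ ^ 2))
          + m z.1 * (C * (rampInt n (extendPast θ θ₀ z - k)
            + ramp n (extendPast θ θ₀ z - k) * ‖extendPast G 0 z‖)))‖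
        ≤ χ z.1 • (ϰ * (‖extendPast G 0 z‖ * ‖extendPast G 0 z‖)
      + C * (m z.1 * max (extendPast θ θ₀ z - k) 0 * max (extendPast θ θ₀ z - k) 0
        + m z.1 * max (extendPast θ θ₀ z - k) 0 * ‖extendPast G 0 z‖)) := fun n z ↦ by
    rw [norm_mul, Real.norm_of_nonneg (hχ0 _), smul_eq_mul]
    exact mul_le_mul_of_nonneg_left (abs_dissipation_add_flux_le hϰ.le hC (hm0 _)
      (rampDeriv_nonneg n _) (rampDeriv_le_one n _) (ramp_nonneg n _) (ramp_le_posPart n _)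
      (rampInt_nonneg n _) (rampInt_le n _) (norm_nonneg _)) (hχ0 _)
  have j1 := memLp_one_iff_integrable.1 (memLp_mul_of_slab
    (memLp_dissipation_bound (ϰ := ϰ) (C := C) (k := k) hE hθ₀ hmW L hL) hχ.continuous hB hL0)
  have meas : ∀ n, AEStronglyMeasurable (fun z ↦ χ z.1 *
      (-(ϰ * (rampDeriv n (extendPast θ θ₀ z - k) * ‖extendPast G 0 z‖ ^ 2))
          + m z.1 * (C * (rampInt n (extendPast θ θ₀ z - k)
            + ramp n (extendPast θ θ₀ z - k) * ‖extendPast G 0 z‖))))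
      ((volume : Measure ℝ).prod (volume.restrict Ω)) := fun n ↦
    (memLp_mul_of_slab (memLp_dissipation (n := n) hϰ.le hC hm0 hE hθ₀ hm hmW L hL)
      hχ.continuous hB hL0).1
  have hlim : ∀ z : ℝ × E3, Tendsto (fun n ↦ χ z.1 *
      (-(ϰ * (rampDeriv n (extendPast θ θ₀ z - k) * ‖extendPast G 0 z‖ ^ 2))
          + m z.1 * (C * (rampInt n (extendPast θ θ₀ z - k)
            + ramp n (extendPast θ θ₀ z - k) * ‖extendPast G 0 z‖)))) atTop
      (𝓝 (χ z.1 * (-(ϰ * ((if 0 < extendPast θ θ₀ z - k then 1 else 0)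
          * ‖extendPast G 0 z‖ ^ 2))
        + m z.1 * (C * (max (extendPast θ θ₀ z - k) 0 ^ 2 / 2
            + max (extendPast θ θ₀ z - k) 0 * ‖extendPast G 0 z‖))))) := fun z ↦
    (((((tendsto_rampDeriv _).mul_const _).const_mul ϰ).neg).add
      (((((tendsto_rampInt _).add ((tendsto_ramp _).mul_const _)).const_mul C)).const_mul
        (m z.1))).const_mul (χ z.1)
  have lim2 := tendsto_integral_of_dominated_convergence _ meas j1
    (fun n ↦ Eventually.of_forall (hbd n)) (Eventually.of_forall hlim)
  have hle := le_of_tendsto_of_tendsto' lim1 lim2 fun n ↦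
    truncated_energy_inequality hΩ hϰ.le hC hm0 hm hE hθ₀ hk hv hmW hflux hweak n hχ hχc hχ0
  refine hle.trans (integral_mono_ae ?_ ?_ (Eventually.of_forall fun z ↦ ?_))
  · refine j1.mono' (aestronglyMeasurable_of_tendsto_ae atTop meas (Eventually.of_forall hlim))
      (Eventually.of_forall fun z ↦ ?_)
    exact le_of_tendsto' (hlim z).norm fun n ↦ hbd n z
  · have h1 : MemLp (fun z ↦ m z.1 * max (extendPast θ θ₀ z - k) 0
        * max (extendPast θ θ₀ z - k) 0) 1 (slab (volume.restrict Ω) L) :=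
      (hE.memLp_posPart hθ₀ L hL).mul (hmW L hL)
    have h2 : MemLp (fun z ↦ m z.1 * max (extendPast θ θ₀ z - k) 0
        * (m z.1 * max (extendPast θ θ₀ z - k) 0)) 1 (slab (volume.restrict Ω) L) :=
      (hmW L hL).mul (hmW L hL)
    refine (memLp_one_iff_integrable.1 (memLp_mul_of_slab
      ((h1.const_mul (C / 2)).add (h2.const_mul (C ^ 2 / (4 * ϰ)))) hχ.continuous hB hL0)).congr
      (Eventually.of_forall fun z ↦ ?_)
    simp only [Pi.add_apply, smul_eq_mul]
    field_simp
    ring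
  · refine mul_le_mul_of_nonneg_left ?_ (hχ0 _)
    -- Where `θ > k` the full dissipation is available for Young's inequality; elsewhere the
    -- positive part is zero and both sides vanish.
    split_ifs with h
    · exact dissipation_add_flux_le hϰ
    · rw [max_eq_right (not_lt.1 h)]
      simp

/-- A solution with initial values below `k` stays below `k`, provided that the flux term is
controlled by a square integrable function of time. -/
theorem ae_le_of_energy_inequality (hΩ : IsOpen Ω) (hϰ : 0 < ϰ) (hC : 0 ≤ C)
    (hm0 : ∀ t, 0 ≤ m t) (hm : MemLp m 2 volume)
    (hE : InEnergyClass Ω θ G) (hθ₀ : MemLp θ₀ 2 (volume.restrict Ω))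
    (hk : ∀ᵐ x ∂(volume.restrict Ω), θ₀ x ≤ k)
    (hv : ∀ T : ℝ, 0 < T → MemLp (Function.uncurry v) 2 (volume.restrict (Ioo 0 T ×ˢ Ω)))
    (hflux : ∀ᵐ t : ℝ, 0 < t → ∀ (w : E3 → ℝ) (H : E3 → E3), HasH1Gradient Ω w H →
      (∀ᵐ x ∂(volume.restrict Ω), 0 ≤ w x) →
      -∫ x in Ω, inner ℝ (v t x) (H x) ≤ m t * (C * ∫ x in Ω, (w x + ‖H x‖)))
    (hweak : ∀ (φ : E3 → ℝ) (Φ : E3 → E3), HasH1Gradient Ω φ Φ →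
      (∃ M : ℝ, ∀ᵐ x ∂(volume.restrict Ω), |φ x| ≤ M) →
      ∀ η : ℝ → ℝ, ContDiff ℝ ∞ η → HasCompactSupport η →
        -(∫ t in Ioi (0 : ℝ), deriv η t * ∫ x in Ω, θ t x * φ x)
          + (∫ t in Ioi (0 : ℝ), η t *
              ∫ x in Ω, (ϰ * inner ℝ (G t x) (Φ x) + inner ℝ (v t x) (G t x) * φ x))
          = η 0 * ∫ x in Ω, θ₀ x * φ x) :
    ∀ᵐ t ∂(volume.restrict (Ioi (0 : ℝ))), ∀ᵐ x ∂(volume.restrict Ω), θ t x ≤ k := by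
  set W : ℝ × E3 → ℝ := fun z ↦ max (extendPast θ θ₀ z - k) 0 with hWdef
  have hW := hE.memLp_posPart (k := k) hθ₀
  have hWneg : ∀ t ≤ 0, ∀ᵐ x ∂(volume.restrict Ω), W (t, x) = 0 := fun t ht ↦ by
    filter_upwards [hk] with x hx
    rw [hWdef]
    simp only [extendPast_of_nonpos ht]
    exact max_eq_right (by linarith)
  have hWslice : ∀ᵐ t : ℝ, 0 < t → MemLp (fun x ↦ W (t, x)) 2 (volume.restrict Ω) := by
    filter_upwards [ae_slice_of_ae_restrict_Ioi hE.hasGradient] with t ht h0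
    simp only [hWdef, extendPast_of_pos h0]
    exact ((ht h0).memLp.sub (memLp_const k)).pos_part
  set E : ℝ → ℝ := fun t ↦ ∫ x in Ω, W (t, x) ^ 2 / 2 with hEdef
  set g : ℝ → ℝ := fun t ↦ C * m t + C ^ 2 / (2 * ϰ) * m t ^ 2 with hgdef
  have hEneg : ∀ t ≤ 0, E t = 0 := fun t ht ↦ integral_eq_zero_of_ae <| by
    filter_upwards [hWneg t ht] with x hx
    simp [hx]
  have hEn : ∀ t, 0 ≤ E t := fun t ↦ integral_nonneg fun x ↦ by positivity
  have hgn : ∀ t, 0 ≤ g t := fun t ↦ by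
    have := hm0 t
    positivity
  -- The bound of `θ` in L_∞(0,T; L₂), through (θ - k)₊² ≤ 2 θ² + 2 k². It makes `m W` square
  -- integrable although `m` is only in L² in time.
  have hWB : ∀ T : ℝ, 0 < T → ∃ B, ∀ᵐ t ∂(volume.restrict (Ioo (-T) T)),
      ∫ x in Ω, W (t, x) ^ 2 ≤ B := fun T hT ↦ by
    obtain ⟨B, hB⟩ := hE.essBounded T hT
    refine ⟨2 * (B : ℝ) ^ 2 + 2 * k ^ 2 * volume.real Ω, ?_⟩
    rw [ae_restrict_iff' measurableSet_Ioo] at hB ⊢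
    filter_upwards [hB, ae_slice_of_ae_restrict_Ioi hE.hasGradient] with t hBt ht hT'
    rcases lt_or_ge 0 t with h0 | h0
    · have hθ := (ht h0).memLp
      have i1 := (memLp_two_iff_integrable_sq hθ.1).1 hθ
      have i2 : Integrable (fun x ↦ 2 * θ t x ^ 2 + 2 * k ^ 2) (volume.restrict Ω) :=
        (i1.const_mul 2).add (integrable_const _)
      have h1 : ∫ x in Ω, (2 * θ t x ^ 2 + 2 * k ^ 2)
          = 2 * (∫ x in Ω, θ t x ^ 2) + 2 * k ^ 2 * volume.real Ω := by
        rw [integral_add (i1.const_mul 2) (integrable_const _), integral_const_mul,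
          integral_const, smul_eq_mul, measureReal_restrict_apply_univ, mul_comm (volume.real Ω)]
      have h2 := integral_sq_le_of_eLpNorm_le hθ (hBt ⟨h0, hT'.2⟩)
      have h3 : ∫ x in Ω, W (t, x) ^ 2 ≤ ∫ x in Ω, (2 * θ t x ^ 2 + 2 * k ^ 2) := by
        refine integral_mono_of_nonneg (Eventually.of_forall fun x ↦ sq_nonneg _) i2
          (Eventually.of_forall fun x ↦ ?_)
        simp only [hWdef, extendPast_of_pos h0]
        rcases max_cases (θ t x - k) 0 with h | h <;> rw [h.1] <;>
          nlinarith [sq_nonneg (θ t x + k), sq_nonneg (θ t x), sq_nonneg k]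
      linarith
    · have h1 : ∫ x in Ω, W (t, x) ^ 2 = 0 := integral_eq_zero_of_ae <| by
        filter_upwards [hWneg t h0] with x hx
        simp [hx]
      rw [h1]
      positivity
  have hmW : ∀ T : ℝ, 0 < T → MemLp (fun z ↦ m z.1 * W z) 2 (slab (volume.restrict Ω) T) :=
    fun T hT ↦ (hWB T hT).elim fun B hB ↦ memLp_mul_of_integral_sq_le hm (hW T hT) hB
  have iE : ∀ T : ℝ, 0 < T → Integrable (fun z ↦ W z ^ 2 / 2) (slab (volume.restrict Ω) T) :=
    fun T hT ↦ ((memLp_two_iff_integrable_sq (hW T hT).1).1 (hW T hT)).div_const 2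
  have igE : ∀ T : ℝ, 0 < T → Integrable (fun z ↦ g z.1 * (W z ^ 2 / 2))
      (slab (volume.restrict Ω) T) := fun T hT ↦ by
    have h1 : MemLp (fun z ↦ m z.1 * W z * W z) 1 (slab (volume.restrict Ω) T) :=
      (hW T hT).mul (hmW T hT)
    have h2 : MemLp (fun z ↦ m z.1 * W z * (m z.1 * W z)) 1 (slab (volume.restrict Ω) T) :=
      (hmW T hT).mul (hmW T hT)
    refine (memLp_one_iff_integrable.1
      ((h1.const_mul (C / 2)).add (h2.const_mul (C ^ 2 / (4 * ϰ))))).congr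
      (Eventually.of_forall fun z ↦ ?_)
    simp only [Pi.add_apply, hgdef]
    field_simp
    ring
  have hEl : LocallyIntegrable E := locallyIntegrable_of_forall_Ioo fun T hT ↦
    (iE T hT).integral_prod_left
  have hgEl : LocallyIntegrable fun t ↦ g t * E t := locallyIntegrable_of_forall_Ioo fun T hT ↦ by
    refine (igE T hT).integral_prod_left.congr (Eventually.of_forall fun t ↦ ?_)
    simp only [integral_const_mul, hEdef]
  have hgl : LocallyIntegrable g := locallyIntegrable_of_forall_Ioo fun T hT ↦ by
    have hmT : MemLp m 2 (volume.restrict (Ioo (-T) T)) := hm.restrict _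
    exact ((hmT.integrable one_le_two).const_mul C).add
      (((memLp_two_iff_integrable_sq hmT.1).1 hmT).const_mul _)
  have hdist : ∀ χ : ℝ → ℝ, ContDiff ℝ ∞ χ → HasCompactSupport χ → (∀ t, 0 ≤ χ t) →
      -∫ t, deriv χ t * E t ≤ ∫ t, χ t * (g t * E t) := fun χ hχ hχc hχ0 ↦ by
    have key := energy_inequality hΩ hϰ hC hm0 hm.1 hE hθ₀ hk hv hmW hflux hweak hχ hχc hχ0
    have hχ1 : ContDiff ℝ 1 χ := hχ.of_le (by exact_mod_cast le_top)
    have hχ' : Continuous (deriv χ) := hχ1.continuous_deriv le_rfl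
    obtain ⟨L, hL, hL0⟩ := exists_forall_le_abs_eq_zero hχc
    obtain ⟨L', hL', hL0'⟩ := exists_forall_le_abs_eq_zero hχc.deriv
    obtain ⟨B, hB⟩ := hχc.exists_bound_of_continuous hχ.continuous
    obtain ⟨B', hB'⟩ := hχc.deriv.exists_bound_of_continuous hχ'
    have i1 := memLp_one_iff_integrable.1 (memLp_mul_of_slab
      (memLp_one_iff_integrable.2 (iE L' hL')) hχ' hB' hL0')
    have i2 := memLp_one_iff_integrable.1 (memLp_mul_of_slab
      (memLp_one_iff_integrable.2 (igE L hL)) hχ.continuous hB hL0)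
    simp only [smul_eq_mul] at i1 i2
    have e1 := integral_prod _ i1
    have e2 := integral_prod _ i2
    simp only [integral_const_mul] at e1 e2
    rw [← e1, ← e2]
    exact key
  have h1 := ae_le_intervalIntegral_of_distributional hEl hgEl hEneg
    (fun t ht ↦ by rw [hEneg t ht, mul_zero]) (fun t ↦ mul_nonneg (hgn t) (hEn t)) hdist
  have h2 := eq_zero_of_le_intervalIntegral hgl hgn hEn hgEl h1
  rw [ae_restrict_iff' measurableSet_Ioi]
  filter_upwards [h2, hWslice] with t ht hWt h0
  have i := ((memLp_two_iff_integrable_sq (hWt h0).1).1 (hWt h0)).div_const 2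
  have h3 := (integral_eq_zero_iff_of_nonneg (fun x ↦ by positivity) i).1 (ht h0)
  filter_upwards [h3] with x hx
  have h4 : W (t, x) = 0 := by simpa using hx
  rw [hWdef] at h4
  simp only [extendPast_of_pos h0] at h4
  have := le_max_left (θ t x - k) 0
  linarith

end EnergyInequality

end HeatFlow

/-! ### Flux bound for the given velocity and conclusion -/

namespace HeatFlow

open Filter Topology ENNReal

/-- The constant of the flux inequality depends only on the cylinder, so one `C` serves almost every
time slice and all time dependence is in `m`. -/
theorem IsVelocity.exists_flux_bound {φ₀ : E2 → ℝ} {c₀ a : ℝ} {d₁ d₂ : ℝ → E2 → ℝ}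
    {v : ℝ → E3 → E3} (hD : IsCrossSection φ₀ c₀) (ha : 0 < a)
    (hd : IsFluxData (section2 φ₀ c₀) d₁ d₂) (hv : IsVelocity φ₀ c₀ a d₁ d₂ v) :
    ∃ (C : ℝ) (m : ℝ → ℝ), 0 ≤ C ∧ (∀ t, 0 ≤ m t) ∧ MemLp m 2 volume ∧
      ∀ᵐ t : ℝ, 0 < t → ∀ (w : E3 → ℝ) (H : E3 → E3), HasH1Gradient (cylinder φ₀ c₀ a) w H →
        (∀ᵐ x ∂(volume.restrict (cylinder φ₀ c₀ a)), 0 ≤ w x) →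
        -∫ x in cylinder φ₀ c₀ a, inner ℝ (v t x) (H x)
          ≤ m t * (C * ∫ x in cylinder φ₀ c₀ a, (w x + ‖H x‖)) := by
  obtain ⟨C, hC, hflux⟩ := hD.exists_flux_const ha
  obtain ⟨m, hm0, hm, hdm⟩ := hd.exists_inflow_bound
  have := hD.isFiniteMeasure_cylinder (a := a)
  have hvs : ∀ᵐ t : ℝ, 0 < t → MemLp (v t) 2 (volume.restrict (cylinder φ₀ c₀ a)) := by
    refine ae_slice_of_ae_restrict_Ioi (ae_restrict_Ioi_of_forall_Ioo fun T hT ↦ ?_)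
    exact ae_memLp_two_slice_of_restrict (hv.memLp T hT)
  refine ⟨C, m, hC, hm0, hm, ?_⟩
  filter_upwards [hdm, hvs, ae_slice_of_ae_restrict_Ioi hv.gauss_green] with t h1 h2 h3 h0
  exact hflux _ _ _ _ (h3 h0) (h2 h0) (hm0 t) (h1 h0).1 (h1 h0).2

theorem InEnergyClass.neg {Ω : Set E3} {θ : ℝ → E3 → ℝ} {G : ℝ → E3 → E3}
    (h : InEnergyClass Ω θ G) : InEnergyClass Ω (fun t x ↦ -θ t x) (fun t x ↦ -G t x) where
  memLp T hT := (h.memLp T hT).neg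
  memLp_grad T hT := (h.memLp_grad T hT).neg
  hasGradient := h.hasGradient.mono fun _ ht ↦ ht.neg
  essBounded T hT := by
    obtain ⟨C, hC⟩ := h.essBounded T hT
    exact ⟨C, hC.mono fun t ht ↦ (eLpNorm_neg (θ t) 2 _).trans_le ht⟩

end HeatFlow
theorem lemma2p4 (φ₀ : HeatFlow.E2 → ℝ) (c₀ a ϰ : ℝ)
    (hD : HeatFlow.IsCrossSection φ₀ c₀) (ha : 0 < a) (hϰ : 0 < ϰ)
    (d₁ d₂ : ℝ → HeatFlow.E2 → ℝ)
    (hd : HeatFlow.IsFluxData (HeatFlow.section2 φ₀ c₀) d₁ d₂)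
    (v : ℝ → HeatFlow.E3 → HeatFlow.E3)
    (hv : HeatFlow.IsVelocity φ₀ c₀ a d₁ d₂ v)
    (θlow θupp : ℝ) (hlow : 0 < θlow) (hlt : θlow < θupp)
    (θ₀ : HeatFlow.E3 → ℝ)
    (hθ₀m : AEStronglyMeasurable θ₀ (volume.restrict (HeatFlow.cylinder φ₀ c₀ a)))
    (hθ₀ : ∀ᵐ x ∂(volume.restrict (HeatFlow.cylinder φ₀ c₀ a)), θlow ≤ θ₀ x ∧ θ₀ x ≤ θupp)
    (θ : ℝ → HeatFlow.E3 → ℝ)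
    (hθ : HeatFlow.IsWeakHeatSolution (HeatFlow.cylinder φ₀ c₀ a) ϰ v θ₀ θ) :
    ∀ᵐ t ∂(volume.restrict (Ioi (0 : ℝ))),
      ∀ᵐ x ∂(volume.restrict (HeatFlow.cylinder φ₀ c₀ a)), θlow ≤ θ t x ∧ θ t x ≤ θupp := by
  have := hD.isFiniteMeasure_cylinder (a := a)
  have hΩ : IsOpen (HeatFlow.cylinder φ₀ c₀ a) := hD.isOpen_cylinder
  obtain ⟨C, m, hC, hm0, hm, hflux⟩ := hv.exists_flux_bound hD ha hd
  obtain ⟨G, hE, hweak⟩ := hθ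
  have hθ₀2 : MemLp θ₀ 2 (volume.restrict (HeatFlow.cylinder φ₀ c₀ a)) := by
    refine MemLp.of_bound hθ₀m θupp ?_
    filter_upwards [hθ₀] with x hx
    rw [Real.norm_eq_abs, abs_of_pos (hlow.trans_le hx.1)]
    exact hx.2
  have hupp := HeatFlow.ae_le_of_energy_inequality hΩ hϰ hC hm0 hm hE hθ₀2
    (hθ₀.mono fun x hx ↦ hx.2) hv.memLp hflux hweak
  -- The problem is linear in `θ` and the flux bound concerns `v` alone, so `-θ` solves it with
  -- initial values `-θ₀ ≤ -θlow`; its upper bound is the lower bound for `θ`.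
  have hlow' := HeatFlow.ae_le_of_energy_inequality (k := -θlow) (θ₀ := fun x ↦ -θ₀ x) hΩ hϰ hC hm0
    hm hE.neg hθ₀2.neg (hθ₀.mono fun x hx ↦ neg_le_neg hx.1) hv.memLp hflux
    fun φ Φ hφ hφb η hη hηc ↦ by
      have h := congrArg Neg.neg (hweak φ Φ hφ hφb η hη hηc)
      simp only [inner_neg_left, inner_neg_right, neg_mul, mul_neg, ← neg_add, integral_neg]
      rw [← h, neg_add]
  filter_upwards [hupp, hlow'] with t h1 h2
  filter_upwards [h1, h2] with x hx1 hx2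
  exact ⟨neg_le_neg_iff.1 hx2, hx1⟩
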